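/- Let $\Gamma=\mathrm{SL}_2(\mathbb Z)$, let $k\ge 2$ and $N\ge 1$ be integers, and let $\mathcal G\subseteq\Gamma$ be a congruence subgroup containing $\Gamma(N)$. *Cusps and vectors.* Let $\mathcal C(\mathcal G)=\mathcal G\backslash\mathbb P^1(\mathbb Q)$ be the set of cusps of $\mathcal G$. A cusp $\mathcal G\sigma\infty$ ($\sigma\in\Gamma$) is called regular if, for every $b\in\mathbb Z$ with $T^b\in\sigma^{-1}\mathcal G\sigma$ or $-T^b\in\sigma^{-1}\mathcal G\sigma$, one has $T^b\in\sigma^{-1}\mathcal G\sigma$, where $T=\begin{pmatrix}1&1\\0&1\end{pmatrix}$. Let $\Lambda_N$ be the set of row vectors of additive order $N$ in $(\mathbb Z/N\mathbb Z)^2$, on which $\Gamma$ acts from the right, and let $\Lambda_N^{\pm}=\Lambda_N/\{\pm1\}$. The map $\phi_N:\mathcal C(\Gamma(N))\to\Lambda_N^{\pm}$, $\Gamma(N)\tfrac{\alpha}{\beta}\mapsto[\overline{(\beta,-\alpha)}]$ (with $\gcd(\alpha,\beta)=1$), is a bijection satisfying $\phi_N(\gamma y)=\phi_N(y)\gamma^{-1}$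 for $\gamma\in\Gamma$. For $x\in\mathcal C(\mathcal G)$ let $\mathrm{or}(x)\subseteq\mathcal C(\Gamma(N))$ be the finite set of cusps of $\Gamma(N)$ lying over $x$ (a $\mathcal G$-orbit). Scalar multiplication of $(\mathbb Z/N\mathbb Z)^\times$ on $\Lambda_N$ commutes with $\Gamma$, and through $\phi_N$ it induces an action of $(\mathbb Z/N\mathbb Z)^\times$ on $\mathcal C(\mathcal G)$. *Choices.* Let $\mathcal A\subseteq\Lambda_N$ be a set of representatives for $\Lambda_N^{\pm}$; for $y\in\mathcal C(\Gamma(N))$ let $\bar\lambda_y\in\mathcal A$ be the representative of $\phi_N(y)$. For each $x\in\mathcal C(\mathcal G)$ choose a scaling matrix $\sigma_x\in\Gamma$ such that $\sigma_x\infty$ represents $x$, and put $\mathcal O_x=\bar\lambda_{x}\mathcal G$, where $\bar\lambda_x=\bar\lambda_{\Gamma(N)\sigma_x\infty}$. If $k$ is odd, assume moreover that $-\mathrm{Id}\notin\mathcal G$; that $\mathcal A$ is $\mathcal G$-admissible, i.e. every $\mathcal G$-orbit $\mathcal O\subseteq\Lambda_N$ with $\mathcal O\cap(-\mathcal O)=\emptyset$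 and $\mathcal O\cap\mathcal A\ne\emptyset$ satisfies $\mathcal O\subseteq\mathcal A$; and that the scaling matrices are compatible with $\mathcal A$, i.e. $\overline{(0,1)}\sigma_x^{-1}=\bar\lambda_x$ for each regular cusp $x$. Put $$\varepsilon_{\mathcal A}(\bar\delta)=\varepsilon_{\mathcal A,x}(\bar\delta)=\begin{cases}1,&\bar\delta^{-1}\mathcal O_x=\mathcal O_{\bar\delta^{-1}x},\\-1,&\text{otherwise.}\end{cases}$$ *Series.* Let $\epsilon_N=\tfrac12$ if $N\in\{1,2\}$ and $\epsilon_N=1$ if $N\ge3$. For $\tau$ in the upper half-plane, $\mathrm{Re}(k+2s)>2$, and a cusp $x$ of $\mathcal G$ (regular if $k$ is odd), put $$G_{k,x}(\tau;s)=\sum_{y\in\mathrm{or}(x)}\ \sum_{\substack{(c,d)\in\mathbb Z^2\setminus\{(0,0)\}\\(c,d)\equiv\bar\lambda_y\ (N)}}\frac{\mathrm{Im}(\tau)^s}{(c\tau+d)^k|c\tau+d|^{2s}},\qquad E_{k,x}(\tau;s)=\sum_{\gamma\in\mathcal G_{\sigma_x\infty}\backslash\mathcal G}\mathbf j(\sigma_x^{-1}\gamma,\tau)^{-k}\,\mathrm{Im}(\sigma_x^{-1}\gamma\tau)^s,$$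 where $\mathcal G_{\sigma_x\infty}$ is the stabilizer of $\sigma_x\infty$ in $\mathcal G$ and $\mathbf j\left(\begin{pmatrix}a&b\\c&d\end{pmatrix},\tau\right)=c\tau+d$. For $\mathrm{Re}(z)>1$ put $$\zeta_+^{(N)}(\delta,z)=\sum_{\substack{n\ge1\\n\equiv\delta\,(N)}}\frac1{n^{z}},\qquad \zeta_+^{(N)}(\mu;\delta,z)=\sum_{\substack{n\ge1\\n\equiv\delta\,(N)}}\frac{\mu(n)}{n^{z}},$$ where $\mu$ is the Möbius function. **Proposition.** For every $\tau$ and every cusp $x$ of $\mathcal G$ (regular if $k$ is odd), the functions $s\mapsto G_{k,x}(\tau;s)$ and $s\mapsto E_{k,x}(\tau;s)$ continue analytically to the half-plane $\mathrm{Re}(k+2s)>1$, and for every $s$ in this half-plane the continued functions satisfy $$G_{k,x}(\tau;s)=\epsilon_N^{-1}\sum_{\bar\delta\in(\mathbb Z/N\mathbb Z)^\times}\varepsilon_{\mathcal A}(\bar\delta)^k\,\zeta_+^{(N)}(\delta,k+2s)\,E_{k,\bar\delta^{-1}x}(\tau;s),$$ $$E_{k,x}(\tau;s)=\epsilon_N\sum_{\bar\delta\in(\mathbb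 Z/N\mathbb Z)^\times}\varepsilon_{\mathcal A}(\bar\delta)^k\,\zeta_+^{(N)}(\mu;\delta,k+2s)\,G_{k,\bar\delta^{-1}x}(\tau;s).$$ -/

import Mathlib

noncomputable section

namespace CongEis

open Matrix OnePoint UpperHalfPlane
open scoped MatrixGroups

/-! ### Cusps -/

/-- `SL(2, ℤ)` acts on `ℙ¹(ℚ) = ℚ ∪ {∞}` by Möbius transformations. -/
instance : MulAction SL(2, ℤ) (OnePoint ℚ) :=
  MulAction.compHom (OnePoint ℚ) (Matrix.SpecialLinearGroup.mapGL ℚ : SL(2, ℤ) →* GL (Fin 2) ℚ)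

lemma smul_point_def (γ : SL(2, ℤ)) (p : OnePoint ℚ) :
    γ • p = (Matrix.SpecialLinearGroup.mapGL ℚ γ : GL (Fin 2) ℚ) • p := rfl

/-- The set `𝒞(𝒢)` of cusps of `𝒢`: the `𝒢`-orbits in `ℙ¹(ℚ)`. -/
abbrev Cusp (𝒢 : Subgroup SL(2, ℤ)) : Type := MulAction.orbitRel.Quotient 𝒢 (OnePoint ℚ)

/-- The cusp of `𝒢` represented by a point of `ℙ¹(ℚ)`. -/
def Cusp.mk (𝒢 : Subgroup SL(2, ℤ)) (p : OnePoint ℚ) : Cusp 𝒢 := Quotient.mk'' p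

lemma Cusp.mk_smul {𝒢 : Subgroup SL(2, ℤ)} {γ : SL(2, ℤ)} (hγ : γ ∈ 𝒢) (p : OnePoint ℚ) :
    Cusp.mk 𝒢 (γ • p) = Cusp.mk 𝒢 p :=
  Quotient.sound' ⟨⟨γ, hγ⟩, rfl⟩

lemma exists_smul_infty (p : OnePoint ℚ) : ∃ g : SL(2, ℤ), g • (∞ : OnePoint ℚ) = p :=
  OnePoint.exists_mem_SL2 ℤ p

/-- The natural map `𝒞(Γ(N)) → 𝒞(𝒢)` for `Γ(N) ≤ 𝒢`. -/
def cuspMap {N : ℕ} {𝒢 : Subgroup SL(2, ℤ)} (h : CongruenceSubgroup.Gamma N ≤ 𝒢) :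
    Cusp (CongruenceSubgroup.Gamma N) → Cusp 𝒢 :=
  Quotient.lift (Cusp.mk 𝒢) (by
    rintro _ p ⟨⟨γ, hγ⟩, rfl⟩
    exact Cusp.mk_smul (h hγ) p)

/-- `or_{𝒢,N}(x)`: the `𝒢`-orbit in `𝒞(Γ(N))` formed by the cusps of `Γ(N)` that lie
over the cusp `x` of `𝒢`. -/
def cuspOrbit {N : ℕ} {𝒢 : Subgroup SL(2, ℤ)} (h : CongruenceSubgroup.Gamma N ≤ 𝒢)
    (x : Cusp 𝒢) : Set (Cusp (CongruenceSubgroup.Gamma N)) :=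
  {y | cuspMap h y = x}

/-- The cusp `x = 𝒢 σ∞` is regular if `σ⁻¹ 𝒢 σ` is regular at `∞`, that is, if every integer `b`
with `± [1, b; 0, 1] ∈ σ⁻¹ 𝒢 σ` satisfies `[1, b; 0, 1] ∈ σ⁻¹ 𝒢 σ`. -/
def IsRegularCusp {𝒢 : Subgroup SL(2, ℤ)} (x : Cusp 𝒢) : Prop :=
  ∀ σ : SL(2, ℤ), Cusp.mk 𝒢 (σ • (∞ : OnePoint ℚ)) = x →
    ((𝒢.map (MulAut.conj σ⁻¹).toMonoidHom).map
      (Matrix.SpecialLinearGroup.toGL : SL(2, ℤ) →* GL (Fin 2) ℤ)).IsRegularAtInfty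

/-! ### The lattice modulo `N` -/

/-- `Λ_N`: the elements of order `N` in `(ℤ/N)²`. -/
@[ext]
structure Lat (N : ℕ) where
  val : Fin 2 → ZMod N
  order_eq : addOrderOf val = N

instance (N : ℕ) [NeZero N] : Finite (Lat N) :=
  Finite.of_injective Lat.val (fun _ _ => Lat.ext)

instance (N : ℕ) : Neg (Lat N) := ⟨fun v => ⟨-v.val, by rw [addOrderOf_neg]; exact v.order_eq⟩⟩

lemma Lat.neg_val {N : ℕ} (v : Lat N) : (-v).val = -v.val := rfl

/-- Reduction of a matrix modulo `N`. -/
def redN (N : ℕ) (γ : SL(2, ℤ)) : Matrix (Fin 2) (Fin 2) (ZMod N) :=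
  (Int.castRingHom (ZMod N)).mapMatrix (γ : Matrix (Fin 2) (Fin 2) ℤ)

lemma redN_mul (N : ℕ) (γ γ' : SL(2, ℤ)) : redN N (γ * γ') = redN N γ * redN N γ' := by
  rw [redN, Matrix.SpecialLinearGroup.coe_mul, map_mul]; rfl

lemma redN_one (N : ℕ) : redN N 1 = 1 := by
  rw [redN, Matrix.SpecialLinearGroup.coe_one, map_one]

/-- The right action of `SL(2, ℤ)` on row vectors in `Λ_N`. -/
def Lat.act {N : ℕ} (v : Lat N) (γ : SL(2, ℤ)) : Lat N :=
  ⟨v.val ᵥ* redN N γ, by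
    have hinj : Function.Injective
        (Matrix.vecMulLinear (redN N γ) : (Fin 2 → ZMod N) →ₗ[ZMod N] _).toAddMonoidHom := by
      intro a b hab
      have hab' : a ᵥ* redN N γ = b ᵥ* redN N γ := hab
      have := congrArg (fun w => w ᵥ* redN N γ⁻¹) hab'
      simpa only [Matrix.vecMul_vecMul, ← redN_mul, mul_inv_cancel, redN_one,
        Matrix.vecMul_one] using this
    exact (addOrderOf_injective _ hinj v.val).trans v.order_eq⟩

lemma Lat.act_val {N : ℕ} (v : Lat N) (γ : SL(2, ℤ)) : (v.act γ).val = v.val ᵥ* redN N γ := rfl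

lemma Lat.act_mul {N : ℕ} (v : Lat N) (γ γ' : SL(2, ℤ)) :
    v.act (γ * γ') = (v.act γ).act γ' := by
  apply Lat.ext
  simp only [Lat.act_val, redN_mul, Matrix.vecMul_vecMul]

lemma Lat.neg_act {N : ℕ} (v : Lat N) (γ : SL(2, ℤ)) : (-v).act γ = -(v.act γ) :=
  Lat.ext (by rw [Lat.act_val, Lat.neg_val, Lat.neg_val, Lat.act_val, Matrix.neg_vecMul])

lemma Lat.act_of_mem {N : ℕ} (v : Lat N) {γ : SL(2, ℤ)} (hγ : γ ∈ CongruenceSubgroup.Gamma N) :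
    v.act γ = v := by
  apply Lat.ext
  have : redN N γ = 1 := congrArg Subtype.val (CongruenceSubgroup.Gamma_mem'.mp hγ)
  rw [Lat.act_val, this, Matrix.vecMul_one]

/-- Scalar multiplication by `(ℤ/N)ˣ` on `Λ_N`. -/
def Lat.scale {N : ℕ} (δ : (ZMod N)ˣ) (v : Lat N) : Lat N :=
  ⟨δ • v.val, by
    have hinj : Function.Injective (DistribSMul.toAddMonoidHom (Fin 2 → ZMod N) δ) :=
      MulAction.injective δ
    exact (addOrderOf_injective _ hinj v.val).trans v.order_eq⟩

lemma Lat.scale_neg {N : ℕ} (δ : (ZMod N)ˣ) (v : Lat N) : (-v).scale δ = -(v.scale δ) :=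
  Lat.ext (smul_neg _ _)

lemma Lat.scale_act {N : ℕ} (δ : (ZMod N)ˣ) (v : Lat N) (γ : SL(2, ℤ)) :
    (v.act γ).scale δ = (v.scale δ).act γ :=
  Lat.ext (show δ • (v.val ᵥ* redN N γ) = (δ • v.val) ᵥ* redN N γ by rw [Matrix.smul_vecMul])

/-- The equivalence relation `μ = ± λ` on `Λ_N`. -/
def pmSetoid (N : ℕ) : Setoid (Lat N) where
  r v w := w = v ∨ w = -v
  iseqv :=
    { refl := fun _ => Or.inl rfl
      symm := by
        rintro v w (rfl | rfl)
        · exact Or.inl rfl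
        · exact Or.inr (Lat.ext (by simp [Lat.neg_val]))
      trans := by
        rintro u v w (rfl | rfl) (rfl | rfl)
        · exact Or.inl rfl
        · exact Or.inr rfl
        · exact Or.inr rfl
        · exact Or.inl (Lat.ext (by simp [Lat.neg_val])) }

/-- `Λ_N^± = Λ_N / {± Id}`. -/
def LatPM (N : ℕ) : Type := Quotient (pmSetoid N)

/-- The projection `Π_N : Λ_N → Λ_N^±`. -/
def LatPM.mk {N : ℕ} (v : Lat N) : LatPM N := Quotient.mk (pmSetoid N) v

lemma LatPM.mk_eq_iff {N : ℕ} {v w : Lat N} : LatPM.mk v = LatPM.mk w ↔ w = v ∨ w = -v :=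
  ⟨fun h => Quotient.exact h, fun h => Quotient.sound h⟩

instance (N : ℕ) [NeZero N] : Finite (LatPM N) := Quotient.finite _

/-- The action of `SL(2, ℤ)` on `Λ_N^±`. -/
def LatPM.act {N : ℕ} (θ : LatPM N) (γ : SL(2, ℤ)) : LatPM N :=
  Quotient.lift (fun v : Lat N => LatPM.mk (v.act γ)) (by
    rintro v w (rfl | rfl)
    · rfl
    · exact LatPM.mk_eq_iff.mpr (Or.inr (Lat.neg_act v γ))) θ

/-- The action of `(ℤ/N)ˣ` on `Λ_N^±`. -/
def LatPM.scale {N : ℕ} (δ : (ZMod N)ˣ) (θ : LatPM N) : LatPM N :=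
  Quotient.lift (fun v : Lat N => LatPM.mk (v.scale δ)) (by
    rintro v w (rfl | rfl)
    · rfl
    · exact LatPM.mk_eq_iff.mpr (Or.inr (Lat.scale_neg δ v))) θ

lemma LatPM.scale_act {N : ℕ} (δ : (ZMod N)ˣ) (θ : LatPM N) (γ : SL(2, ℤ)) :
    (θ.act γ).scale δ = (θ.scale δ).act γ := by
  induction θ using Quotient.inductionOn with
  | h v => exact congrArg LatPM.mk (Lat.scale_act δ v γ)

/-! ### The bijection `φ_N : 𝒞(Γ(N)) → Λ_N^±` -/

/-- For `p = α/β` in lowest terms the row vector `(β, -α)`; `∞ = 1/0`. -/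
def primVec : OnePoint ℚ → Fin 2 → ℤ :=
  fun p => p.elim ![0, -1] (fun q : ℚ => ![(q.den : ℤ), -q.num])

lemma isCoprime_primVec (p : OnePoint ℚ) : IsCoprime (primVec p 0) (primVec p 1) := by
  induction p using OnePoint.rec with
  | infty => exact ⟨0, -1, by simp [primVec]⟩
  | coe q =>
    have : IsCoprime (q.den : ℤ) (-q.num) := by
      rw [IsCoprime.neg_right_iff, isCoprime_comm, Int.isCoprime_iff_gcd_eq_one]
      exact q.reduced
    simpa [primVec] using this

lemma addOrderOf_of_isCoprime (N : ℕ) {v : Fin 2 → ℤ} (hv : IsCoprime (v 0) (v 1)) :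
    addOrderOf (fun i => (v i : ZMod N)) = N := by
  rw [← Nat.dvd_right_iff_eq]
  intro n
  rw [addOrderOf_dvd_iff_nsmul_eq_zero]
  constructor
  · intro h
    obtain ⟨a, b, hab⟩ := hv
    have h0 : ((n : ℤ) * v 0 : ZMod N) = 0 := by simpa using congrFun h 0
    have h1 : ((n : ℤ) * v 1 : ZMod N) = 0 := by simpa using congrFun h 1
    have : ((n : ℕ) : ZMod N) = 0 := by
      have e : ((n : ℤ) : ZMod N) = ((a * (n * v 0) + b * (n * v 1) : ℤ) : ZMod N) := by
        congr 1
        linear_combination -(n : ℤ) * hab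
      have e' : ((n : ℤ) : ZMod N) = 0 := by
        rw [e]
        push_cast at h0 h1 ⊢
        rw [h0, h1]
        simp
      exact_mod_cast e'
    exact (ZMod.natCast_eq_zero_iff n N).mp this
  · intro h
    have := (ZMod.natCast_eq_zero_iff n N).mpr h
    ext i
    simp [this]

/-- The reduction modulo `N` of a primitive vector. -/
def Lat.ofPrim (N : ℕ) (v : Fin 2 → ℤ) (hv : IsCoprime (v 0) (v 1)) : Lat N :=
  ⟨fun i => (v i : ZMod N), addOrderOf_of_isCoprime N hv⟩

/-- The class of `(0, 1)` in `Λ_N`. -/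
def Lat.base (N : ℕ) : Lat N := Lat.ofPrim N ![0, 1] ⟨0, 1, by simp⟩

/-- `φ_N` on points of `ℙ¹(ℚ)`: `α/β ↦ [(β, -α)]`. -/
def phiPoint (N : ℕ) (p : OnePoint ℚ) : LatPM N :=
  LatPM.mk (Lat.ofPrim N (primVec p) (isCoprime_primVec p))

lemma base_act_val (N : ℕ) (g : SL(2, ℤ)) :
    ((Lat.base N).act g).val = fun i => ((g 1 i : ℤ) : ZMod N) := by
  ext i
  simp [Lat.act_val, redN, Lat.base, Lat.ofPrim, Matrix.vecMul, dotProduct, Fin.sum_univ_two]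

lemma coprime_unique {a b c d : ℤ} (h₁ : IsCoprime a b) (h₂ : IsCoprime c d)
    (h : a * d = b * c) : (c = a ∧ d = b) ∨ (c = -a ∧ d = -b) := by
  have hac : a ∣ c := h₁.dvd_of_dvd_mul_left ⟨d, h.symm⟩
  have hca : c ∣ a := h₂.dvd_of_dvd_mul_right ⟨b, by linarith⟩
  obtain ⟨e, he⟩ := hac
  obtain ⟨f, hf⟩ := hca
  have hbd : b ∣ d := h₁.symm.dvd_of_dvd_mul_left ⟨c, h⟩
  have hdb : d ∣ b := h₂.symm.dvd_of_dvd_mul_right ⟨a, by linarith⟩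
  have h1 := Int.natAbs_eq_natAbs_iff.mp
    (Nat.dvd_antisymm (Int.natAbs_dvd_natAbs.mpr ⟨f, hf⟩) (Int.natAbs_dvd_natAbs.mpr ⟨e, he⟩))
  have h2 := Int.natAbs_eq_natAbs_iff.mp
    (Nat.dvd_antisymm (Int.natAbs_dvd_natAbs.mpr hdb) (Int.natAbs_dvd_natAbs.mpr hbd))
  rcases h1 with h1 | h1 <;> rcases h2 with h2 | h2
  · exact Or.inl ⟨h1, h2⟩
  · subst h1 h2
    have : c * b = 0 := by linarith
    rcases mul_eq_zero.mp this with h0 | h0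
    · exact Or.inr ⟨by omega, rfl⟩
    · exact Or.inl ⟨rfl, by omega⟩
  · subst h1 h2
    have : a * d = 0 := by linarith
    rcases mul_eq_zero.mp this with h0 | h0
    · exact Or.inl ⟨by omega, rfl⟩
    · exact Or.inr ⟨rfl, by omega⟩
  · exact Or.inr ⟨h1, h2⟩

lemma primVec_smul_infty (g : SL(2, ℤ)) :
    primVec (g • (∞ : OnePoint ℚ)) 0 * g 0 0 = primVec (g • (∞ : OnePoint ℚ)) 1 * -g 1 0 := by
  rw [smul_point_def, OnePoint.smul_infty_eq_ite]
  by_cases hc : g 1 0 = 0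
  · simp [hc, primVec]
  · have hc' : ((g 1 0 : ℤ) : ℚ) ≠ 0 := by exact_mod_cast hc
    have h := Rat.num_div_den (((g 0 0 : ℤ) : ℚ) / ((g 1 0 : ℤ) : ℚ))
    have hd : ((((g 0 0 : ℤ) : ℚ) / ((g 1 0 : ℤ) : ℚ)).den : ℚ) ≠ 0 := by
      exact_mod_cast Rat.den_nz _
    rw [div_eq_div_iff hd hc'] at h
    have h' : (((g 0 0 : ℤ) : ℚ) / ((g 1 0 : ℤ) : ℚ)).num * g 1 0 =
        g 0 0 * (((g 0 0 : ℤ) : ℚ) / ((g 1 0 : ℤ) : ℚ)).den := by exact_mod_cast h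
    simp [hc, primVec]
    linarith

lemma phiPoint_smul_infty (N : ℕ) (g : SL(2, ℤ)) :
    phiPoint N (g • (∞ : OnePoint ℚ)) = LatPM.mk ((Lat.base N).act g⁻¹) := by
  have hcop : IsCoprime (-g 1 0) (g 0 0) := by
    have hdet := g.det_coe
    rw [Matrix.det_fin_two] at hdet
    exact ⟨g 0 1, g 1 1, by linarith⟩
  have h0 : (g⁻¹ : SL(2, ℤ)) 1 0 = -g 1 0 := by
    rw [Matrix.SpecialLinearGroup.coe_inv, Matrix.adjugate_fin_two]; simp
  have h1 : (g⁻¹ : SL(2, ℤ)) 1 1 = g 0 0 := by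
    rw [Matrix.SpecialLinearGroup.coe_inv, Matrix.adjugate_fin_two]; simp
  apply LatPM.mk_eq_iff.mpr
  rcases coprime_unique (isCoprime_primVec (g • (∞ : OnePoint ℚ))) hcop (primVec_smul_infty g)
    with ⟨e0, e1⟩ | ⟨e0, e1⟩
  · left
    apply Lat.ext
    rw [base_act_val]
    ext i
    fin_cases i
    · simp only [Lat.ofPrim, Fin.zero_eta, h0, e0]
    · simp only [Lat.ofPrim, Fin.mk_one, h1, e1]
  · right
    apply Lat.ext
    rw [base_act_val, Lat.neg_val]
    ext i
    fin_cases i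
    · simp only [Lat.ofPrim, Fin.zero_eta, h0, e0, Pi.neg_apply, Int.cast_neg]
    · simp only [Lat.ofPrim, Fin.mk_one, h1, e1, Pi.neg_apply, Int.cast_neg]

lemma phiPoint_smul (N : ℕ) (γ : SL(2, ℤ)) (p : OnePoint ℚ) :
    phiPoint N (γ • p) = (phiPoint N p).act γ⁻¹ := by
  obtain ⟨g, rfl⟩ := exists_smul_infty p
  rw [← mul_smul, phiPoint_smul_infty, phiPoint_smul_infty, _root_.mul_inv_rev, Lat.act_mul]
  rfl

lemma LatPM.act_of_mem {N : ℕ} (θ : LatPM N) {γ : SL(2, ℤ)}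
    (hγ : γ ∈ CongruenceSubgroup.Gamma N) : θ.act γ = θ := by
  induction θ using Quotient.inductionOn with
  | h v => exact congrArg LatPM.mk (Lat.act_of_mem v hγ)

/-- `φ_N : 𝒞(Γ(N)) → Λ_N^±`, `α/β ↦ [(β, -α)]` for coprime `α`, `β`. -/
def phi (N : ℕ) : Cusp (CongruenceSubgroup.Gamma N) → LatPM N :=
  Quotient.lift (phiPoint N) (by
    rintro _ p ⟨⟨γ, hγ⟩, rfl⟩
    exact (phiPoint_smul N γ p).trans (LatPM.act_of_mem _ (inv_mem hγ)))

lemma T_zpow_smul_infty (b : ℤ) : (ModularGroup.T ^ b) • (∞ : OnePoint ℚ) = ∞ := by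
  rw [smul_point_def, OnePoint.smul_infty_eq_self_iff]
  rw [Matrix.SpecialLinearGroup.mapGL_coe_matrix, Matrix.SpecialLinearGroup.map_apply_coe,
    ModularGroup.coe_T_zpow]
  simp

lemma neg_smul_infty (g : SL(2, ℤ)) : (-g) • (∞ : OnePoint ℚ) = g • ∞ := by
  rw [smul_point_def, smul_point_def, OnePoint.smul_infty_eq_ite, OnePoint.smul_infty_eq_ite]
  simp

lemma mk_eq_of_base_act {N : ℕ} {g h : SL(2, ℤ)}
    (e : (Lat.base N).act g⁻¹ = (Lat.base N).act h⁻¹) :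
    Cusp.mk (CongruenceSubgroup.Gamma N) (g • (∞ : OnePoint ℚ)) =
      Cusp.mk (CongruenceSubgroup.Gamma N) (h • (∞ : OnePoint ℚ)) := by
  have e1 : (Lat.base N).act (g⁻¹ * h) = Lat.base N := by
    rw [Lat.act_mul, e, ← Lat.act_mul, inv_mul_cancel]
    exact Lat.act_of_mem _ (one_mem _)
  have e2 := congrArg Lat.val e1
  rw [base_act_val] at e2
  set m := g⁻¹ * h with hm
  have hm10 : ((m 1 0 : ℤ) : ZMod N) = 0 := by
    simpa [Lat.base, Lat.ofPrim] using congrFun e2 0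
  have hm11 : ((m 1 1 : ℤ) : ZMod N) = 1 := by
    simpa [Lat.base, Lat.ofPrim] using congrFun e2 1
  have hm00 : ((m 0 0 : ℤ) : ZMod N) = 1 := by
    have hdet := m.det_coe
    rw [Matrix.det_fin_two] at hdet
    have := congrArg (Int.cast : ℤ → ZMod N) hdet
    push_cast at this
    rw [hm10, hm11] at this
    simpa using this
  have hmem : m * ModularGroup.T ^ (-m 0 1) ∈ CongruenceSubgroup.Gamma N := by
    rw [CongruenceSubgroup.Gamma_mem]
    simp only [Matrix.SpecialLinearGroup.coe_mul, ModularGroup.coe_T_zpow, Matrix.mul_apply,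
      Fin.sum_univ_two]
    simp [hm10, hm11, hm00]
  have hmem' := (CongruenceSubgroup.Gamma_normal N).conj_mem _ hmem g
  rw [← Cusp.mk_smul hmem', ← mul_smul, inv_mul_cancel_right, hm, ← mul_assoc,
    mul_inv_cancel_left, mul_smul, T_zpow_smul_infty]

lemma phi_injective (N : ℕ) : Function.Injective (phi N) := by
  intro x y
  induction x using Quotient.inductionOn with | h p
  induction y using Quotient.inductionOn with | h q
  obtain ⟨g, rfl⟩ := exists_smul_infty p
  obtain ⟨h, rfl⟩ := exists_smul_infty q
  intro e
  have e' : LatPM.mk ((Lat.base N).act g⁻¹) = LatPM.mk ((Lat.base N).act h⁻¹) := by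
    rw [← phiPoint_smul_infty, ← phiPoint_smul_infty]; exact e
  rcases LatPM.mk_eq_iff.mp e' with e' | e'
  · exact mk_eq_of_base_act e'.symm
  · have : (Lat.base N).act (-g)⁻¹ = (Lat.base N).act h⁻¹ := by
      rw [e']
      apply Lat.ext
      rw [base_act_val, Lat.neg_val, base_act_val]
      ext i
      simp
    have := mk_eq_of_base_act this
    rwa [neg_smul_infty] at this

/-- A pair with `gcd(a, b, N) = 1` and `a ≠ 0` becomes coprime after adding a multiple of `N`
to `b`. -/
lemma exists_coprime_lift (N : ℕ) (a b : ℤ) (ha : a ≠ 0)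
    (h : ∀ p : ℕ, p.Prime → (p : ℤ) ∣ a → (p : ℤ) ∣ b → ¬ p ∣ N) :
    ∃ t : ℤ, IsCoprime a (b + t * N) := by
  refine ⟨((∏ p ∈ a.natAbs.primeFactors.filter (fun p : ℕ => ¬ (p : ℤ) ∣ b), p : ℕ) : ℤ), ?_⟩
  rw [Int.isCoprime_iff_gcd_eq_one]
  by_contra hg
  obtain ⟨p, hp, hpg⟩ := Nat.exists_prime_and_dvd hg
  have hpa : (p : ℤ) ∣ a := (Int.natCast_dvd_natCast.mpr hpg).trans (Int.gcd_dvd_left _ _)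
  have hpb := (Int.natCast_dvd_natCast.mpr hpg).trans (Int.gcd_dvd_right a _)
  have hpf : p ∈ a.natAbs.primeFactors :=
    Nat.mem_primeFactors.mpr ⟨hp, Int.natCast_dvd.mp hpa, Int.natAbs_ne_zero.mpr ha⟩
  by_cases hb : (p : ℤ) ∣ b
  · have h1 := (Int.dvd_add_right hb).mp hpb
    rw [← Nat.cast_mul, Int.natCast_dvd_natCast] at h1
    rcases hp.dvd_mul.mp h1 with h2 | h2
    · obtain ⟨q, hq, hpq⟩ := (Prime.dvd_finsetProd_iff hp.prime _).mp h2
      rw [Finset.mem_filter] at hq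
      have : p = q := (Nat.prime_dvd_prime_iff_eq hp (Nat.prime_of_mem_primeFactors hq.1)).mp hpq
      exact hq.2 (this ▸ hb)
    · exact h p hp hpa hb h2
  · apply hb
    refine (Int.dvd_add_left ?_).mp hpb
    refine Dvd.dvd.mul_right (Int.natCast_dvd_natCast.mpr ?_) _
    exact Finset.dvd_prod_of_mem _ (Finset.mem_filter.mpr ⟨hpf, hb⟩)

lemma base_act_surjective (N : ℕ) [NeZero N] (v : Lat N) :
    ∃ g : SL(2, ℤ), (Lat.base N).act g = v := by
  obtain ⟨w, hw⟩ := v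
  have hN : (N : ℤ) ≠ 0 := by exact_mod_cast NeZero.ne N
  obtain ⟨a, ha, ha0⟩ : ∃ a : ℤ, (a : ZMod N) = w 0 ∧ a ≠ 0 := by
    obtain ⟨a, ha⟩ := ZMod.intCast_surjective (w 0)
    by_cases h : a = 0
    · exact ⟨N, by rw [← ha, h]; simp, hN⟩
    · exact ⟨a, ha, h⟩
  obtain ⟨b, hb⟩ := ZMod.intCast_surjective (w 1)
  obtain ⟨t, ht⟩ := exists_coprime_lift N a b ha0 (by
    intro p hp hpa hpb hpN
    obtain ⟨m, hm⟩ := hpN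
    obtain ⟨a', rfl⟩ := hpa
    obtain ⟨b', rfl⟩ := hpb
    have hz : ((m : ZMod N) * p) = 0 := by
      rw [mul_comm, ← Nat.cast_mul, ← hm, ZMod.natCast_self]
    have : m • w = 0 := by
      ext i
      fin_cases i
      · simp [← ha, ← mul_assoc, hz]
      · simp [← hb, ← mul_assoc, hz]
    have hd := addOrderOf_dvd_of_nsmul_eq_zero this
    rw [hw, hm] at hd
    have hm0 : m ≠ 0 := by
      rintro rfl
      exact NeZero.ne N (by simpa using hm)
    have := Nat.le_of_dvd (Nat.pos_of_ne_zero hm0) hd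
    nlinarith [hp.two_le, Nat.pos_of_ne_zero hm0])
  have hgcd : IsCoprime (![a, b + t * N] 0) (![a, b + t * N] 1) := by simpa using ht
  obtain ⟨g, hg⟩ := hgcd.exists_SL2_row 1
  refine ⟨g, Lat.ext ?_⟩
  rw [base_act_val]
  ext i
  fin_cases i
  · simpa [← ha] using congrArg (Int.cast : ℤ → ZMod N) hg.1
  · simpa [← hb] using congrArg (Int.cast : ℤ → ZMod N) hg.2

lemma phi_surjective (N : ℕ) [NeZero N] : Function.Surjective (phi N) := by
  intro θ
  induction θ using Quotient.inductionOn with | h v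
  obtain ⟨g, rfl⟩ := base_act_surjective N v
  refine ⟨Cusp.mk _ (g⁻¹ • ∞), ?_⟩
  exact (phiPoint_smul_infty N g⁻¹).trans (by rw [inv_inv]; rfl)

/-- The bijection `φ_N`. -/
def phiEquiv (N : ℕ) [NeZero N] : Cusp (CongruenceSubgroup.Gamma N) ≃ LatPM N :=
  Equiv.ofBijective (phi N) ⟨phi_injective N, phi_surjective N⟩

instance (N : ℕ) [NeZero N] : Finite (Cusp (CongruenceSubgroup.Gamma N)) :=
  Finite.of_equiv _ (phiEquiv N).symm

/-- The action of `(ℤ/N)ˣ` on `𝒞(𝒢)`: the cusp `x`, represented by `p ∈ ℙ¹(ℚ)`, is sent to the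
cusp of `𝒢` under the cusp `φ_N⁻¹(δ · φ_N(p))` of `Γ(N)`. -/
def unitAct {N : ℕ} [NeZero N] {𝒢 : Subgroup SL(2, ℤ)} (h : CongruenceSubgroup.Gamma N ≤ 𝒢)
    (δ : (ZMod N)ˣ) : Cusp 𝒢 → Cusp 𝒢 :=
  Quotient.lift (fun p => cuspMap h ((phiEquiv N).symm ((phiPoint N p).scale δ))) (by
    rintro _ p ⟨⟨γ, hγ⟩, rfl⟩
    show cuspMap h ((phiEquiv N).symm ((phiPoint N (γ • p)).scale δ)) = _
    obtain ⟨y, hy⟩ := (phiEquiv N).surjective ((phiPoint N p).scale δ)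
    induction y using Quotient.inductionOn with | h q
    have hq : phiPoint N q = (phiPoint N p).scale δ := hy
    have hq' : phiEquiv N (Cusp.mk _ (γ • q)) = (phiPoint N (γ • p)).scale δ := by
      rw [phiPoint_smul, LatPM.scale_act, ← hq]
      exact phiPoint_smul N γ q
    have hq'' : phiEquiv N (Cusp.mk _ q) = (phiPoint N p).scale δ := hq
    rw [← hq', ← hq'', Equiv.symm_apply_apply, Equiv.symm_apply_apply]
    exact Cusp.mk_smul hγ q)

/-! ### Orbits and choices of representatives -/

/-- The `𝒢`-orbit of `v` in `Λ_N`. -/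
def latOrbit {N : ℕ} (𝒢 : Subgroup SL(2, ℤ)) (v : Lat N) : Set (Lat N) :=
  {w | ∃ γ ∈ 𝒢, w = v.act γ}

/-- A `𝒢`-orbit `𝒪 ⊆ Λ_N` is regular if `𝒪 ∩ (-𝒪) = ∅`. -/
def IsRegularOrbit {N : ℕ} (𝒪 : Set (Lat N)) : Prop :=
  ∀ w ∈ 𝒪, -w ∉ 𝒪

/-- A set `𝒜` of representatives for the orbits of `{± Id}` on `Λ_N`. -/
structure SignReps (N : ℕ) where
  carrier : Set (Lat N)
  existsUnique : ∀ θ : LatPM N, ∃! v, v ∈ carrier ∧ LatPM.mk v = θ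

/-- `Π_{N,𝒜}⁻¹ : Λ_N^± → 𝒜`. -/
def SignReps.lift {N : ℕ} (A : SignReps N) (θ : LatPM N) : Lat N :=
  (A.existsUnique θ).choose

/-- `𝒜` is `𝒢`-admissible: a regular `𝒢`-orbit that meets `𝒜` is contained in `𝒜`. -/
def SignReps.IsAdmissible {N : ℕ} (A : SignReps N) (𝒢 : Subgroup SL(2, ℤ)) : Prop :=
  ∀ v : Lat N, IsRegularOrbit (latOrbit 𝒢 v) →
    (latOrbit 𝒢 v ∩ A.carrier).Nonempty → latOrbit 𝒢 v ⊆ A.carrier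

/-- A choice of a scaling matrix `σ_x` for every cusp `x` of `𝒢`; the point `σ_x ∞` is the chosen
representative of `x` in `ℙ¹(ℚ)`. -/
structure ScalingChoice (𝒢 : Subgroup SL(2, ℤ)) where
  mat : Cusp 𝒢 → SL(2, ℤ)
  mk_mat : ∀ x, Cusp.mk 𝒢 (mat x • (∞ : OnePoint ℚ)) = x

/-- The scaling matrices of the regular cusps are compatible with `𝒜`:
`Π_{N,𝒜}⁻¹(φ_N(σ_x ∞)) = (0, 1) σ_x⁻¹` for each regular cusp `x`. -/
def ScalingChoice.IsCompatible {N : ℕ} {𝒢 : Subgroup SL(2, ℤ)} (σ : ScalingChoice 𝒢)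
    (A : SignReps N) : Prop :=
  ∀ x : Cusp 𝒢, IsRegularCusp x →
    A.lift (phi N (Cusp.mk _ (σ.mat x • (∞ : OnePoint ℚ)))) = (Lat.base N).act (σ.mat x)⁻¹

/-- `𝒪_x = λ_x 𝒢` where `λ_x = Π_{N,𝒜}⁻¹(φ_N(σ_x ∞))`. -/
def orbitOfCusp {N : ℕ} {𝒢 : Subgroup SL(2, ℤ)} (A : SignReps N) (σ : ScalingChoice 𝒢)
    (x : Cusp 𝒢) : Set (Lat N) :=
  latOrbit 𝒢 (A.lift (phi N (Cusp.mk _ (σ.mat x • (∞ : OnePoint ℚ)))))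

open Classical in
/-- The sign `ε_𝒜(δ)` at the cusp `x`: it is `1` if `δ⁻¹ 𝒪_x = 𝒪_{δ⁻¹ x}` and `-1` otherwise. -/
def cuspSign {N : ℕ} [NeZero N] {𝒢 : Subgroup SL(2, ℤ)} (h : CongruenceSubgroup.Gamma N ≤ 𝒢)
    (A : SignReps N) (σ : ScalingChoice 𝒢) (x : Cusp 𝒢) (δ : (ZMod N)ˣ) : ℂ :=
  if Lat.scale δ⁻¹ '' orbitOfCusp A σ x = orbitOfCusp A σ (unitAct h δ⁻¹ x) then 1 else -1

/-! ### Eisenstein series -/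

/-- `ε_N`, equal to `1/2` for `N ∈ {1, 2}` and to `1` for `N ≥ 3`. -/
def epsN (N : ℕ) : ℂ := if N ≤ 2 then 1 / 2 else 1

/-- `Im(τ)^s / ((cτ + d)^k |cτ + d|^{2s})` for `v = (c, d)`. -/
def eisTerm (k : ℕ) (τ : ℍ) (s : ℂ) (v : Fin 2 → ℤ) : ℂ :=
  (τ.im : ℂ) ^ s /
    (((v 0 : ℂ) * τ + v 1) ^ k * ((‖(v 0 : ℂ) * τ + v 1‖ : ℝ) : ℂ) ^ (2 * s))

/-- `G_k(τ, λ, N; s)`: the sum over the nonzero `(c, d) ≡ λ` modulo `N`. -/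
def levelG (k : ℕ) {N : ℕ} (v : Lat N) (τ : ℍ) (s : ℂ) : ℂ :=
  ∑' w : {w : Fin 2 → ℤ // (fun i => (w i : ZMod N)) = v.val ∧ w ≠ 0}, eisTerm k τ s w.1

/-- The series defining `G_{k,x}(τ; s)` for `Re(k + 2s) > 2`. -/
def seriesG (k : ℕ) {N : ℕ} {𝒢 : Subgroup SL(2, ℤ)} (h : CongruenceSubgroup.Gamma N ≤ 𝒢)
    (A : SignReps N) (x : Cusp 𝒢) (τ : ℍ) (s : ℂ) : ℂ :=
  ∑ᶠ y ∈ cuspOrbit h x, levelG k (A.lift (phi N y)) τ s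

/-- The automorphy factor `j(γ, τ) = cτ + d`. -/
def autFactor (γ : SL(2, ℤ)) (τ : ℍ) : ℂ := (γ 1 0 : ℂ) * τ + γ 1 1

/-- The spectral series `∑ j(σ⁻¹γ, τ)^{-k} Im(σ⁻¹γτ)^s` over `γ ∈ 𝒢_p \ 𝒢`, where `p = σ∞`, for
`Re(k + 2s) > 2`. One representative is taken in each coset; when `k` is even, or `-Id ∉ 𝒢` and
the cusp is regular, the terms do not depend on it. -/
def seriesE (k : ℕ) (𝒢 : Subgroup SL(2, ℤ)) (σ : SL(2, ℤ)) (τ : ℍ) (s : ℂ) : ℂ :=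
  ∑' q : Quotient (QuotientGroup.rightRel (MulAction.stabilizer 𝒢 (σ • (∞ : OnePoint ℚ)))),
    (autFactor (σ⁻¹ * (q.out : SL(2, ℤ))) τ ^ k)⁻¹ *
      (((σ⁻¹ * (q.out : SL(2, ℤ))) • τ).im : ℂ) ^ s

/-- `F` is an analytic continuation of `f`, given on `Re(k + 2s) > 2`, to `Re(k + 2s) > 1`. -/
structure IsContinuation (k : ℕ) (f F : ℂ → ℂ) : Prop where
  analytic : AnalyticOnNhd ℂ F {s | 1 < ((k : ℂ) + 2 * s).re}
  eq : ∀ s : ℂ, 2 < ((k : ℂ) + 2 * s).re → F s = f s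

/-- The analytic continuation to `Re(k + 2s) > 1`, if there is one; its values in this half-plane
are then unique. -/
def continuation (k : ℕ) (f : ℂ → ℂ) : ℂ → ℂ := Classical.epsilon (IsContinuation k f)

/-- The unnormalized Eisenstein series `G_{k,x}(τ; s)` for `Re(k + 2s) > 1`. -/
def unnormG (k : ℕ) {N : ℕ} {𝒢 : Subgroup SL(2, ℤ)} (h : CongruenceSubgroup.Gamma N ≤ 𝒢)
    (A : SignReps N) (x : Cusp 𝒢) (τ : ℍ) : ℂ → ℂ :=
  continuation k (seriesG k h A x τ)

/-- The spectral Eisenstein series `E_{k,x}(τ; s)` for `Re(k + 2s) > 1`. -/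
def spectralE (k : ℕ) {𝒢 : Subgroup SL(2, ℤ)} (σ : ScalingChoice 𝒢) (x : Cusp 𝒢) (τ : ℍ) :
    ℂ → ℂ :=
  continuation k (seriesE k 𝒢 (σ.mat x) τ)

/-- `ζ₊^{(N)}(δ, z) = ∑_{n ≥ 1, n ≡ δ (N)} n^{-z}`. -/
def zetaPlus {N : ℕ} (δ : (ZMod N)ˣ) (z : ℂ) : ℂ :=
  ∑' n : {n : ℕ // 1 ≤ n ∧ (n : ZMod N) = δ}, 1 / ((n : ℕ) : ℂ) ^ z

/-- `ζ₊^{(N)}(μ; δ, z) = ∑_{n ≥ 1, n ≡ δ (N)} μ(n) n^{-z}`. -/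
def zetaPlusMu {N : ℕ} (δ : (ZMod N)ˣ) (z : ℂ) : ℂ :=
  ∑' n : {n : ℕ // 1 ≤ n ∧ (n : ZMod N) = δ},
    ((ArithmeticFunction.moebius (n : ℕ) : ℤ) : ℂ) / ((n : ℕ) : ℂ) ^ z

end CongEis

end

/-! The basic object is `powTerm`, the function u⁻ᵏ|u|⁻²ˢ, which is homogeneous of degree -(k+2s)
under positive scalars.

Identities for Re(k+2s) > 2. A nonzero integer vector is uniquely n·u with n ≥ 1 and u primitive,
and if its class has order N modulo N then n is a unit modulo N. Homogeneity therefore turns a sum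
over a class into a combination of sums over primitive vectors with coefficients ζ₊(δ)
(`levelG_eq_sum_primG`). The partial zeta functions and their Möbius twists are inverse in the group
algebra of (ℤ/N)ˣ (`sum_zetaPlusMu_mul_zetaPlus`), so this relation inverts (`primG_eq_sum_levelG`).
The spectral series is ε_N times the sum over primitive vectors in the classes above the cusp
(`seriesE_eq_finsum_primG`): a coset determines a bottom row up to sign, and exactly one of the two
signs lies in a counted class, or both when N ≤ 2. Scaling by δ⁻¹ permutes the classes above x and
δ⁻¹x up to a sign; for odd k, regularity, admissibility and compatibility make this sign constant
and equal to ε_𝒜(δ) (`finsum_scale`).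

Continuation to Re(k+2s) > 1. Each lattice term off the row c = 0 is compared with its mean over the
segment [u, u+N]. The difference decays one power faster, so these differences sum to a holomorphic
function. The means add up to integrals over horizontal lines, which give `lineIntegral` times a
Hurwitz zeta function at k+2s-1. For odd k this is the entire odd Hurwitz zeta function. For even k
the even one may have a pole at k+2s = 2, and there the integral vanishes (`lineIntegral_eq_zero`).
This continues G; E is continued as a finite combination of the G, and the identities extend by
uniqueness of continuation (`IsContinuation.eqOn`). -/

namespace CongEis

open Matrix OnePoint UpperHalfPlane
open scoped MatrixGroups Topology

/-! ### Holomorphic dependence on a parameter -/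

section Parameter

open MeasureTheory Filter Metric

/-- An integral that is locally dominated and whose integrand is holomorphic in the parameter is
holomorphic in the parameter. -/
theorem differentiableOn_integral_of_locally_dominated {α : Type*} [MeasurableSpace α]
    {μ : Measure α} {F : ℂ → α → ℂ} {U : Set ℂ} (hU : IsOpen U)
    (hd : ∀ t, DifferentiableOn ℂ (fun s => F s t) U)
    (hm : ∀ s ∈ U, AEStronglyMeasurable (F s) μ)
    (hb : ∀ s₀ ∈ U, ∃ V ∈ 𝓝 s₀, ∃ bound : α → ℝ, Integrable bound μ ∧
      ∀ᵐ t ∂μ, ∀ s ∈ V, ‖F s t‖ ≤ bound t) :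
    DifferentiableOn ℂ (fun s => ∫ t, F s t ∂μ) U := by
  intro s₀ hs₀
  obtain ⟨V, hV, bound, hbi, hbd⟩ := hb s₀ hs₀
  obtain ⟨ε, hε, hball⟩ := Metric.mem_nhds_iff.mp (inter_mem hV (hU.mem_nhds hs₀))
  have hr : 0 < ε / 2 := by positivity
  have hdiff : ∀ t, ∀ s ∈ ball s₀ (ε / 2), HasDerivAt (fun s => F s t)
      (deriv (fun s => F s t) s) s := fun t s hs =>
    ((hd t).differentiableAt (hU.mem_nhds (hball (ball_subset_ball (by linarith) hs)).2)).hasDerivAt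
  -- The radii ε/2 and ε/3 add up to less than ε, so Cauchy's estimate on circles of radius ε/3
  -- stays where the bound is valid.
  have hcb : ∀ s ∈ ball s₀ (ε / 2), closedBall s (ε / 3) ⊆ ball s₀ ε := by
    intro s hs w hw
    rw [mem_ball, mem_closedBall] at *
    linarith [dist_triangle w s s₀]
  have hbd' : ∀ᵐ t ∂μ, ∀ s ∈ ball s₀ (ε / 2),
      ‖deriv (fun s => F s t) s‖ ≤ bound t / (ε / 3) := by
    filter_upwards [hbd] with t ht s hs
    refine Complex.norm_deriv_le_of_forall_mem_sphere_norm_le (by positivity) ?_ ?_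
    · apply DifferentiableOn.diffContOnCl
      refine (hd t).mono fun w hw => (hball (hcb s hs (closure_ball_subset_closedBall hw))).2
    · exact fun w hw => ht w (hball (hcb s hs (sphere_subset_closedBall hw))).1
  have hmem : ∀ n : ℕ, s₀ + ((ε / 2 / (n + 2) : ℝ) : ℂ) ∈ ball s₀ ε := by
    intro n
    rw [mem_ball, dist_eq_norm, add_sub_cancel_left, Complex.norm_real,
      Real.norm_of_nonneg (by positivity), div_lt_iff₀ (by positivity)]
    nlinarith [(Nat.cast_nonneg n : (0 : ℝ) ≤ n)]
  have hlim : Tendsto (fun n : ℕ => s₀ + ((ε / 2 / (n + 2) : ℝ) : ℂ)) atTop (𝓝[≠] s₀) := by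
    rw [tendsto_nhdsWithin_iff]
    constructor
    · have h1 : Tendsto (fun n : ℕ => ε / 2 / ((n : ℝ) + 2)) atTop (𝓝 0) :=
        (tendsto_atTop_add_const_right _ _ tendsto_natCast_atTop_atTop).const_div_atTop _
      have h2 := (Complex.continuous_ofReal.tendsto 0).comp h1
      simpa using (tendsto_const_nhds (x := s₀)).add h2
    · refine Eventually.of_forall fun n => ?_
      have : (ε / 2 / ((n : ℝ) + 2)) ≠ 0 := by positivity
      simpa using Complex.ofReal_ne_zero.mpr this
  -- The derivative is measurable as a pointwise limit of difference quotients along a sequence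
  -- tending to s₀.
  have hmeas' : AEStronglyMeasurable (fun t => deriv (fun s => F s t) s₀) μ := by
    refine aestronglyMeasurable_of_tendsto_ae atTop
      (f := fun (n : ℕ) t => slope (fun s => F s t) s₀ (s₀ + ((ε / 2 / (n + 2) : ℝ) : ℂ))) ?_ ?_
    · intro n
      simp only [slope_def_field, div_eq_mul_inv]
      exact ((hm _ (hball (hmem n)).2).sub (hm _ hs₀)).mul_const _
    · refine Eventually.of_forall fun t => ?_
      exact (hasDerivAt_iff_tendsto_slope.mp (hdiff t s₀ (mem_ball_self hr))).comp hlim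
  have hint : Integrable (F s₀) μ := by
    refine hbi.mono' (hm _ hs₀) ?_
    filter_upwards [hbd] with t ht using ht _ (hball (mem_ball_self hε)).1
  refine (hasDerivAt_integral_of_dominated_loc_of_deriv_le (ball_mem_nhds s₀ hr) ?_ hint hmeas'
    hbd' (hbi.div_const _) (Eventually.of_forall hdiff)).2.differentiableAt.differentiableWithinAt
  filter_upwards [hU.mem_nhds hs₀] with s hs using hm s hs

/-- A locally dominated series of holomorphic functions is holomorphic. -/
theorem differentiableOn_tsum_of_locally_dominated {ι : Type*} {F : ι → ℂ → ℂ} {U : Set ℂ}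
    (hd : ∀ i, DifferentiableOn ℂ (F i) U)
    (hb : ∀ s₀ ∈ U, ∃ V ∈ 𝓝 s₀, ∃ bound : ι → ℝ, Summable bound ∧
      ∀ i, ∀ s ∈ V, ‖F i s‖ ≤ bound i) (hU : IsOpen U) :
    DifferentiableOn ℂ (fun s => ∑' i, F i s) U := by
  intro s₀ hs₀
  obtain ⟨V, hV, bound, hbs, hbd⟩ := hb s₀ hs₀
  obtain ⟨W, hWV, hW, hsW⟩ := _root_.mem_nhds_iff.mp (inter_mem hV (hU.mem_nhds hs₀))
  have := Complex.differentiableOn_tsum_of_summable_norm hbs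
    (fun i => (hd i).mono fun s hs => (hWV hs).2) hW (fun i s hs => hbd i s (hWV hs).1)
  exact (this.differentiableAt (hW.mem_nhds hsW)).differentiableWithinAt

end Parameter

/-! ### The function `u ↦ u⁻ᵏ |u|⁻²ˢ` -/

/-- The function `u⁻ᵏ |u|⁻²ˢ` of a complex variable `u`. -/
noncomputable def powTerm (k : ℕ) (s u : ℂ) : ℂ := (u ^ k * ((‖u‖ : ℝ) : ℂ) ^ (2 * s))⁻¹

theorem eisTerm_eq (k : ℕ) (τ : ℍ) (s : ℂ) (v : Fin 2 → ℤ) :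
    eisTerm k τ s v = (τ.im : ℂ) ^ s * powTerm k s ((v 0 : ℂ) * τ + v 1) := by
  rw [eisTerm, powTerm, div_eq_mul_inv]

theorem norm_powTerm (k : ℕ) (s : ℂ) {u : ℂ} (hu : u ≠ 0) :
    ‖powTerm k s u‖ = ‖u‖ ^ (-((k : ℂ) + 2 * s).re) := by
  have hu' : 0 < ‖u‖ := norm_pos_iff.mpr hu
  rw [powTerm, norm_inv, norm_mul, norm_pow, Complex.norm_cpow_eq_rpow_re_of_pos hu',
    ← Real.rpow_natCast, ← Real.rpow_add hu', Real.rpow_neg hu'.le]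
  simp

theorem differentiable_powTerm (k : ℕ) {u : ℂ} (hu : u ≠ 0) :
    Differentiable ℂ (fun s => powTerm k s u) := by
  have hu' : ((‖u‖ : ℝ) : ℂ) ≠ 0 := by simpa using hu
  intro s
  refine DifferentiableAt.inv ?_ ?_
  · refine (differentiableAt_const _).mul (DifferentiableAt.const_cpow (by fun_prop) (Or.inl hu'))
  · exact mul_ne_zero (pow_ne_zero _ hu) (by simp [Complex.cpow_eq_zero_iff, hu'])

/-- This homogeneity is used twice: to extract the gcd of a vector and to rescale a horizontal line
to height 1. -/
theorem powTerm_ofReal_mul (k : ℕ) (s : ℂ) {ρ : ℝ} (hρ : 0 < ρ) (u : ℂ) :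
    powTerm k s (ρ * u) = (ρ : ℂ) ^ (-((k : ℂ) + 2 * s)) * powTerm k s u := by
  have h0 : (ρ : ℂ) ≠ 0 := by exact_mod_cast hρ.ne'
  rw [powTerm, powTerm, norm_mul, Complex.norm_real, Real.norm_of_nonneg hρ.le, Complex.ofReal_mul,
    Complex.mul_cpow_ofReal_nonneg hρ.le (norm_nonneg _), Complex.cpow_neg, Complex.cpow_add _ _ h0,
    Complex.cpow_natCast, mul_pow, ← mul_inv]
  congr 1
  ring

theorem powTerm_neg (k : ℕ) (s u : ℂ) : powTerm k s (-u) = (-1) ^ k * powTerm k s u := by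
  rw [powTerm, powTerm, norm_neg, neg_pow, mul_assoc, mul_inv]
  congr 1
  rw [← inv_pow, inv_neg, inv_one]

/-- Differentiating along the real direction lowers the exponent of |u| by one, because |Re u| ≤
|u|. This gain of one power is what moves the boundary of convergence from 2 to 1. -/
theorem exists_hasDerivAt_powTerm (k : ℕ) (s u : ℂ) (x : ℝ) (hu : u + x ≠ 0) :
    ∃ D, HasDerivAt (fun x : ℝ => powTerm k s (u + x)) D x ∧
      ‖D‖ ≤ (k + 2 * ‖s‖) * ‖u + x‖ ^ (-((k : ℂ) + 2 * s).re - 1) := by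
  have hpos : 0 < ‖u + x‖ := norm_pos_iff.mpr hu
  have hlin : HasDerivAt (fun x : ℝ => u + (x : ℂ)) 1 x :=
    (Complex.ofRealCLM.hasDerivAt (x := x)).const_add u |>.congr_deriv (by simp)
  have hsq : HasDerivAt (fun x : ℝ => (u.re + x) ^ 2 + u.im ^ 2) (2 * (u.re + x)) x := by
    have := (((hasDerivAt_id x).const_add u.re).pow 2).add_const (u.im ^ 2)
    simpa using this
  have hne : (u.re + x) ^ 2 + u.im ^ 2 = ‖u + x‖ ^ 2 := by
    rw [← Complex.normSq_eq_norm_sq, Complex.normSq_apply]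
    simp
    ring
  have hnorm : HasDerivAt (fun x : ℝ => ‖u + x‖) ((u.re + x) / ‖u + x‖) x := by
    have h1 := hsq.sqrt (by rw [hne]; positivity)
    have h2 : (fun x : ℝ => ‖u + x‖) = fun x : ℝ => √((u.re + x) ^ 2 + u.im ^ 2) := by
      ext y
      rw [Complex.norm_def, Complex.normSq_apply]
      congr 1
      simp
      ring
    rw [h2]
    refine h1.congr_deriv ?_
    have h3 : √((u.re + x) ^ 2 + u.im ^ 2) = ‖u + x‖ := by rw [hne]; exact Real.sqrt_sq hpos.le
    simp only [h3]
    rw [mul_div_mul_left _ _ two_ne_zero]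
  have hcp : HasDerivAt (fun x : ℝ => ((‖u + x‖ : ℝ) : ℂ) ^ (2 * s))
      (2 * s * ((‖u + x‖ : ℝ) : ℂ) ^ (2 * s - 1) * ((u.re + x) / ‖u + x‖ : ℝ)) x := by
    have hz : ((‖u + x‖ : ℝ) : ℂ) ∈ Complex.slitPlane := Complex.ofReal_mem_slitPlane.mpr hpos
    have h1 := (hasDerivAt_id ((‖u + x‖ : ℝ) : ℂ)).cpow_const (c := 2 * s) hz
    have h2 := h1.comp x hnorm.ofReal_comp
    rw [mul_one] at h2
    exact h2
  have hN : ((‖u + x‖ : ℝ) : ℂ) ≠ 0 := by simpa using hu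
  have hc0 : ((‖u + x‖ : ℝ) : ℂ) ^ (2 * s) ≠ 0 := by simp [Complex.cpow_eq_zero_iff, hN]
  have hmul := (hlin.pow k).mul hcp
  have hinv := hmul.inv (mul_ne_zero (pow_ne_zero _ hu) hc0)
  have hD : HasDerivAt (fun x : ℝ => powTerm k s (u + x))
      (powTerm k s (u + x) * (-(k / (u + x)) - 2 * s * ((u.re + x : ℝ) / ‖u + x‖ / ‖u + x‖))) x :=
        by
    refine hinv.congr_deriv ?_
    rw [powTerm]
    have hk : (k : ℂ) * (u + x) ^ (k - 1) = k * (u + x) ^ k / (u + x) := by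
      rcases k with _ | k
      · simp
      · rw [Nat.add_sub_cancel, pow_succ, eq_div_iff hu]; ring
    simp only [Pi.mul_apply, Pi.pow_apply]
    rw [hk, Complex.cpow_sub _ _ hN, Complex.cpow_one]
    push_cast
    field_simp
    ring
  refine ⟨_, hD, ?_⟩
  rw [norm_mul, norm_powTerm k s hu, Real.rpow_sub_one hpos.ne']
  have hre : |u.re + x| ≤ ‖u + x‖ := by simpa using Complex.abs_re_le_norm (u + x)
  have : ‖-((k : ℂ) / (u + x)) - 2 * s * ((u.re + x : ℝ) / ‖u + x‖ / ‖u + x‖)‖ ≤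
      (k + 2 * ‖s‖) / ‖u + x‖ := by
    refine (norm_sub_le _ _).trans ?_
    rw [norm_neg, norm_div, norm_mul, norm_mul, norm_div, norm_div, Complex.norm_real,
      Complex.norm_real, norm_norm, add_div]
    simp only [Complex.norm_natCast, Complex.norm_ofNat, Real.norm_eq_abs]
    have h1 : |u.re + x| / ‖u + x‖ / ‖u + x‖ ≤ 1 / ‖u + x‖ := by
      gcongr
      exact div_le_one_of_le₀ hre hpos.le
    calc _ ≤ k / ‖u + x‖ + 2 * ‖s‖ * (1 / ‖u + x‖) := by gcongr
      _ = _ := by ring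
  calc _ ≤ ‖u + x‖ ^ (-((k : ℂ) + 2 * s).re) * ((k + 2 * ‖s‖) / ‖u + x‖) := by gcongr
    _ = _ := by ring

section

open MeasureTheory Filter

theorem isOpen_halfPlane (k : ℕ) (r : ℝ) : IsOpen {s : ℂ | r < ((k : ℂ) + 2 * s).re} :=
  isOpen_lt continuous_const (by fun_prop)

/-! ### The integral of `u⁻ᵏ |u|⁻²ˢ` along the line `Im u = 1` -/

theorem add_ofReal_ne_zero {u : ℂ} (hu : u.im ≠ 0) (x : ℝ) : u + x ≠ 0 := fun h =>
  hu (by simpa using congrArg Complex.im h)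

theorem continuous_powTerm (k : ℕ) (s : ℂ) {u : ℂ} (hu : u.im ≠ 0) :
    Continuous (fun x : ℝ => powTerm k s (u + x)) :=
  continuous_iff_continuousAt.mpr fun x =>
    (exists_hasDerivAt_powTerm k s u x (add_ofReal_ne_zero hu x)).choose_spec.1.continuousAt

theorem norm_I_add (x : ℝ) : ‖Complex.I + x‖ = (1 + ‖x‖ ^ 2) ^ (1 / 2 : ℝ) := by
  rw [Complex.norm_def, Complex.normSq_apply, Real.sqrt_eq_rpow]
  congr 1
  simp
  ring

theorem one_le_norm_I_add (x : ℝ) : 1 ≤ ‖Complex.I + x‖ := by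
  rw [norm_I_add]
  exact Real.one_le_rpow (by nlinarith [sq_nonneg ‖x‖]) (by norm_num)

theorem integrable_norm_I_add {r : ℝ} (hr : 1 < r) :
    Integrable (fun x : ℝ => ‖Complex.I + x‖ ^ (-r)) := by
  refine (integrable_rpow_neg_one_add_norm_sq (E := ℝ) (μ := volume) (r := r)
    (by simpa using hr)).congr ?_
  refine Eventually.of_forall fun x => ?_
  simp only
  rw [norm_I_add, ← Real.rpow_mul (by positivity)]
  congr 1
  ring

theorem I_add_ne_zero (x : ℝ) : Complex.I + (x : ℂ) ≠ 0 :=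
  add_ofReal_ne_zero (by simp) x

theorem integrable_powTerm_I {k : ℕ} {s : ℂ} (hs : 1 < ((k : ℂ) + 2 * s).re) :
    Integrable (fun x : ℝ => powTerm k s (Complex.I + x)) := by
  refine (integrable_norm_I_add hs).mono' (continuous_powTerm k s (by simp)).aestronglyMeasurable ?_
  refine Eventually.of_forall fun x => ?_
  rw [norm_powTerm k s (I_add_ne_zero x)]

/-- The integral of `u⁻ᵏ |u|⁻²ˢ` along the line `Im u = 1`. -/
noncomputable def lineIntegral (k : ℕ) (s : ℂ) : ℂ := ∫ x : ℝ, powTerm k s (Complex.I + x)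

/-- Since |i + x| ≥ 1, a single exponent r with 1 < r < Re(k+2s₀) dominates the integrand for all s
near s₀. -/
theorem differentiableOn_lineIntegral (k : ℕ) :
    DifferentiableOn ℂ (lineIntegral k) {s | 1 < ((k : ℂ) + 2 * s).re} := by
  refine differentiableOn_integral_of_locally_dominated (isOpen_halfPlane k 1)
    (fun x => (differentiable_powTerm k (I_add_ne_zero x)).differentiableOn)
    (fun s hs => (integrable_powTerm_I hs).aestronglyMeasurable) ?_
  intro s₀ hs₀
  rw [Set.mem_ofPred_eq] at hs₀
  obtain ⟨r, hr1, hr2⟩ := exists_between hs₀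
  refine ⟨_, (isOpen_halfPlane k r).mem_nhds hr2, _, integrable_norm_I_add hr1,
    Eventually.of_forall fun x s hs => ?_⟩
  rw [norm_powTerm k s (I_add_ne_zero x)]
  rw [Set.mem_ofPred_eq] at hs
  exact Real.rpow_le_rpow_of_exponent_le (one_le_norm_I_add x) (by linarith)

theorem tendsto_inv_I_add {l : Filter ℝ} (hl : Tendsto (fun x : ℝ => |x|) l atTop) :
    Tendsto (fun x : ℝ => (Complex.I + (x : ℂ))⁻¹) l (𝓝 0) := by
  refine tendsto_inv₀_cobounded.comp ?_
  rw [← tendsto_norm_atTop_iff_cobounded]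
  refine tendsto_atTop_mono (fun x => ?_) hl
  simpa using Complex.abs_re_le_norm (Complex.I + x)

/-- Here k + 2s = 2, and with k = 2n+2 the integrand on the line is the rational function
(x-i)ⁿ/(x+i)ⁿ⁺². It has the primitive ((x-i)/(x+i))ⁿ⁺¹/(2i(n+1)), whose limits at -∞ and +∞
coincide. -/
theorem lineIntegral_eq_zero {k : ℕ} (hk : 2 ≤ k) (hev : Even k) :
    lineIntegral k (1 - k / 2) = 0 := by
  obtain ⟨m, rfl⟩ := hev
  obtain ⟨n, rfl⟩ : ∃ n, m = n + 1 := ⟨m - 1, by omega⟩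
  set s : ℂ := 1 - ((n + 1 + (n + 1) : ℕ) : ℂ) / 2 with hs
  have hσ : 1 < (((n + 1 + (n + 1) : ℕ) : ℂ) + 2 * s).re := by
    have : ((n + 1 + (n + 1) : ℕ) : ℂ) + 2 * s = 2 := by rw [hs]; ring
    rw [this]; norm_num
  have hterm : ∀ x : ℝ, powTerm (n + 1 + (n + 1)) s (Complex.I + x) =
      (x - Complex.I) ^ n / (Complex.I + x) ^ (n + 2) := by
    intro x
    have hne := I_add_ne_zero x
    have hN : ((‖Complex.I + x‖ : ℝ) : ℂ) ≠ 0 := by simpa using hne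
    -- As 2s = -2n, the factor |u|⁻²ˢ is the polynomial (u·ū)ⁿ, with ū = x - i.
    have hsq : ((‖Complex.I + x‖ : ℝ) : ℂ) ^ 2 = (Complex.I + x) * (x - Complex.I) := by
      rw [← Complex.ofReal_pow, ← Complex.normSq_eq_norm_sq, ← Complex.mul_conj]
      simp only [map_add, Complex.conj_I, Complex.conj_ofReal]
      ring
    have h2 : (2 : ℂ) * s = -((2 * n : ℕ) : ℂ) := by rw [hs]; push_cast; ring
    have hne' : (x : ℂ) - Complex.I ≠ 0 := by
      intro h
      rw [h, mul_zero] at hsq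
      exact hN (pow_eq_zero_iff two_ne_zero |>.mp hsq)
    rw [powTerm, h2, Complex.cpow_neg, Complex.cpow_natCast, pow_mul, hsq, mul_pow]
    field_simp
    ring
  have hderiv : ∀ x : ℝ, HasDerivAt
      (fun x : ℝ => (1 - 2 * Complex.I * (Complex.I + (x : ℂ))⁻¹) ^ (n + 1) /
        (2 * Complex.I * (n + 1)))
      (powTerm (n + 1 + (n + 1)) s (Complex.I + x)) x := by
    intro x
    have hne := I_add_ne_zero x
    have hlin : HasDerivAt (fun x : ℝ => Complex.I + (x : ℂ)) 1 x :=
      (Complex.ofRealCLM.hasDerivAt (x := x)).const_add Complex.I |>.congr_deriv (by simp)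
    have h1 :=
        ((((hlin.fun_inv hne).const_mul (2 * Complex.I)).const_sub 1).fun_pow (n + 1)).div_const
      (2 * Complex.I * (n + 1))
    refine h1.congr_deriv ?_
    have hu : 1 - 2 * Complex.I * (Complex.I + (x : ℂ))⁻¹ = (x - Complex.I) / (Complex.I + x) := by
      field_simp
      ring
    have hn : (n : ℂ) + 1 ≠ 0 := by exact_mod_cast Nat.succ_ne_zero n
    rw [hterm, hu, Nat.add_sub_cancel, div_pow]
    push_cast
    field_simp [Complex.I_ne_zero]
    ring
  have hlim : ∀ l : Filter ℝ, Tendsto (fun x : ℝ => |x|) l atTop → Tendsto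
      (fun x : ℝ => (1 - 2 * Complex.I * (Complex.I + (x : ℂ))⁻¹) ^ (n + 1) /
        (2 * Complex.I * (n + 1))) l (𝓝 (1 / (2 * Complex.I * (n + 1)))) := by
    intro l hl
    have := ((((tendsto_inv_I_add hl).const_mul (2 * Complex.I)).const_sub 1).pow (n + 1)).div_const
      (2 * Complex.I * (n + 1))
    simpa using this
  have := integral_of_hasDerivAt_of_tendsto hderiv (integrable_powTerm_I hσ)
    (hlim _ tendsto_abs_atBot_atTop) (hlim _ tendsto_abs_atTop_atTop)
  rw [lineIntegral, this, sub_self]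

theorem sign_eq_one_or_neg_one {x : ℝ} (hx : x ≠ 0) :
    (SignType.sign x : ℝ) = 1 ∨ (SignType.sign x : ℝ) = -1 := by
  rcases lt_or_gt_of_ne hx with h | h
  · right; simp [sign_neg h]
  · left; simp [sign_pos h]

/-- A horizontal line is carried to the line `Im u = 1` by a similarity. -/
theorem powTerm_line_eq {k : ℕ} (s : ℂ) (N : ℕ) (τ : ℍ) {c : ℤ} (hc : c ≠ 0) (d : ℤ)
    {ρ ε : ℝ} (hρ : ρ = |(c : ℝ)| * τ.im) (hε : ε = (SignType.sign (c : ℝ) : ℝ)) (x : ℝ) :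
    powTerm k s (c * τ + d + ((N * x : ℝ) : ℂ)) =
      (ρ : ℂ) ^ (-((k : ℂ) + 2 * s)) * ((ε : ℂ) ^ k *
        powTerm k s (Complex.I + ((ε * ((N / ρ) * x + (c * τ.re + d) / ρ) : ℝ) : ℂ))) := by
  have hc' : (c : ℝ) ≠ 0 := by exact_mod_cast hc
  have hρ0 : 0 < ρ := hρ ▸ mul_pos (abs_pos.mpr hc') τ.im_pos
  have hρ0' : (ρ : ℂ) ≠ 0 := by exact_mod_cast hρ0.ne'
  have hεc : ε * |(c : ℝ)| = c := hε ▸ sign_mul_abs _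
  have hε2 : ε = 1 ∨ ε = -1 := hε ▸ sign_eq_one_or_neg_one hc'
  -- The sign ε of c turns a line below the real axis into one above it, at the cost of the parity
  -- factor εᵏ; dividing by ρ = |c| Im τ brings it to height 1.
  have h1 : (c : ℂ) * τ + d + ((N * x : ℝ) : ℂ) = (ρ : ℂ) * (ε * (Complex.I +
      ((ε * ((N / ρ) * x + (c * τ.re + d) / ρ) : ℝ) : ℂ))) := by
    have hτ : (τ : ℂ) = τ.re + τ.im * Complex.I := (Complex.re_add_im _).symm
    have hεε : (ε : ℂ) * ε = 1 := by rcases hε2 with h | h <;> simp [h]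
    have hcc : (c : ℂ) * τ.im = ρ * ε := by
      rw [← Complex.ofReal_intCast, ← hεc, hρ]; push_cast; ring
    rw [← mul_assoc, mul_add, ← hcc, hτ, hcc]
    push_cast
    have : (ρ : ℂ) * ε * (ε * (N / ρ * x + (c * τ.re + d) / ρ)) =
      (ε * ε) * (ρ * (N / ρ * x + (c * τ.re + d) / ρ)) := by ring
    rw [this, hεε]
    field_simp
    linear_combination Complex.I * hcc
  rw [h1, powTerm_ofReal_mul k s hρ0]
  congr 1
  rcases hε2 with h | h
  · simp [h]
  · rw [h, Complex.ofReal_neg, Complex.ofReal_one, ← powTerm_neg, neg_one_mul]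

theorem integrable_powTerm_line {k : ℕ} {s : ℂ} (hs : 1 < ((k : ℂ) + 2 * s).re) {N : ℕ}
    (hN : 0 < N) (τ : ℍ) {c : ℤ} (hc : c ≠ 0) (d : ℤ) :
    Integrable fun x : ℝ => powTerm k s (c * τ + d + ((N * x : ℝ) : ℂ)) := by
  have hc' : (c : ℝ) ≠ 0 := by exact_mod_cast hc
  have hε2 := sign_eq_one_or_neg_one hc'
  simp_rw [powTerm_line_eq s N τ hc d rfl rfl]
  refine Integrable.const_mul (Integrable.const_mul ?_ _) _
  set ρ : ℝ := |(c : ℝ)| * τ.im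
  have hρ0 : 0 < ρ := mul_pos (abs_pos.mpr hc') τ.im_pos
  have hN' : (N : ℝ) ≠ 0 := by exact_mod_cast hN.ne'
  set ε : ℝ := (SignType.sign (c : ℝ) : ℝ)
  have hε0 : ε ≠ 0 := by rcases hε2 with h | h <;> simp [h]
  have h1 := ((integrable_powTerm_I hs).comp_mul_left' hε0).comp_add_right ((c * τ.re + d) / ρ)
  exact h1.comp_mul_left' (div_ne_zero hN' hρ0.ne')

/-- The integral of `u⁻ᵏ |u|⁻²ˢ` along a horizontal line, parametrized with speed `N`. -/
theorem integral_powTerm_line {k : ℕ} (s : ℂ) {N : ℕ} (hN : 0 < N) (τ : ℍ) {c : ℤ} (hc : c ≠ 0)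
    (d : ℤ) :
    ∫ x : ℝ, powTerm k s (c * τ + d + ((N * x : ℝ) : ℂ)) =
      (N : ℂ)⁻¹ * ((|(c : ℝ)| * τ.im : ℝ) : ℂ) ^ (1 - ((k : ℂ) + 2 * s)) *
        ((SignType.sign (c : ℝ) : ℝ) : ℂ) ^ k * lineIntegral k s := by
  have hc' : (c : ℝ) ≠ 0 := by exact_mod_cast hc
  have hε2 := sign_eq_one_or_neg_one hc'
  simp_rw [powTerm_line_eq s N τ hc d rfl rfl]
  set ρ : ℝ := |(c : ℝ)| * τ.im
  have hρ0 : 0 < ρ := mul_pos (abs_pos.mpr hc') τ.im_pos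
  have hρ0' : (ρ : ℂ) ≠ 0 := by exact_mod_cast hρ0.ne'
  have hN' : (N : ℝ) ≠ 0 := by exact_mod_cast hN.ne'
  set ε : ℝ := (SignType.sign (c : ℝ) : ℝ)
  rw [integral_const_mul, integral_const_mul]
  -- The substitution contributes ρ/N, which raises the exponent of ρ from -(k+2s) to 1-(k+2s). The
  -- reflection by ε does not change the integral over ℝ.
  have e1 : ∫ x : ℝ, powTerm k s (Complex.I +
      ((ε * ((N / ρ) * x + (c * τ.re + d) / ρ) : ℝ) : ℂ)) = (ρ / N : ℝ) * lineIntegral k s := by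
    have h2 := Measure.integral_comp_mul_left (fun x : ℝ => powTerm k s (Complex.I +
      ((ε * (x + (c * τ.re + d) / ρ) : ℝ) : ℂ))) (N / ρ)
    rw [h2, integral_add_right_eq_self (fun x : ℝ => powTerm k s (Complex.I + ((ε * x : ℝ) : ℂ))),
      Measure.integral_comp_mul_left (fun x : ℝ => powTerm k s (Complex.I + (x : ℂ))) ε]
    have h3 : |ε⁻¹| = 1 := by rcases hε2 with h | h <;> simp [h]
    rw [h3, inv_div, abs_of_pos (by positivity), one_smul, Complex.real_smul, lineIntegral]
  rw [e1, sub_eq_neg_add, Complex.cpow_add _ _ hρ0', Complex.cpow_one]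
  push_cast
  field_simp

end

section

open MeasureTheory Filter

/-! ### Comparison of a lattice sum with an integral -/

/-- One constant serves all cells with c ≠ 0, so that estimates along the segments can be summed
against powers of ‖(c, d)‖. -/
theorem exists_norm_vec_le (τ : ℍ) (N : ℕ) : ∃ K : ℝ, 1 ≤ K ∧ ∀ c d : ℤ, c ≠ 0 →
    ∀ t ∈ Set.Icc (0 : ℝ) N, ‖![c, d]‖ ≤ K * ‖(c : ℂ) * τ + d + t‖ := by
  have hy := τ.im_pos
  -- The constant comes from |c| ≤ |u|/Im τ and |d| ≤ |u| + |c||τ| + N, where N ≤ |c|N because |c| ≥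
  -- 1.
  refine ⟨1 + (1 + ‖(τ : ℂ)‖ + N) / τ.im, by
    have : 0 ≤ (1 + ‖(τ : ℂ)‖ + N) / τ.im := by positivity
    linarith, fun c d hc t ht => ?_⟩
  set u : ℂ := (c : ℂ) * τ + d + t with hu
  have hcabs : (1 : ℝ) ≤ |(c : ℝ)| := by exact_mod_cast Int.one_le_abs hc
  have h1 : |(c : ℝ)| * τ.im ≤ ‖u‖ := by
    have := Complex.abs_im_le_norm u
    simpa [hu, abs_mul, abs_of_pos hy] using this
  have h1' : |(c : ℝ)| ≤ ‖u‖ / τ.im := (le_div_iff₀ hy).mpr h1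
  have h2 : |(d : ℝ)| ≤ ‖u‖ + |(c : ℝ)| * ‖(τ : ℂ)‖ + N := by
    have e : ((d : ℝ) : ℂ) = u - c * τ - t := by rw [hu]; push_cast; ring
    have := norm_sub_le (u - c * τ) (t : ℂ)
    have h3 := norm_sub_le u ((c : ℂ) * τ)
    rw [← e, Complex.norm_real, Complex.norm_real, Real.norm_eq_abs, Real.norm_eq_abs,
      abs_of_nonneg ht.1] at this
    rw [norm_mul, Complex.norm_intCast] at h3
    linarith [ht.2]
  have h3 : (N : ℝ) ≤ |(c : ℝ)| * N := le_mul_of_one_le_left (Nat.cast_nonneg N) hcabs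
  have h4 : |(c : ℝ)| * (1 + ‖(τ : ℂ)‖ + N) ≤ ‖u‖ / τ.im * (1 + ‖(τ : ℂ)‖ + N) := by gcongr
  have h5 : (1 + (1 + ‖(τ : ℂ)‖ + N) / τ.im) * ‖u‖ =
      ‖u‖ + ‖u‖ / τ.im * (1 + ‖(τ : ℂ)‖ + N) := by field_simp
  rw [h5, pi_norm_le_iff_of_nonneg (by positivity)]
  have h6 : 0 ≤ |(c : ℝ)| * ‖(τ : ℂ)‖ := by positivity
  have h7 : 0 ≤ |(c : ℝ)| * (N : ℝ) := by positivity
  intro i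
  fin_cases i
  · simp only [Fin.zero_eta, cons_val_zero, Int.norm_eq_abs]
    nlinarith [norm_nonneg u]
  · simp only [Fin.mk_one, cons_val_one, cons_val_fin_one, Int.norm_eq_abs]
    nlinarith [norm_nonneg u]

/-- The difference of `u⁻ᵏ |u|⁻²ˢ` and its mean on the segment `[u, u + N]`. -/
noncomputable def cellDiff (k N : ℕ) (s u : ℂ) : ℂ :=
  powTerm k s u - ∫ x in (0 : ℝ)..1, powTerm k s (u + ((N * x : ℝ) : ℂ))

theorem continuous_powTerm_mul (k N : ℕ) (s : ℂ) {u : ℂ} (hu : u.im ≠ 0) :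
    Continuous (fun x : ℝ => powTerm k s (u + ((N * x : ℝ) : ℂ))) :=
  (continuous_powTerm k s hu).comp (by fun_prop : Continuous fun x : ℝ => (N : ℝ) * x)

theorem norm_powTerm_sub_le (k : ℕ) {s u : ℂ} {B h : ℝ} (hh : 0 ≤ h)
    (hne : ∀ t ∈ Set.Icc 0 h, u + (t : ℂ) ≠ 0)
    (hB : ∀ t ∈ Set.Icc (0 : ℝ) h, ‖u + (t : ℂ)‖ ^ (-((k : ℂ) + 2 * s).re - 1) ≤ B) :
    ‖powTerm k s (u + (h : ℂ)) - powTerm k s u‖ ≤ (k + 2 * ‖s‖) * B * h := by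
  choose! D hD hDb using fun t (ht : t ∈ Set.Icc 0 h) =>
    exists_hasDerivAt_powTerm k s u t (hne t ht)
  have := (convex_Icc (0 : ℝ) h).norm_image_sub_le_of_norm_hasDerivWithin_le
    (C := (k + 2 * ‖s‖) * B)
    (fun t ht => (hD t ht).hasDerivWithinAt) (fun t ht => (hDb t ht).trans (by
      gcongr
      exact hB t ht)) (Set.left_mem_Icc.mpr hh) (Set.right_mem_Icc.mpr hh)
  simpa [abs_of_nonneg hh] using this

/-- By the mean value inequality the difference is bounded by the derivative on the segment. The
resulting exponent -(Re(k+2s)+1) is summable over ℤ² as soon as Re(k+2s) > 1. -/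
theorem norm_cellDiff_le (k N : ℕ) {τ : ℍ} {s : ℂ} {K : ℝ} (hK : 1 ≤ K)
    (hs : 0 < ((k : ℂ) + 2 * s).re) {c d : ℤ} (hc : c ≠ 0)
    (hb : ∀ t ∈ Set.Icc (0 : ℝ) N, ‖![c, d]‖ ≤ K * ‖(c : ℂ) * τ + d + t‖) :
    ‖cellDiff k N s (c * τ + d)‖ ≤ (k + 2 * ‖s‖) * N * K ^ (((k : ℂ) + 2 * s).re + 1) *
      ‖![c, d]‖ ^ (-((k : ℂ) + 2 * s).re - 1) := by
  set σ := ((k : ℂ) + 2 * s).re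
  set u : ℂ := c * τ + d with hu
  have huim : u.im ≠ 0 := by
    simp [hu, hc, τ.im_pos.ne']
  have hn : 0 < ‖![c, d]‖ := norm_pos_iff.mpr fun h => hc (congrFun h 0)
  set B := K ^ (σ + 1) * ‖![c, d]‖ ^ (-σ - 1) with hB
  have hBt : ∀ t ∈ Set.Icc (0 : ℝ) N, ‖u + (t : ℂ)‖ ^ (-σ - 1) ≤ B := by
    intro t ht
    have hK0 : 0 < K := by linarith
    have h1 : ‖![c, d]‖ / K ≤ ‖u + (t : ℂ)‖ := by
      rw [div_le_iff₀ hK0, mul_comm]; exact hb t ht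
    refine (Real.rpow_le_rpow_of_nonpos (by positivity) h1 (by linarith)).trans_eq ?_
    rw [Real.div_rpow hn.le hK0.le, hB, show -σ - 1 = -(σ + 1) by ring, Real.rpow_neg hK0.le,
      div_inv_eq_mul, mul_comm]
  have hint : cellDiff k N s u =
      ∫ x in (0 : ℝ)..1, (powTerm k s u - powTerm k s (u + ((N * x : ℝ) : ℂ))) := by
    rw [intervalIntegral.integral_sub (by simp)
      ((continuous_powTerm_mul k N s huim).intervalIntegrable _ _)]
    simp [cellDiff]
  rw [hint]
  have := intervalIntegral.norm_integral_le_of_norm_le_const (a := (0 : ℝ)) (b := 1)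
    (f := fun x => powTerm k s u - powTerm k s (u + ((N * x : ℝ) : ℂ)))
    (C := (k + 2 * ‖s‖) * B * N) (by
      intro x hx
      rw [Set.uIoc_of_le zero_le_one] at hx
      have hxN : (N : ℝ) * x ≤ N := mul_le_of_le_one_right (Nat.cast_nonneg _) hx.2
      have hx0 : 0 ≤ (N : ℝ) * x := mul_nonneg (Nat.cast_nonneg _) hx.1.le
      rw [norm_sub_rev]
      refine (norm_powTerm_sub_le k hx0 (fun t _ => add_ofReal_ne_zero huim t)
        (fun t ht => hBt t ⟨ht.1, ht.2.trans hxN⟩)).trans ?_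
      gcongr)
  refine this.trans_eq ?_
  rw [hB]
  simp
  ring

theorem differentiable_cellDiff (k N : ℕ) {u : ℂ} (hu : u.im ≠ 0) :
    Differentiable ℂ (fun s => cellDiff k N s u) := by
  have hu0 : u ≠ 0 := fun h => hu (by simp [h])
  refine (differentiable_powTerm k hu0).sub ?_
  rw [← differentiableOn_univ]
  simp_rw [intervalIntegral.integral_of_le zero_le_one]
  refine differentiableOn_integral_of_locally_dominated isOpen_univ
    (fun x => (differentiable_powTerm k (add_ofReal_ne_zero hu _)).differentiableOn)
    (fun s _ => (continuous_powTerm_mul k N s hu).aestronglyMeasurable) ?_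
  intro s₀ _
  -- For |Re(k+2s)| < r the bound exp(r·|log|u||) dominates the integrand whether |u| is small or
  -- large, so no restriction on s is needed.
  set r := |((k : ℂ) + 2 * s₀).re| + 1 with hr
  refine ⟨{s | |((k : ℂ) + 2 * s).re| < r},
    (isOpen_lt (by fun_prop) continuous_const).mem_nhds (by simp [hr]),
    fun x => Real.exp (r * |Real.log ‖u + ((N * x : ℝ) : ℂ)‖|), ?_, ?_⟩
  · have hcont : Continuous fun x : ℝ => Real.exp (r * |Real.log ‖u + ((N * x : ℝ) : ℂ)‖|) := by
      refine Real.continuous_exp.comp (continuous_const.mul (continuous_abs.comp ?_))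
      exact Continuous.log (by fun_prop) fun x => norm_ne_zero_iff.mpr (add_ofReal_ne_zero hu _)
    exact (hcont.integrableOn_Icc (a := 0) (b := 1)).mono_set Set.Ioc_subset_Icc_self
  · refine Eventually.of_forall fun x s hs => ?_
    have hne := add_ofReal_ne_zero hu (N * x)
    rw [norm_powTerm k s hne, Real.rpow_def_of_pos (norm_pos_iff.mpr hne)]
    apply Real.exp_le_exp.mpr
    refine (le_abs_self _).trans ?_
    rw [abs_mul, abs_neg, mul_comm]
    rw [Set.mem_ofPred_eq] at hs
    gcongr

/-! ### Summability -/

theorem injective_vec {N : ℕ} (hN : 0 < N) (a b : ℤ) :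
    Function.Injective (fun p : ℤ × ℤ => ![a + N * p.1, b + N * p.2]) := by
  intro p q h
  have h0 := congrFun h 0
  have h1 := congrFun h 1
  simp [hN.ne'] at h0 h1
  exact Prod.ext h0 h1

theorem summable_vec_rpow {N : ℕ} (hN : 0 < N) (a b : ℤ) {q : ℝ} (hq : 2 < q) :
    Summable fun p : ℤ × ℤ => ‖![a + N * p.1, b + N * p.2]‖ ^ (-q) :=
  (EisensteinSeries.summable_one_div_norm_rpow hq).comp_injective (injective_vec hN a b)

theorem one_le_norm_vec {w : Fin 2 → ℤ} (hw : w ≠ 0) : 1 ≤ ‖w‖ := by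
  obtain ⟨i, hi⟩ := Function.ne_iff.mp hw
  refine le_trans ?_ (norm_le_pi_norm w i)
  rw [Int.norm_eq_abs]
  exact_mod_cast Int.one_le_abs hi

theorem lin_ne_zero (τ : ℍ) {w : Fin 2 → ℤ} (hw : w ≠ 0) : (w 0 : ℂ) * τ + w 1 ≠ 0 := by
  intro h
  have := EisensteinSeries.r_mul_max_le τ hw
  rw [h, norm_zero] at this
  have h2 := mul_pos (EisensteinSeries.r_pos τ) (norm_pos_iff.mpr hw)
  linarith

theorem summable_powTerm {k : ℕ} (τ : ℍ) {s : ℂ} (hs : 2 < ((k : ℂ) + 2 * s).re) :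
    Summable fun w : Fin 2 → ℤ => if w = 0 then 0 else powTerm k s ((w 0 : ℂ) * τ + w 1) := by
  refine Summable.of_norm_bounded ((EisensteinSeries.summable_one_div_norm_rpow hs).mul_left
    (EisensteinSeries.r τ ^ (-((k : ℂ) + 2 * s).re))) fun w => ?_
  split_ifs with hw
  · rw [norm_zero]
    have := EisensteinSeries.r_pos τ
    positivity
  · rw [norm_powTerm k s (lin_ne_zero τ hw)]
    exact EisensteinSeries.summand_bound τ (by linarith) w

end

section

open MeasureTheory Filter

/-! ### The analytic continuation -/

open HurwitzZeta in
/-- The function `(w - 1) ζ(a, w)`, with the even Hurwitz zeta function, is entire. -/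
theorem exists_differentiable_sub_one_mul_hurwitzZetaEven (a : UnitAddCircle) :
    ∃ K : ℂ → ℂ, Differentiable ℂ K ∧ ∀ w, w ≠ 1 → K w = (w - 1) * hurwitzZetaEven a w := by
  -- Subtracting 1/((w-1)Γ_ℝ(w)) removes the singularity at 1; after multiplication by w-1 the
  -- subtracted term is the entire function 1/Γ_ℝ, which is added back.
  refine ⟨fun w => (w - 1) * (hurwitzZetaEven a w - 1 / (w - 1) / Complex.Gammaℝ w) +
    (Complex.Gammaℝ w)⁻¹, fun w => ?_, fun w hw => ?_⟩
  · have hΓ := Complex.differentiable_Gammaℝ_inv w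
    refine DifferentiableAt.add (DifferentiableAt.mul (by fun_prop) ?_) hΓ
    rcases eq_or_ne w 1 with rfl | hw
    · exact differentiableAt_hurwitzZetaEven_sub_one_div a
    · refine (differentiableAt_hurwitzZetaEven a hw).sub ?_
      simp_rw [fun w : ℂ => div_eq_mul_inv (1 / (w - 1)) (Complex.Gammaℝ w)]
      refine DifferentiableAt.mul ?_ hΓ
      exact (differentiableAt_const _).div (by fun_prop) (sub_ne_zero.mpr hw)
  · have := sub_ne_zero.mpr hw
    field_simp
    ring

theorem sub_one_re {k : ℕ} {s : ℂ} (hs : 2 < ((k : ℂ) + 2 * s).re) :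
    1 < ((k : ℂ) + 2 * s - 1).re := by
  rw [Complex.sub_re, Complex.one_re]; linarith

open HurwitzZeta in
/-- The contribution of the integrals along horizontal lines: the pole of the even Hurwitz zeta
function is cancelled by a zero of the integral. -/
theorem exists_continuation_hurwitz {k : ℕ} (hk : 2 ≤ k) (α : ℝ) :
    ∃ H : ℂ → ℂ, DifferentiableOn ℂ H {s | 1 < ((k : ℂ) + 2 * s).re} ∧
      ∀ s : ℂ, 2 < ((k : ℂ) + 2 * s).re → HasSum (fun l : ℤ =>
        ((SignType.sign (l + α) : ℝ) : ℂ) ^ k / ((|l + α| : ℝ) : ℂ) ^ ((k : ℂ) + 2 * s - 1) *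
          lineIntegral k s) (H s) := by
  have hU := isOpen_halfPlane k 1
  rcases Nat.even_or_odd k with hev | hodd
  · obtain ⟨K, hK, hK'⟩ := exists_differentiable_sub_one_mul_hurwitzZetaEven (α : UnitAddCircle)
    set s₀ : ℂ := 1 - k / 2 with hs₀
    have hmem : s₀ ∈ {s : ℂ | 1 < ((k : ℂ) + 2 * s).re} := by
      have : (k : ℂ) + 2 * s₀ = 2 := by rw [hs₀]; ring
      rw [Set.mem_ofPred_eq, this]; norm_num
    -- At s₀ the Hurwitz argument k+2s-1 equals 1. The divided difference removes the zero of the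
    -- integral there and K carries the factor w-1, so their product is holomorphic across s₀.
    refine ⟨fun s => dslope (lineIntegral k) s₀ s * K ((k : ℂ) + 2 * s - 1), ?_, fun s hs => ?_⟩
    · refine DifferentiableOn.mul ?_ (hK.comp (by fun_prop)).differentiableOn
      exact (Complex.differentiableOn_dslope (hU.mem_nhds hmem)).mpr
        (differentiableOn_lineIntegral k)
    · have hw := sub_one_re hs
      have hw1 : (k : ℂ) + 2 * s - 1 ≠ 1 := fun h => by rw [h] at hw; simp at hw
      have hw0 : (k : ℂ) + 2 * s - 1 ≠ 0 := fun h => by rw [h] at hw; norm_num at hw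
      have hne : s ≠ s₀ := by
        rintro rfl
        exact hw1 (by rw [hs₀]; ring)
      have hval : dslope (lineIntegral k) s₀ s * K ((k : ℂ) + 2 * s - 1) =
          2 * lineIntegral k s * hurwitzZetaEven α ((k : ℂ) + 2 * s - 1) := by
        -- This factor 2 compensates for the 1/2 in the series of the even Hurwitz zeta function.
        have h1 : (k : ℂ) + 2 * s - 1 - 1 = 2 * (s - s₀) := by rw [hs₀]; ring
        rw [dslope_of_ne _ hne, slope_def_field, hs₀, lineIntegral_eq_zero hk hev, ← hs₀, sub_zero,
          hK' _ hw1, h1]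
        field_simp [sub_ne_zero.mpr hne]
      simp only
      rw [hval]
      refine ((hasSum_int_hurwitzZetaEven α hw).mul_left (2 * lineIntegral k s)).congr_fun
        fun l => ?_
      -- At l + α = 0 both terms vanish by convention: 0ʷ = 0 for w ≠ 0, and division by zero gives
      -- 0.
      rcases eq_or_ne ((l : ℝ) + α) 0 with h0 | h0
      · rw [h0]
        simp [Complex.zero_cpow hw0]
      · have : ((SignType.sign ((l : ℝ) + α) : ℝ) : ℂ) ^ k = 1 := by
          rcases lt_or_gt_of_ne h0 with h | h
          · simp [sign_neg h, hev.neg_one_pow]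
          · simp [sign_pos h]
        rw [this]
        ring
  · refine ⟨fun s => 2 * lineIntegral k s * hurwitzZetaOdd α ((k : ℂ) + 2 * s - 1), ?_,
      fun s hs => ?_⟩
    · refine ((differentiableOn_lineIntegral k).const_mul _).mul
        ((differentiable_hurwitzZetaOdd _).comp (by fun_prop)).differentiableOn
    · have hw := sub_one_re hs
      refine ((hasSum_int_hurwitzZetaOdd α hw).mul_left (2 * lineIntegral k s)).congr_fun
        fun l => ?_
      have : ((SignType.sign ((l : ℝ) + α) : ℝ) : ℂ) ^ k = (SignType.sign ((l : ℝ) + α) : ℂ) := by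
        rcases lt_trichotomy ((l : ℝ) + α) 0 with h | h | h
        · simp [sign_neg h, hodd.neg_one_pow]
        · simp [h, hodd.pos.ne']
        · simp [sign_pos h]
      rw [this]
      ring

/-! ### Sums over a coset of Nℤ × Nℤ -/

section Lattice

variable (k N : ℕ) (a b : ℤ) (τ : ℍ)

/-- The part of the regularized lattice sum off the line `c = 0`. -/
theorem differentiableOn_tsum_cellDiff (hN : 0 < N) :
    DifferentiableOn ℂ (fun s => ∑' p : ℤ × ℤ, if a + N * p.1 = 0 then 0 else
      cellDiff k N s (((a + N * p.1 : ℤ) : ℂ) * τ + (b + N * p.2 : ℤ)))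
      {s | 1 < ((k : ℂ) + 2 * s).re} := by
  obtain ⟨K, hK, hKb⟩ := exists_norm_vec_le τ N
  refine differentiableOn_tsum_of_locally_dominated (fun p => ?_) ?_ (isOpen_halfPlane k 1)
  · split_ifs with h
    · exact differentiableOn_const _
    · refine (differentiable_cellDiff k N ?_).differentiableOn
      have : ((a + N * p.1 : ℤ) : ℝ) ≠ 0 := by exact_mod_cast h
      have h2 := mul_ne_zero this τ.im_pos.ne'
      simpa using h2
  · intro s₀ hs₀
    rw [Set.mem_ofPred_eq] at hs₀
    obtain ⟨r, hr1, hr2⟩ := exists_between hs₀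
    -- Both bounds on Re(k+2s) are needed: the lower bound r controls the decay in the vector, the
    -- upper bound R controls the power of K.
    set R := ((k : ℂ) + 2 * s₀).re + 1 with hR
    refine ⟨{s | r < ((k : ℂ) + 2 * s).re ∧ ((k : ℂ) + 2 * s).re < R ∧ ‖s‖ < ‖s₀‖ + 1},
      inter_mem ((isOpen_halfPlane k r).mem_nhds hr2) (inter_mem
        ((isOpen_lt (f := fun s : ℂ => ((k : ℂ) + 2 * s).re) (by fun_prop)
          continuous_const).mem_nhds (by simp [hR]))
        ((isOpen_lt (f := fun s : ℂ => ‖s‖) (by fun_prop) continuous_const).mem_nhds (by simp))),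
      fun p => (k + 2 * (‖s₀‖ + 1)) * N * K ^ (R + 1) *
        ‖![a + N * p.1, b + N * p.2]‖ ^ (-(r + 1)),
      (summable_vec_rpow hN a b (by linarith)).mul_left _, fun p s hs => ?_⟩
    obtain ⟨hs1, hs2, hs3⟩ := hs
    split_ifs with h
    · rw [norm_zero]; positivity
    · refine (norm_cellDiff_le k N hK (by linarith) h (hKb _ _ h)).trans ?_
      have h1 : 1 ≤ ‖![a + N * p.1, b + N * p.2]‖ :=
        one_le_norm_vec fun h0 => h (congrFun h0 0)
      beta_reduce
      gcongr
      linarith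

theorem summable_cellDiff (hN : 0 < N) {s : ℂ} (hs : 1 < ((k : ℂ) + 2 * s).re) :
    Summable fun p : ℤ × ℤ => if a + N * p.1 = 0 then 0 else
      cellDiff k N s (((a + N * p.1 : ℤ) : ℂ) * τ + (b + N * p.2 : ℤ)) := by
  obtain ⟨K, hK, hKb⟩ := exists_norm_vec_le τ N
  refine Summable.of_norm_bounded ((summable_vec_rpow hN a b
    (q := ((k : ℂ) + 2 * s).re + 1) (by linarith)).mul_left
    ((k + 2 * ‖s‖) * N * K ^ (((k : ℂ) + 2 * s).re + 1))) fun p => ?_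
  split_ifs with h
  · rw [norm_zero]; positivity
  · rw [neg_add']
    exact norm_cellDiff_le k N hK (by linarith) h (hKb _ _ h)

/-- The part of the lattice sum on the line `c = 0`. -/
theorem differentiableOn_tsum_line (hN : 0 < N) :
    DifferentiableOn ℂ (fun s => ∑' m : ℤ, if b + N * m = 0 then 0 else
      powTerm k s ((b + N * m : ℤ) : ℂ)) {s | 1 < ((k : ℂ) + 2 * s).re} := by
  refine differentiableOn_tsum_of_locally_dominated (fun m => ?_) ?_ (isOpen_halfPlane k 1)
  · split_ifs with h
    · exact differentiableOn_const _
    · exact (differentiable_powTerm k (by exact_mod_cast h)).differentiableOn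
  · intro s₀ hs₀
    rw [Set.mem_ofPred_eq] at hs₀
    obtain ⟨r, hr1, hr2⟩ := exists_between hs₀
    have hinj : Function.Injective fun m : ℤ => b + N * m := by
      intro m m' h
      simpa [hN.ne'] using h
    refine ⟨_, (isOpen_halfPlane k r).mem_nhds hr2, fun m => |((b + N * m : ℤ) : ℝ)| ^ (-r),
      (Real.summable_abs_int_rpow hr1).comp_injective hinj, fun m s hs => ?_⟩
    rw [Set.mem_ofPred_eq] at hs
    split_ifs with h
    · rw [norm_zero]; positivity
    · have h1 : (1 : ℝ) ≤ |((b + N * m : ℤ) : ℝ)| := by exact_mod_cast Int.one_le_abs h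
      rw [norm_powTerm k s (by exact_mod_cast h), Complex.norm_intCast]
      exact Real.rpow_le_rpow_of_exponent_le h1 (by linarith)

/-- The means over the cells of a horizontal line add up to the integral along the line. -/
theorem hasSum_cell_integral {s : ℂ} (hs : 1 < ((k : ℂ) + 2 * s).re) (hN : 0 < N) {c : ℤ}
    (hc : c ≠ 0) :
    HasSum (fun m : ℤ => ∫ x in (0 : ℝ)..1,
      powTerm k s ((c : ℂ) * τ + (b + N * m : ℤ) + ((N * x : ℝ) : ℂ)))
      (∫ x : ℝ, powTerm k s (c * τ + b + ((N * x : ℝ) : ℂ))) := by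
  refine ((integrable_powTerm_line hs hN τ hc b).hasSum_intervalIntegral 0).congr_fun fun m => ?_
  have := intervalIntegral.integral_comp_add_right (a := 0) (b := 1)
    (fun x : ℝ => powTerm k s (c * τ + b + ((N * x : ℝ) : ℂ))) (m : ℝ)
  rw [add_right_comm, zero_add 1, ← this]
  refine intervalIntegral.integral_congr fun x _ => ?_
  congr 1
  push_cast
  ring

/-- The lattice sum over a coset of `Nℤ × Nℤ` continues analytically. -/
theorem exists_continuation_lattice (hk : 2 ≤ k) (hN : 0 < N) (ha : 0 ≤ a) (haN : a < N) :
    ∃ F : ℂ → ℂ, DifferentiableOn ℂ F {s | 1 < ((k : ℂ) + 2 * s).re} ∧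
      ∀ s : ℂ, 2 < ((k : ℂ) + 2 * s).re → F s = ∑' p : ℤ × ℤ,
        if ![a + N * p.1, b + N * p.2] = 0 then 0 else
          powTerm k s (((a + N * p.1 : ℤ) : ℂ) * τ + (b + N * p.2 : ℤ)) := by
  obtain ⟨H, hH, hHs⟩ := exists_continuation_hurwitz hk (a / N : ℝ)
  have hNC : (N : ℂ) ≠ 0 := by exact_mod_cast hN.ne'
  have hτC : (τ.im : ℂ) ≠ 0 := by exact_mod_cast τ.im_pos.ne'
  set A : ℂ → ℂ := fun s => ∑' p : ℤ × ℤ, if a + N * p.1 = 0 then 0 else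
      cellDiff k N s (((a + N * p.1 : ℤ) : ℂ) * τ + (b + N * p.2 : ℤ)) with hA
  set B : ℂ → ℂ := fun s => ∑' m : ℤ, if b + N * m = 0 then 0 else
      powTerm k s ((b + N * m : ℤ) : ℂ) with hB
  -- The three summands are the cell differences off the row c = 0, the row c = 0 itself (present
  -- only if a = 0), and the integrals over the rows c ≠ 0.
  refine ⟨fun s => A s + (if a = 0 then 1 else 0) * B s +
    (N : ℂ)⁻¹ * ((N * τ.im : ℝ) : ℂ) ^ (1 - ((k : ℂ) + 2 * s)) * H s, ?_, fun s hs => ?_⟩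
  · refine ((differentiableOn_tsum_cellDiff k N a b τ hN).add
      ((differentiableOn_tsum_line k N b hN).const_mul _)).add (DifferentiableOn.mul ?_ hH)
    refine (Differentiable.const_mul (fun s => DifferentiableAt.const_cpow (by fun_prop)
      (Or.inl ?_)) _).differentiableOn
    push_cast
    exact mul_ne_zero hNC hτC
  · set t : ℤ × ℤ → ℂ := fun p => if ![a + N * p.1, b + N * p.2] = 0 then 0 else
      powTerm k s (((a + N * p.1 : ℤ) : ℂ) * τ + (b + N * p.2 : ℤ)) with ht
    set tA : ℤ × ℤ → ℂ := fun p => if a + N * p.1 = 0 then 0 else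
      cellDiff k N s (((a + N * p.1 : ℤ) : ℂ) * τ + (b + N * p.2 : ℤ)) with htA
    set tB : ℤ × ℤ → ℂ := fun p => if a + N * p.1 = 0 then
      (if b + N * p.2 = 0 then 0 else powTerm k s ((b + N * p.2 : ℤ) : ℂ)) else 0 with htB
    set tJ : ℤ × ℤ → ℂ := fun p => if a + N * p.1 = 0 then 0 else ∫ x in (0 : ℝ)..1,
      powTerm k s (((a + N * p.1 : ℤ) : ℂ) * τ + (b + N * p.2 : ℤ) + ((N * x : ℝ) : ℂ)) with htJ
    have hsplit : ∀ p, t p = tA p + tB p + tJ p := by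
      intro p
      simp only [ht, htA, htB, htJ]
      by_cases h : a + N * p.1 = 0
      · simp [h]
      · simp [h, cellDiff]
    have hst : Summable t := by
      refine ((summable_powTerm τ hs).comp_injective (injective_vec hN a b)).congr fun p => ?_
      simp [ht]
    have hsA : Summable tA := summable_cellDiff k N a b τ hN (by linarith)
    have hsB : Summable tB := by
      refine Summable.of_norm_bounded hst.norm fun p => ?_
      simp only [ht, htB]
      by_cases h : a + N * p.1 = 0
      · simp [h]
      · simp [h]
    -- The double series of means is summable because it is the lattice series minus two summable
    -- series; only then may it be summed row by row.
    have hsJ : Summable tJ := by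
      refine ((hst.sub hsA).sub hsB).congr fun p => ?_
      rw [hsplit p]; ring
    -- The normalization 0 ≤ a < N leaves only l = 0 as a possible row with c = 0.
    have hline : ∀ l : ℤ, a + N * l = 0 ↔ a = 0 ∧ l = 0 := by
      intro l
      constructor
      · intro h
        have hl : l = 0 := by
          have hN' : (0 : ℤ) < N := by exact_mod_cast hN
          by_contra hl
          rcases lt_or_gt_of_ne hl with h' | h' <;> nlinarith
        subst hl
        simpa using h
      · rintro ⟨rfl, rfl⟩; simp
    have hBsum : ∑' p, tB p = (if a = 0 then 1 else 0) * B s := by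
      rw [hsB.tsum_prod]
      simp only [htB, hline]
      by_cases h : a = 0
      · rw [tsum_eq_single 0 (fun l hl => by simp [hl])]
        simp [h, hB]
      · simp [h]
    have hJsum : ∑' p, tJ p =
        (N : ℂ)⁻¹ * ((N * τ.im : ℝ) : ℂ) ^ (1 - ((k : ℂ) + 2 * s)) * H s := by
      rw [hsJ.tsum_prod, ← (hHs s hs).tsum_eq, ← tsum_mul_left]
      refine tsum_congr fun l => ?_
      -- Writing c = N(l + a/N) identifies a/N as the Hurwitz parameter.
      have hl : ((a + N * l : ℤ) : ℝ) = N * (l + a / N) := by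
        have : (N : ℝ) ≠ 0 := by exact_mod_cast hN.ne'
        push_cast
        field_simp
        ring
      by_cases h : a + N * l = 0
      · have h0 : (l : ℝ) + a / N = 0 := by
          rw [h, Int.cast_zero, zero_eq_mul] at hl
          exact hl.resolve_left (by exact_mod_cast hN.ne')
        have hk0 : k ≠ 0 := by omega
        simp [htJ, h, h0, hk0]
      · simp only [htJ, if_neg h]
        rw [(hasSum_cell_integral k N b τ (by linarith) hN h).tsum_eq,
          integral_powTerm_line s hN τ h b, hl, abs_mul, sign_mul, Nat.abs_cast,
          sign_pos (by exact_mod_cast hN : (0 : ℝ) < N), one_mul, mul_right_comm (N : ℝ),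
          Complex.ofReal_mul, Complex.mul_cpow_ofReal_nonneg (by have := τ.im_pos; positivity)
          (abs_nonneg _), ← neg_sub ((k : ℂ) + 2 * s) 1, Complex.cpow_neg (|_| : ℝ)]
        ring
    rw [tsum_congr hsplit, (hsA.add hsB).tsum_add hsJ, hsA.tsum_add hsB, hBsum, hJsum]

end Lattice

end

section

open Filter

/-! ### Series over a congruence class of vectors -/

open Classical in
theorem tsum_subtype_eq_ite {ι : Type*} (p : ι → Prop) (f : ι → ℂ) :
    ∑' w : {w // p w}, f w = ∑' w, if p w then f w else 0 := by
  rw [← Subtype.val_injective.tsum_eq (f := fun w => if p w then f w else 0) (g := Subtype.val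
    (p := p))]
  · exact tsum_congr fun w => (if_pos w.2).symm
  · intro w hw
    rw [Function.mem_support] at hw
    exact ⟨⟨w, by_contra fun h => hw (if_neg h)⟩, rfl⟩

/-- The class is parametrized by the least nonnegative residues of its two coordinates, which
supplies 0 ≤ a < N; the factor Im(τ)ˢ is entire in s. -/
theorem exists_continuation_levelG {k : ℕ} (hk : 2 ≤ k) {N : ℕ} [NeZero N] (v : Lat N) (τ : ℍ) :
    ∃ F, IsContinuation k (levelG k v τ) F := by
  classical
  have hN := NeZero.pos N
  obtain ⟨a, ha⟩ : ∃ a : ℤ, a = ((v.val 0).val : ℕ) := ⟨_, rfl⟩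
  obtain ⟨b, hb⟩ : ∃ b : ℤ, b = ((v.val 1).val : ℕ) := ⟨_, rfl⟩
  have haN : a < N := by rw [ha]; exact_mod_cast ZMod.val_lt _
  obtain ⟨F, hF, hFs⟩ := exists_continuation_lattice k N a b τ hk hN (by rw [ha]; positivity) haN
  refine ⟨fun s => (τ.im : ℂ) ^ s * F s, ?_, fun s hs => ?_⟩
  · refine DifferentiableOn.analyticOnNhd (DifferentiableOn.mul ?_ hF) (isOpen_halfPlane k 1)
    refine Differentiable.differentiableOn fun s => ?_
    exact DifferentiableAt.const_cpow differentiableAt_id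
      (Or.inl (by exact_mod_cast τ.im_pos.ne'))
  · rw [hFs s hs, levelG, tsum_subtype_eq_ite, ← tsum_mul_left,
      ← (injective_vec hN a b).tsum_eq]
    · refine tsum_congr fun p => ?_
      have hcast : (fun i => ((![a + N * p.1, b + N * p.2] i : ℤ) : ZMod N)) = v.val := by
        ext i
        fin_cases i <;> simp [ha, hb]
      by_cases h : ![a + N * p.1, b + N * p.2] = 0
      · rw [if_pos h, if_neg (fun h' => h'.2 h), mul_zero]
      · rw [if_neg h, if_pos ⟨hcast, h⟩, eisTerm_eq]
        rfl
    · intro w hw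
      rw [Function.mem_support] at hw
      have hw' : (fun i => (w i : ZMod N)) = v.val := by
        by_contra h
        exact hw (if_neg fun h' => h h'.1)
      have key : ∀ i, ∃ m : ℤ, ((v.val i).val : ℤ) + N * m = w i := by
        intro i
        have h1 : ((w i : ℤ) : ZMod N) = (((v.val i).val : ℤ) : ZMod N) := by
          rw [Int.cast_natCast, ZMod.natCast_zmod_val]
          exact congrFun hw' i
        obtain ⟨m, hm⟩ := (ZMod.intCast_eq_intCast_iff_dvd_sub _ _ N).mp h1.symm
        exact ⟨m, by linarith⟩
      obtain ⟨l, hl⟩ := key 0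
      obtain ⟨m, hm⟩ := key 1
      refine ⟨(l, m), ?_⟩
      ext i
      fin_cases i
      · exact ha ▸ hl
      · exact hb ▸ hm

/-! ### Primitive vectors, parity and homogeneity -/

/-- The sum over the primitive vectors in a class modulo `N`. -/
noncomputable def primG (k : ℕ) {N : ℕ} (v : Lat N) (τ : ℍ) (s : ℂ) : ℂ :=
  ∑' w : {w : Fin 2 → ℤ // (fun i => (w i : ZMod N)) = v.val ∧ IsCoprime (w 0) (w 1)},
    eisTerm k τ s w.1

theorem eisTerm_neg (k : ℕ) (τ : ℍ) (s : ℂ) (w : Fin 2 → ℤ) :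
    eisTerm k τ s (-w) = (-1) ^ k * eisTerm k τ s w := by
  have : (((-w) 0 : ℤ) : ℂ) * τ + ((-w) 1 : ℤ) = -((w 0 : ℂ) * τ + w 1) := by
    simp only [Pi.neg_apply]; push_cast; ring
  rw [eisTerm_eq, eisTerm_eq, this, powTerm_neg]
  ring

theorem eisTerm_nsmul (k : ℕ) (τ : ℍ) (s : ℂ) {n : ℕ} (hn : 0 < n) (w : Fin 2 → ℤ) :
    eisTerm k τ s (n • w) = 1 / (n : ℂ) ^ ((k : ℂ) + 2 * s) * eisTerm k τ s w := by
  have : (((n • w) 0 : ℤ) : ℂ) * τ + ((n • w) 1 : ℤ) = ((n : ℝ) : ℂ) * ((w 0 : ℂ) * τ + w 1) := by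
    simp only [Pi.smul_apply, nsmul_eq_mul]; push_cast; ring
  rw [eisTerm_eq, eisTerm_eq, this, powTerm_ofReal_mul k s (by exact_mod_cast hn),
    Complex.cpow_neg, Complex.ofReal_natCast]
  ring

theorem intCast_neg_eq_iff {N : ℕ} (v : Lat N) (w : Fin 2 → ℤ) :
    (fun i => (((-w) i : ℤ) : ZMod N)) = (-v).val ↔ (fun i => (w i : ZMod N)) = v.val := by
  rw [Lat.neg_val, ← neg_inj]
  simp only [Pi.neg_apply, Int.cast_neg, neg_neg]
  constructor <;> intro h <;> [rw [← h]; rw [← h]] <;> ext i <;> simp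

theorem levelG_neg (k : ℕ) {N : ℕ} (v : Lat N) (τ : ℍ) (s : ℂ) :
    levelG k (-v) τ s = (-1) ^ k * levelG k v τ s := by
  classical
  rw [levelG, levelG, tsum_subtype_eq_ite, tsum_subtype_eq_ite, ← tsum_mul_left,
    ← (Equiv.neg (Fin 2 → ℤ)).tsum_eq]
  refine tsum_congr fun w => ?_
  simp only [Equiv.neg_apply, intCast_neg_eq_iff, neg_ne_zero, eisTerm_neg, mul_ite, mul_zero]

theorem primG_neg (k : ℕ) {N : ℕ} (v : Lat N) (τ : ℍ) (s : ℂ) :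
    primG k (-v) τ s = (-1) ^ k * primG k v τ s := by
  classical
  rw [primG, primG, tsum_subtype_eq_ite, tsum_subtype_eq_ite, ← tsum_mul_left,
    ← (Equiv.neg (Fin 2 → ℤ)).tsum_eq]
  refine tsum_congr fun w => ?_
  rw [Equiv.neg_apply, intCast_neg_eq_iff]
  simp only [Pi.neg_apply, IsCoprime.neg_neg_iff, eisTerm_neg, mul_ite, mul_zero]

theorem summable_eisTerm {k : ℕ} (τ : ℍ) {s : ℂ} (hs : 2 < ((k : ℂ) + 2 * s).re) :
    Summable fun w : Fin 2 → ℤ => if w = 0 then 0 else eisTerm k τ s w := by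
  refine ((summable_powTerm τ hs).mul_left ((τ.im : ℂ) ^ s)).congr fun w => ?_
  rw [mul_ite, mul_zero, eisTerm_eq]

theorem ne_zero_of_isCoprime_vec {w : Fin 2 → ℤ} (hw : IsCoprime (w 0) (w 1)) : w ≠ 0 := by
  rintro rfl
  exact not_isCoprime_zero_zero hw

/-! ### Zeta functions of residue classes -/

-- Passing to L-series gives analyticity from the abscissa of absolute convergence and products from
-- Dirichlet convolution. The condition n ≥ 1 is absorbed because the L-series term at 0 is 0.
open Classical in
theorem zetaPlus_eq_LSeries {N : ℕ} (δ : (ZMod N)ˣ) (z : ℂ) :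
    zetaPlus δ z = LSeries (fun n => if (n : ZMod N) = δ then 1 else 0) z := by
  rw [zetaPlus, tsum_subtype_eq_ite (fun n : ℕ => 1 ≤ n ∧ (n : ZMod N) = δ)
    (fun n => 1 / (n : ℂ) ^ z)]
  refine tsum_congr fun n => ?_
  rcases Nat.eq_zero_or_pos n with rfl | hn
  · simp
  · rw [LSeries.term_of_ne_zero hn.ne']
    by_cases h : (n : ZMod N) = δ
    · simp [h, Nat.one_le_iff_ne_zero, hn.ne']
    · simp [h]

open Classical in
theorem zetaPlusMu_eq_LSeries {N : ℕ} (δ : (ZMod N)ˣ) (z : ℂ) :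
    zetaPlusMu δ z = LSeries (fun n => if (n : ZMod N) = δ then
      ((ArithmeticFunction.moebius n : ℤ) : ℂ) else 0) z := by
  rw [zetaPlusMu, tsum_subtype_eq_ite (fun n : ℕ => 1 ≤ n ∧ (n : ZMod N) = δ)
    (fun n => ((ArithmeticFunction.moebius n : ℤ) : ℂ) / (n : ℂ) ^ z)]
  refine tsum_congr fun n => ?_
  rcases Nat.eq_zero_or_pos n with rfl | hn
  · simp
  · rw [LSeries.term_of_ne_zero hn.ne']
    by_cases h : (n : ZMod N) = δ
    · simp [h, Nat.one_le_iff_ne_zero, hn.ne']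
    · simp [h]

open Classical in
theorem abscissa_ite_le_one {N : ℕ} (δ : (ZMod N)ˣ) {f : ℕ → ℂ} (hf : ∀ n, ‖f n‖ ≤ 1) :
    LSeries.abscissaOfAbsConv (fun n => if (n : ZMod N) = δ then f n else 0) ≤ 1 := by
  refine LSeries.abscissaOfAbsConv_le_of_le_const ⟨1, fun n _ => ?_⟩
  split_ifs
  · exact hf n
  · simp

theorem norm_moebius_le_one (n : ℕ) : ‖((ArithmeticFunction.moebius n : ℤ) : ℂ)‖ ≤ 1 := by
  rw [Complex.norm_intCast]
  exact_mod_cast ArithmeticFunction.abs_moebius_le_one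

theorem analyticOnNhd_LSeries_comp (k : ℕ) {f : ℕ → ℂ} (hf : LSeries.abscissaOfAbsConv f ≤ 1) :
    AnalyticOnNhd ℂ (fun s => LSeries f ((k : ℂ) + 2 * s)) {s | 1 < ((k : ℂ) + 2 * s).re} := by
  refine (LSeries_analyticOnNhd f).comp (f := fun s : ℂ => (k : ℂ) + 2 * s)
    (fun s _ => by fun_prop) fun s hs => ?_
  exact lt_of_le_of_lt hf (by exact_mod_cast hs)

theorem analyticOnNhd_zetaPlus (k : ℕ) {N : ℕ} (δ : (ZMod N)ˣ) :
    AnalyticOnNhd ℂ (fun s => zetaPlus δ ((k : ℂ) + 2 * s)) {s | 1 < ((k : ℂ) + 2 * s).re} := by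
  simp_rw [zetaPlus_eq_LSeries]
  exact analyticOnNhd_LSeries_comp k (abscissa_ite_le_one δ fun _ => by simp)

theorem analyticOnNhd_zetaPlusMu (k : ℕ) {N : ℕ} (δ : (ZMod N)ˣ) :
    AnalyticOnNhd ℂ (fun s => zetaPlusMu δ ((k : ℂ) + 2 * s)) {s | 1 < ((k : ℂ) + 2 * s).re} := by
  simp_rw [zetaPlusMu_eq_LSeries]
  exact analyticOnNhd_LSeries_comp k (abscissa_ite_le_one δ norm_moebius_le_one)

open Classical in
/-- The two families of partial zeta functions are inverse to each other in the group algebra of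
`(ℤ/N)ˣ`. -/
theorem sum_zetaPlusMu_mul_zetaPlus {N : ℕ} [NeZero N] (η : (ZMod N)ˣ) {z : ℂ} (hz : 1 < z.re) :
    ∑ δ : (ZMod N)ˣ, zetaPlusMu δ z * zetaPlus (δ⁻¹ * η) z = if η = 1 then 1 else 0 := by
  set f : (ZMod N)ˣ → ℕ → ℂ := fun δ n => if (n : ZMod N) = δ then
      ((ArithmeticFunction.moebius n : ℤ) : ℂ) else 0 with hf
  set g : (ZMod N)ˣ → ℕ → ℂ := fun δ n => if (n : ZMod N) = δ then 1 else 0 with hg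
  have hz' : (1 : EReal) < (z.re : EReal) := by exact_mod_cast hz
  have hfs : ∀ δ, LSeriesSummable (f δ) z := fun δ =>
    LSeriesSummable_of_abscissaOfAbsConv_lt_re
      ((abscissa_ite_le_one δ norm_moebius_le_one).trans_lt hz')
  have hgs : ∀ δ, LSeriesSummable (g δ) z := fun δ =>
    LSeriesSummable_of_abscissaOfAbsConv_lt_re
      ((abscissa_ite_le_one δ fun _ => by simp).trans_lt hz')
  simp_rw [zetaPlus_eq_LSeries, zetaPlusMu_eq_LSeries]
  have h1 : ∀ δ : (ZMod N)ˣ, LSeries (f δ) z * LSeries (g (δ⁻¹ * η)) z =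
      LSeries (LSeries.convolution (f δ) (g (δ⁻¹ * η))) z :=
          fun δ => (LSeries_convolution' (hfs _) (hgs _)).symm
  calc _ = ∑ δ : (ZMod N)ˣ, LSeries (LSeries.convolution (f δ) (g (δ⁻¹ * η))) z :=
      Finset.sum_congr rfl fun δ _ => h1 δ
    _ = LSeries (∑ δ : (ZMod N)ˣ, LSeries.convolution (f δ) (g (δ⁻¹ * η))) z :=
      (LSeries_sum fun δ _ => (hfs δ).convolution (hgs _)).symm
    _ = LSeries ((if η = 1 then (1 : ℂ) else 0) • LSeries.delta) z := by
      refine LSeries_congr (fun {n} hn => ?_) z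
      -- In a factorization n = p₁p₂ with n ≡ η, the factor p₁ is a unit modulo N; exactly one δ,
      -- its class, contributes, and then p₂ ≡ δ⁻¹η automatically.
      have hconv : ∀ p ∈ n.divisorsAntidiagonal, ∑ δ : (ZMod N)ˣ, f δ p.1 * g (δ⁻¹ * η) p.2 =
          if (n : ZMod N) = η then ((ArithmeticFunction.moebius p.1 : ℤ) : ℂ) else 0 := by
        intro p hp
        have hpn : (p.1 : ZMod N) * p.2 = n := by
          rw [← (Nat.mem_divisorsAntidiagonal.mp hp).1, Nat.cast_mul]
        simp only [hf, hg]
        by_cases hη : (n : ZMod N) = η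
        · rw [if_pos hη]
          have hu : IsUnit (p.1 : ZMod N) :=
            isUnit_of_mul_isUnit_left (hpn ▸ hη ▸ η.isUnit : IsUnit ((p.1 : ZMod N) * p.2))
          obtain ⟨ε, hε⟩ := hu
          rw [Finset.sum_eq_single ε]
          · rw [if_pos hε.symm, if_pos, mul_one]
            rw [Units.val_mul, ← hη, ← hpn, ← hε, Units.inv_mul_cancel_left]
          · intro δ _ hδ
            rw [if_neg, zero_mul]
            rw [← hε]
            exact fun h => hδ (Units.ext h).symm
          · simp
        · rw [if_neg hη]
          refine Finset.sum_eq_zero fun δ _ => ?_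
          by_cases h1 : (p.1 : ZMod N) = δ
          · rw [if_neg (c := (p.2 : ZMod N) = _), mul_zero]
            intro h2
            apply hη
            rw [← hpn, h1, h2, Units.val_mul, Units.mul_inv_cancel_left]
          · rw [if_neg h1, zero_mul]
      have hmu : ∑ p ∈ n.divisorsAntidiagonal, ((ArithmeticFunction.moebius p.1 : ℤ) : ℂ) =
          if n = 1 then 1 else 0 := by
        have := congrArg (fun F : ArithmeticFunction ℤ => ((F n : ℤ) : ℂ))
          ArithmeticFunction.moebius_mul_coe_zeta
        simp only [ArithmeticFunction.mul_apply, ArithmeticFunction.one_apply] at this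
        push_cast at this
        rw [← this]
        refine Finset.sum_congr rfl fun p hp => ?_
        have : p.2 ≠ 0 := (Nat.ne_zero_of_mem_divisorsAntidiagonal hp).2
        simp [this]
      rw [Finset.sum_apply]
      simp only [LSeries.convolution_def]
      rw [Finset.sum_comm, Finset.sum_congr rfl hconv, Pi.smul_apply, LSeries.delta]
      by_cases hη : (n : ZMod N) = η
      · simp only [hη, if_true]
        rw [hmu]
        rcases eq_or_ne n 1 with rfl | hn1
        · have : η = 1 := Units.ext (by rw [← hη]; simp)
          simp [this]
        · simp [hn1]
      · simp only [hη, if_false, Finset.sum_const_zero]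
        rcases eq_or_ne n 1 with rfl | hn1
        · have : η ≠ 1 := fun h => hη (by simp [h])
          simp [this]
        · simp [hn1]
    _ = _ := by
      rw [LSeries_smul, LSeries_delta]
      simp

/-! ### Decomposition according to the greatest common divisor -/

/-- The vector `n u` for `n ≥ 1` and `u` primitive. -/
def mulPrim (q : ℕ+ × {u : Fin 2 → ℤ // IsCoprime (u 0) (u 1)}) : Fin 2 → ℤ :=
  (q.1 : ℕ) • q.2.1

theorem gcd_mulPrim (q : ℕ+ × {u : Fin 2 → ℤ // IsCoprime (u 0) (u 1)}) :
    (mulPrim q 0).gcd (mulPrim q 1) = q.1 := by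
  have := Int.isCoprime_iff_gcd_eq_one.mp q.2.2
  simp [mulPrim, Int.gcd_mul_left, this]

theorem mulPrim_injective : Function.Injective mulPrim := by
  rintro ⟨n, u⟩ ⟨m, w⟩ h
  have h1 := gcd_mulPrim (n, u)
  rw [h, gcd_mulPrim] at h1
  have h2 : m = n := PNat.coe_injective h1
  subst h2
  refine Prod.ext rfl (Subtype.ext ?_)
  exact nsmul_right_injective m.ne_zero h

theorem exists_mulPrim_eq {w : Fin 2 → ℤ} (hw : w ≠ 0) : ∃ q, mulPrim q = w := by
  have hg : (w 0).gcd (w 1) ≠ 0 := by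
    intro h
    rw [Int.gcd_eq_zero_iff] at h
    exact hw (by ext i; fin_cases i <;> simp [h])
  refine ⟨(⟨_, Nat.pos_of_ne_zero hg⟩, ⟨![w 0 / (w 0).gcd (w 1), w 1 / (w 0).gcd (w 1)], ?_⟩), ?_⟩
  · rw [Int.isCoprime_iff_gcd_eq_one]
    exact Int.gcd_ediv_gcd_ediv_gcd (Nat.pos_of_ne_zero hg)
  · ext i
    fin_cases i
    · simpa [mulPrim] using Int.mul_ediv_cancel' (Int.gcd_dvd_left (w 0) (w 1))
    · simpa [mulPrim] using Int.mul_ediv_cancel' (Int.gcd_dvd_right (w 0) (w 1))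

theorem mulPrim_ne_zero (q) : mulPrim q ≠ 0 := fun h => by
  have := gcd_mulPrim q
  rw [h] at this
  exact q.1.ne_zero (by simpa using this.symm)

/-- A primitive vector has order N modulo N, so n times it has order N/gcd(N, n); this is N only if
n is prime to N. -/
theorem isUnit_of_nsmul_eq {N : ℕ} [NeZero N] (v : Lat N) {n : ℕ} (hn : n ≠ 0) {u : Fin 2 → ℤ}
    (hu : IsCoprime (u 0) (u 1)) (h : n • (fun i => (u i : ZMod N)) = v.val) :
    IsUnit (n : ZMod N) := by
  have h1 := addOrderOf_nsmul' (fun i => (u i : ZMod N)) hn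
  rw [h, v.order_eq, addOrderOf_of_isCoprime N hu] at h1
  rw [ZMod.isUnit_iff_coprime, Nat.coprime_comm]
  have h2 := Nat.div_mul_cancel (Nat.gcd_dvd_left N n)
  rw [← h1] at h2
  exact Nat.eq_of_mul_eq_mul_left (NeZero.pos N) (by rw [h2, mul_one])

-- The congruence n·u ≡ v forces δ to be the class of n, a unit by `isUnit_of_nsmul_eq`, and then
-- reads u ≡ δ⁻¹v. It thus splits into separate conditions on n and on u.
open Classical in
theorem sum_indicator_units {N : ℕ} [NeZero N] (v : Lat N) {n : ℕ} (hn : n ≠ 0) {u : Fin 2 → ℤ}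
    (hu : IsCoprime (u 0) (u 1)) (x y : ℂ) :
    (∑ δ : (ZMod N)ˣ, (if (n : ZMod N) = δ then x else 0) *
      (if (fun i => (u i : ZMod N)) = (v.scale δ⁻¹).val then y else 0)) =
      if n • (fun i => (u i : ZMod N)) = v.val then x * y else 0 := by
  have hval : ∀ δ : (ZMod N)ˣ, (v.scale δ⁻¹).val = δ⁻¹ • v.val := fun _ => rfl
  split_ifs with h
  · obtain ⟨ε, hε⟩ := isUnit_of_nsmul_eq v hn hu h
    have key : ∀ δ : (ZMod N)ˣ, (n : ZMod N) = δ → (fun i => (u i : ZMod N)) =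
        (v.scale δ⁻¹).val := by
      intro δ hδ
      rw [hval, eq_inv_smul_iff, ← h]
      ext i
      simp [Units.smul_def, ← hδ]
    rw [Finset.sum_eq_single ε]
    · rw [if_pos hε.symm, if_pos (key ε hε.symm)]
    · intro δ _ hδ
      rw [if_neg, zero_mul]
      rw [← hε]
      exact fun h => hδ (Units.ext h).symm
    · simp
  · refine Finset.sum_eq_zero fun δ _ => ?_
    by_cases h1 : (n : ZMod N) = δ
    · rw [if_neg (c := (fun i => (u i : ZMod N)) = _), mul_zero]
      intro h2
      apply h
      rw [h2, hval]
      ext i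
      simp [h1, Units.smul_def]
    · rw [if_neg h1, zero_mul]

/-- The vectors of the class are written as n·u and n⁻⁽ᵏ⁺²ˢ⁾ is pulled out. Absolute convergence
allows the product of the zeta series and the primitive series to be expanded as a double series. -/
theorem levelG_eq_sum_primG {k N : ℕ} [NeZero N] (v : Lat N) (τ : ℍ) {s : ℂ}
    (hs : 2 < ((k : ℂ) + 2 * s).re) :
    levelG k v τ s = ∑ δ : (ZMod N)ˣ, zetaPlus δ (k + 2 * s) * primG k (v.scale δ⁻¹) τ s := by
  classical
  set z : ℂ := (k : ℂ) + 2 * s with hz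
  set e : {u : Fin 2 → ℤ // IsCoprime (u 0) (u 1)} → ℂ := fun u => eisTerm k τ s u.1
  have hsumu : Summable e := by
    refine ((summable_eisTerm τ hs).comp_injective Subtype.val_injective).congr fun u => ?_
    exact if_neg (ne_zero_of_isCoprime_vec u.2)
  have hsumn : Summable fun n : ℕ+ => 1 / ((n : ℕ) : ℂ) ^ z :=
    (Complex.summable_one_div_nat_cpow.mpr (by linarith)).comp_injective PNat.coe_injective
  have hzeta : ∀ δ : (ZMod N)ˣ, zetaPlus δ z =
      ∑' n : ℕ+, if ((n : ℕ) : ZMod N) = δ then 1 / ((n : ℕ) : ℂ) ^ z else 0 := by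
    intro δ
    rw [zetaPlus, tsum_subtype_eq_ite (fun n : ℕ => 1 ≤ n ∧ (n : ZMod N) = δ)
      (fun n => 1 / (n : ℂ) ^ z), ← PNat.coe_injective.tsum_eq]
    · refine tsum_congr fun n => ?_
      simp [Nat.one_le_iff_ne_zero]
    · intro n hn
      rw [Function.mem_support] at hn
      exact ⟨⟨n, by_contra fun h => hn (if_neg fun h' => h h'.1)⟩, rfl⟩
  have hprim : ∀ w : Lat N, primG k w τ s =
      ∑' u : {u : Fin 2 → ℤ // IsCoprime (u 0) (u 1)},
        if (fun i => (u.1 i : ZMod N)) = w.val then e u else 0 := by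
    intro w
    rw [primG, tsum_subtype_eq_ite, ← (Subtype.val_injective
      (p := fun u : Fin 2 → ℤ => IsCoprime (u 0) (u 1))).tsum_eq]
    · refine tsum_congr fun u => ?_
      simp only [u.2, and_true]
      rfl
    · intro u hu
      rw [Function.mem_support] at hu
      exact ⟨⟨u, by_contra fun h => hu (if_neg fun h' => h h'.2)⟩, rfl⟩
  have hsn : ∀ δ : (ZMod N)ˣ, Summable fun n : ℕ+ =>
      ‖if ((n : ℕ) : ZMod N) = δ then 1 / ((n : ℕ) : ℂ) ^ z else 0‖ := fun δ =>
    hsumn.norm.of_nonneg_of_le (fun _ => norm_nonneg _) fun n => by split_ifs <;> simp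
  have hsu : ∀ w : Lat N, Summable fun u : {u : Fin 2 → ℤ // IsCoprime (u 0) (u 1)} =>
      ‖if (fun i => (u.1 i : ZMod N)) = w.val then e u else 0‖ := fun w =>
    hsumu.norm.of_nonneg_of_le (fun _ => norm_nonneg _) fun n => by split_ifs <;> simp
  have hprod : ∀ δ : (ZMod N)ˣ, zetaPlus δ z * primG k (v.scale δ⁻¹) τ s =
      ∑' q : ℕ+ × {u : Fin 2 → ℤ // IsCoprime (u 0) (u 1)},
        (if ((q.1 : ℕ) : ZMod N) = δ then 1 / ((q.1 : ℕ) : ℂ) ^ z else 0) *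
        (if (fun i => (q.2.1 i : ZMod N)) = (v.scale δ⁻¹).val then e q.2 else 0) := by
    intro δ
    rw [hzeta, hprim, tsum_mul_tsum_of_summable_norm (hsn δ) (hsu _)]
  rw [Finset.sum_congr rfl fun δ _ => hprod δ, ← Summable.tsum_finsetSum fun δ _ =>
    (summable_mul_of_summable_norm (hsn δ) (hsu (v.scale δ⁻¹)))]
  rw [levelG, tsum_subtype_eq_ite, ← mulPrim_injective.tsum_eq]
  · refine tsum_congr fun q => ?_
    rw [sum_indicator_units v q.1.ne_zero q.2.2, mulPrim, eisTerm_nsmul k τ s q.1.pos]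
    have h1 : (fun i => ((((q.1 : ℕ) • q.2.1) i : ℤ) : ZMod N)) =
        (q.1 : ℕ) • fun i => (q.2.1 i : ZMod N) := by
      ext i
      simp
    rw [h1]
    simp only [show (q.1 : ℕ) • q.2.1 ≠ 0 from mulPrim_ne_zero q, ne_eq, not_false_eq_true,
      and_true]
    rfl
  · intro w hw
    rw [Function.mem_support] at hw
    exact exists_mulPrim_eq fun h => hw (if_neg fun h' => h'.2 h)

/-! ### Möbius inversion over the units -/

theorem Lat.scale_mul {N : ℕ} (δ ε : (ZMod N)ˣ) (v : Lat N) :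
    v.scale (δ * ε) = (v.scale ε).scale δ := Lat.ext (mul_smul δ ε v.val)

theorem Lat.scale_one {N : ℕ} (v : Lat N) : v.scale 1 = v := Lat.ext (one_smul _ v.val)

theorem primG_eq_sum_levelG {k N : ℕ} [NeZero N] (v : Lat N) (τ : ℍ) {s : ℂ}
    (hs : 2 < ((k : ℂ) + 2 * s).re) :
    primG k v τ s = ∑ δ : (ZMod N)ˣ, zetaPlusMu δ (k + 2 * s) * levelG k (v.scale δ⁻¹) τ s := by
  classical
  have h1 : ∀ δ : (ZMod N)ˣ, zetaPlusMu δ (k + 2 * s) * levelG k (v.scale δ⁻¹) τ s =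
      ∑ η : (ZMod N)ˣ, zetaPlusMu δ (k + 2 * s) * zetaPlus (δ⁻¹ * η) (k + 2 * s) *
        primG k (v.scale η⁻¹) τ s := by
    intro δ
    -- The index is shifted by δ⁻¹ so that the primitive sum depends on η alone; the sum over δ then
    -- collapses to η = 1.
    rw [levelG_eq_sum_primG _ τ hs, Finset.mul_sum, ← Equiv.sum_comp (Equiv.mulLeft δ⁻¹)]
    refine Finset.sum_congr rfl fun η _ => ?_
    rw [Equiv.coe_mulLeft, ← Lat.scale_mul, _root_.mul_inv_rev, inv_inv, mul_inv_cancel_right,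
      mul_assoc]
  rw [Finset.sum_congr rfl fun δ _ => h1 δ, Finset.sum_comm]
  simp_rw [← Finset.sum_mul, sum_zetaPlusMu_mul_zetaPlus _ (show 1 < ((k : ℂ) + 2 * s).re by
    linarith)]
  simp [Lat.scale_one]

end

/-! ### Orbits in `Λ_N` -/

theorem Lat.act_one {N : ℕ} (v : Lat N) : v.act 1 = v := Lat.act_of_mem v (one_mem _)

theorem Lat.neg_neg {N : ℕ} (v : Lat N) : - -v = v :=
  Lat.ext (by rw [Lat.neg_val, Lat.neg_val, _root_.neg_neg])

theorem Lat.act_inv_act {N : ℕ} (v : Lat N) (γ : SL(2, ℤ)) : (v.act γ).act γ⁻¹ = v := by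
  rw [← Lat.act_mul, mul_inv_cancel, Lat.act_one]

/-- The equation -v = v means that the order N of v divides 2. This is the source of the factor ε_N.
-/
theorem Lat.neg_eq_self_iff {N : ℕ} [NeZero N] (v : Lat N) : -v = v ↔ N ≤ 2 := by
  have h1 : -v = v ↔ 2 • v.val = 0 := by
    rw [two_nsmul, Lat.ext_iff, Lat.neg_val, neg_eq_iff_add_eq_zero]
  rw [h1, ← addOrderOf_dvd_iff_nsmul_eq_zero, v.order_eq]
  have := NeZero.pos N
  constructor
  · exact Nat.le_of_dvd two_pos
  · intro h
    interval_cases N <;> decide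

theorem mem_latOrbit_self {N : ℕ} (𝒢 : Subgroup SL(2, ℤ)) (v : Lat N) : v ∈ latOrbit 𝒢 v :=
  ⟨1, one_mem _, (Lat.act_one v).symm⟩

theorem latOrbit_eq_of_mem {N : ℕ} {𝒢 : Subgroup SL(2, ℤ)} {v w : Lat N}
    (hw : w ∈ latOrbit 𝒢 v) : latOrbit 𝒢 w = latOrbit 𝒢 v := by
  obtain ⟨γ, hγ, rfl⟩ := hw
  ext u
  constructor
  · rintro ⟨γ', hγ', rfl⟩
    exact ⟨γ * γ', mul_mem hγ hγ', (Lat.act_mul _ _ _).symm⟩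
  · rintro ⟨γ', hγ', rfl⟩
    exact ⟨γ⁻¹ * γ', mul_mem (inv_mem hγ) hγ', by rw [← Lat.act_mul, mul_inv_cancel_left]⟩

theorem image_scale_latOrbit {N : ℕ} (𝒢 : Subgroup SL(2, ℤ)) (δ : (ZMod N)ˣ) (v : Lat N) :
    Lat.scale δ '' latOrbit 𝒢 v = latOrbit 𝒢 (v.scale δ) := by
  ext u
  constructor
  · rintro ⟨_, ⟨γ, hγ, rfl⟩, rfl⟩
    exact ⟨γ, hγ, Lat.scale_act δ v γ⟩
  · rintro ⟨γ, hγ, rfl⟩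
    exact ⟨_, ⟨γ, hγ, rfl⟩, Lat.scale_act δ v γ⟩

theorem isRegularOrbit_iff {N : ℕ} {𝒢 : Subgroup SL(2, ℤ)} {v : Lat N} :
    IsRegularOrbit (latOrbit 𝒢 v) ↔ ∀ γ ∈ 𝒢, v.act γ ≠ -v := by
  constructor
  · intro h γ hγ e
    exact h v (mem_latOrbit_self 𝒢 v) ⟨γ, hγ, e.symm⟩
  · rintro h _ ⟨γ, hγ, rfl⟩ ⟨γ', hγ', e⟩
    refine h (γ' * γ⁻¹) (mul_mem hγ' (inv_mem hγ)) ?_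
    rw [Lat.act_mul, ← e, Lat.neg_act, Lat.act_inv_act]

/-! ### Representatives -/

theorem SignReps.lift_mem {N : ℕ} (A : SignReps N) (θ : LatPM N) : A.lift θ ∈ A.carrier :=
  (A.existsUnique θ).choose_spec.1.1

theorem SignReps.mk_lift {N : ℕ} (A : SignReps N) (θ : LatPM N) : LatPM.mk (A.lift θ) = θ :=
  (A.existsUnique θ).choose_spec.1.2

theorem SignReps.lift_mk {N : ℕ} (A : SignReps N) {v : Lat N} (hv : v ∈ A.carrier) :
    A.lift (LatPM.mk v) = v :=
  (A.existsUnique (LatPM.mk v)).unique ⟨A.lift_mem _, A.mk_lift _⟩ ⟨hv, rfl⟩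

theorem SignReps.lift_injective {N : ℕ} (A : SignReps N) : Function.Injective A.lift := by
  intro θ θ' h
  rw [← A.mk_lift θ, ← A.mk_lift θ', h]

theorem SignReps.lift_mk_eq_or {N : ℕ} (A : SignReps N) (v : Lat N) :
    A.lift (LatPM.mk v) = v ∨ A.lift (LatPM.mk v) = -v :=
  LatPM.mk_eq_iff.mp (A.mk_lift (LatPM.mk v)).symm

theorem LatPM.mk_neg {N : ℕ} (v : Lat N) : LatPM.mk (-v) = LatPM.mk v :=
  (LatPM.mk_eq_iff.mpr (Or.inr rfl)).symm

theorem LatPM.act_mk {N : ℕ} (v : Lat N) (γ : SL(2, ℤ)) :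
    (LatPM.mk v).act γ = LatPM.mk (v.act γ) := rfl

theorem LatPM.scale_mk {N : ℕ} (δ : (ZMod N)ˣ) (v : Lat N) :
    (LatPM.mk v).scale δ = LatPM.mk (v.scale δ) := rfl

theorem LatPM.scale_inv_scale {N : ℕ} (δ : (ZMod N)ˣ) (θ : LatPM N) :
    (θ.scale δ).scale δ⁻¹ = θ := by
  induction θ using Quotient.inductionOn with
  | h v =>
    change LatPM.mk ((v.scale δ).scale δ⁻¹) = LatPM.mk v
    rw [← Lat.scale_mul, inv_mul_cancel, Lat.scale_one]

/-! ### Cusps of `𝒢` in terms of `Λ_N` -/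

theorem phi_mk (N : ℕ) (p : OnePoint ℚ) : phi N (Cusp.mk _ p) = phiPoint N p := rfl

theorem cuspMap_mk {N : ℕ} {𝒢 : Subgroup SL(2, ℤ)} (h : CongruenceSubgroup.Gamma N ≤ 𝒢)
    (p : OnePoint ℚ) : cuspMap h (Cusp.mk _ p) = Cusp.mk 𝒢 p := rfl

theorem Cusp.mk_surjective (𝒢 : Subgroup SL(2, ℤ)) : Function.Surjective (Cusp.mk 𝒢) :=
  Quotient.mk_surjective

theorem Cusp.mk_eq_iff {𝒢 : Subgroup SL(2, ℤ)} {p q : OnePoint ℚ} :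
    Cusp.mk 𝒢 p = Cusp.mk 𝒢 q ↔ ∃ γ ∈ 𝒢, γ • q = p := by
  constructor
  · intro e
    obtain ⟨⟨γ, hγ⟩, hq⟩ := Quotient.exact e
    exact ⟨γ, hγ, hq⟩
  · rintro ⟨γ, hγ, rfl⟩
    exact Cusp.mk_smul hγ q

/-- This dictionary replaces geometry by congruences: under φ_N the cusps of Γ(N) above σ∞ become
the sign classes of (0,1)σ⁻¹𝒢. -/
theorem cuspMap_eq_mk_iff {N : ℕ} {𝒢 : Subgroup SL(2, ℤ)} (h : CongruenceSubgroup.Gamma N ≤ 𝒢)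
    (y : Cusp (CongruenceSubgroup.Gamma N)) (σ : SL(2, ℤ)) :
    cuspMap h y = Cusp.mk 𝒢 (σ • (∞ : OnePoint ℚ)) ↔
      ∃ γ ∈ 𝒢, phi N y = LatPM.mk ((Lat.base N).act (σ⁻¹ * γ)) := by
  obtain ⟨p, rfl⟩ := Cusp.mk_surjective _ y
  rw [cuspMap_mk, Cusp.mk_eq_iff, phi_mk]
  constructor
  · rintro ⟨γ, hγ, rfl⟩
    refine ⟨γ⁻¹, inv_mem hγ, ?_⟩
    rw [phiPoint_smul, phiPoint_smul_infty, LatPM.act_mk, ← Lat.act_mul]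
  · rintro ⟨γ, hγ, e⟩
    have e' : phi N (Cusp.mk _ p) = phi N (Cusp.mk _ (γ⁻¹ • σ • (∞ : OnePoint ℚ))) := by
      rw [phi_mk, phi_mk, e, phiPoint_smul, phiPoint_smul_infty, LatPM.act_mk, inv_inv,
        ← Lat.act_mul]
    obtain ⟨γ', hγ', e2⟩ := Cusp.mk_eq_iff.mp (phi_injective N e')
    exact ⟨γ' * γ⁻¹, mul_mem (h hγ') (inv_mem hγ), by rw [mul_smul]; exact e2⟩

/-- Scalar multiplication on the cusps of `Γ(N)`. -/
noncomputable def scaleCusp {N : ℕ} [NeZero N] (δ : (ZMod N)ˣ)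
    (y : Cusp (CongruenceSubgroup.Gamma N)) : Cusp (CongruenceSubgroup.Gamma N) :=
  (phiEquiv N).symm ((phi N y).scale δ)

theorem phi_scaleCusp {N : ℕ} [NeZero N] (δ : (ZMod N)ˣ)
    (y : Cusp (CongruenceSubgroup.Gamma N)) : phi N (scaleCusp δ y) = (phi N y).scale δ :=
  (phiEquiv N).apply_symm_apply _

theorem scaleCusp_inv_scaleCusp {N : ℕ} [NeZero N] (δ : (ZMod N)ˣ)
    (y : Cusp (CongruenceSubgroup.Gamma N)) : scaleCusp δ⁻¹ (scaleCusp δ y) = y :=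
  phi_injective N (by rw [phi_scaleCusp, phi_scaleCusp, LatPM.scale_inv_scale])

theorem cuspMap_scaleCusp {N : ℕ} [NeZero N] {𝒢 : Subgroup SL(2, ℤ)}
    (h : CongruenceSubgroup.Gamma N ≤ 𝒢) (δ : (ZMod N)ˣ)
    (y : Cusp (CongruenceSubgroup.Gamma N)) :
    cuspMap h (scaleCusp δ y) = unitAct h δ (cuspMap h y) := by
  obtain ⟨p, rfl⟩ := Cusp.mk_surjective _ y
  rfl

theorem bijOn_scaleCusp {N : ℕ} [NeZero N] {𝒢 : Subgroup SL(2, ℤ)}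
    (h : CongruenceSubgroup.Gamma N ≤ 𝒢) (δ : (ZMod N)ˣ) (x : Cusp 𝒢) :
    Set.BijOn (scaleCusp δ) (cuspOrbit h x) (cuspOrbit h (unitAct h δ x)) := by
  refine ⟨?_, ?_, ?_⟩
  · intro y (hy : cuspMap h y = x)
    change cuspMap h _ = _
    rw [cuspMap_scaleCusp, hy]
  · intro y _ y' _ e
    rw [← scaleCusp_inv_scaleCusp δ y, ← scaleCusp_inv_scaleCusp δ y', e]
  · intro y (hy : cuspMap h y = unitAct h δ x)
    have e : scaleCusp δ (scaleCusp δ⁻¹ y) = y := by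
      simpa using scaleCusp_inv_scaleCusp δ⁻¹ y
    refine ⟨scaleCusp δ⁻¹ y, ?_, e⟩
    change cuspMap h _ = _
    obtain ⟨p, rfl⟩ := Cusp.mk_surjective _ x
    rw [cuspMap_scaleCusp, hy, ← cuspMap_mk h, ← cuspMap_scaleCusp, ← cuspMap_scaleCusp,
      scaleCusp_inv_scaleCusp]

/-! ### Regular cusps and regular orbits -/

theorem upperRightHom_eq_toGL (b : ℤ) :
    GeneralLinearGroup.upperRightHom b = SpecialLinearGroup.toGL (ModularGroup.T ^ b) := by
  apply Units.ext
  change _ = ((ModularGroup.T ^ b : SL(2, ℤ)) : Matrix (Fin 2) (Fin 2) ℤ)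
  rw [ModularGroup.coe_T_zpow]
  rfl

theorem toGL_mem_map_conj_iff {𝒢 : Subgroup SL(2, ℤ)} {σ g : SL(2, ℤ)} :
    SpecialLinearGroup.toGL g ∈ (𝒢.map (MulAut.conj σ⁻¹).toMonoidHom).map
      (SpecialLinearGroup.toGL : SL(2, ℤ) →* GL (Fin 2) ℤ) ↔ σ * g * σ⁻¹ ∈ 𝒢 := by
  rw [Subgroup.mem_map_iff_mem SpecialLinearGroup.toGL_injective, Subgroup.mem_map]
  constructor
  · rintro ⟨γ, hγ, rfl⟩
    simpa [mul_assoc] using hγ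
  · intro hg
    exact ⟨_, hg, by simp [mul_assoc]⟩

theorem isRegularCusp_iff {𝒢 : Subgroup SL(2, ℤ)} {x : Cusp 𝒢} :
    IsRegularCusp x ↔ ∀ σ : SL(2, ℤ), Cusp.mk 𝒢 (σ • (∞ : OnePoint ℚ)) = x → ∀ b : ℤ,
      σ * -(ModularGroup.T ^ b) * σ⁻¹ ∈ 𝒢 → σ * ModularGroup.T ^ b * σ⁻¹ ∈ 𝒢 := by
  refine forall_congr' fun σ => forall_congr' fun _ => ?_
  have hneg : ∀ b : ℤ, -GeneralLinearGroup.upperRightHom b =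
      SpecialLinearGroup.toGL (-(ModularGroup.T ^ b)) := by
    intro b
    rw [upperRightHom_eq_toGL]
    apply Units.ext
    rw [Units.val_neg, SpecialLinearGroup.coe_GL_coe_matrix, SpecialLinearGroup.coe_GL_coe_matrix,
      SpecialLinearGroup.coe_neg]
  rw [Subgroup.IsRegularAtInfty, SetLike.ext_iff]
  simp only [Subgroup.periods, Subgroup.mem_strictPeriods_iff, Subgroup.mem_adjoinNegOne_iff, hneg]
  simp only [upperRightHom_eq_toGL, toGL_mem_map_conj_iff]
  exact forall_congr' fun b => ⟨fun h h' => h.mpr (Or.inr h'), fun h =>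
    ⟨Or.inl, fun h' => h'.elim id h⟩⟩

/-- An element whose bottom row is `(0, 1)` modulo `N` is a power of `T` modulo `Γ(N)`. -/
theorem mul_T_zpow_mem_Gamma {N : ℕ} {m : SL(2, ℤ)} (e : (Lat.base N).act m = Lat.base N) :
    m * ModularGroup.T ^ (-m 0 1) ∈ CongruenceSubgroup.Gamma N := by
  have e2 := congrArg Lat.val e
  rw [base_act_val] at e2
  have hm10 : ((m 1 0 : ℤ) : ZMod N) = 0 := by
    simpa [Lat.base, Lat.ofPrim] using congrFun e2 0
  have hm11 : ((m 1 1 : ℤ) : ZMod N) = 1 := by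
    simpa [Lat.base, Lat.ofPrim] using congrFun e2 1
  have hm00 : ((m 0 0 : ℤ) : ZMod N) = 1 := by
    have hdet := m.det_coe
    rw [Matrix.det_fin_two] at hdet
    have := congrArg (Int.cast : ℤ → ZMod N) hdet
    push_cast at this
    rw [hm10, hm11] at this
    simpa using this
  rw [CongruenceSubgroup.Gamma_mem]
  simp only [Matrix.SpecialLinearGroup.coe_mul, ModularGroup.coe_T_zpow, Matrix.mul_apply,
    Fin.sum_univ_two]
  simp [hm10, hm11, hm00]

theorem Lat.act_neg {N : ℕ} (v : Lat N) (γ : SL(2, ℤ)) : v.act (-γ) = -(v.act γ) := by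
  apply Lat.ext
  rw [Lat.neg_val, Lat.act_val, Lat.act_val, ← Matrix.vecMul_neg]
  congr 1
  ext i j
  simp [redN]

/-- If γ ∈ 𝒢 negates (0,1)σ⁻¹, then -(σ⁻¹γσ) fixes (0,1) modulo N, hence is some Tᵇ modulo Γ(N). So
σ(-Tᵇ)σ⁻¹ lies in 𝒢, regularity puts σTᵇσ⁻¹ in 𝒢 as well, and their quotient is -1. -/
theorem isRegularOrbit_of_isRegularCusp {N : ℕ} {𝒢 : Subgroup SL(2, ℤ)}
    (h : CongruenceSubgroup.Gamma N ≤ 𝒢) (h1 : -1 ∉ 𝒢) {σ : SL(2, ℤ)}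
    (hx : IsRegularCusp (Cusp.mk 𝒢 (σ • (∞ : OnePoint ℚ)))) :
    IsRegularOrbit (latOrbit 𝒢 ((Lat.base N).act σ⁻¹)) := by
  rw [isRegularOrbit_iff]
  intro γ hγ e
  have e1 : (Lat.base N).act (-(σ⁻¹ * γ * σ)) = Lat.base N := by
    rw [Lat.act_neg, Lat.act_mul, Lat.act_mul, e, Lat.neg_act, ← Lat.act_mul, inv_mul_cancel,
      Lat.act_one, Lat.neg_neg]
  have e2 := mul_T_zpow_mem_Gamma e1
  set b := (-(σ⁻¹ * γ * σ)) 0 1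
  have e3 := h ((CongruenceSubgroup.Gamma_normal N).conj_mem _ e2 σ)
  have e4 : σ * -(ModularGroup.T ^ b) * σ⁻¹ ∈ 𝒢 := by
    have e' : σ * -(ModularGroup.T ^ b) * σ⁻¹ =
        (σ * (-(σ⁻¹ * γ * σ) * ModularGroup.T ^ (-b)) * σ⁻¹)⁻¹ * γ := by
      refine eq_inv_mul_of_mul_eq ?_
      simp [mul_assoc]
    rw [e']
    exact mul_mem (inv_mem e3) hγ
  have e5 := isRegularCusp_iff.mp hx σ rfl b e4
  have e6 := mul_mem e4 (inv_mem e5)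
  refine h1 ?_
  convert e6 using 1
  simp [mul_assoc]

/-- Since (0,1)(-Tᵇ) = -(0,1), an element σ(-Tᵇ)σ⁻¹ of 𝒢 would negate (0,1)σ⁻¹, so regularity of the
cusp holds vacuously. -/
theorem isRegularCusp_of_isRegularOrbit {N : ℕ} {𝒢 : Subgroup SL(2, ℤ)} {x : Cusp 𝒢}
    (hx : ∀ σ : SL(2, ℤ), Cusp.mk 𝒢 (σ • (∞ : OnePoint ℚ)) = x →
      IsRegularOrbit (latOrbit 𝒢 ((Lat.base N).act σ⁻¹))) : IsRegularCusp x := by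
  rw [isRegularCusp_iff]
  intro σ hσ b hb
  exfalso
  refine isRegularOrbit_iff.mp (hx σ hσ) _ hb ?_
  have hT : (Lat.base N).act (ModularGroup.T ^ b) = Lat.base N := by
    apply Lat.ext
    rw [base_act_val]
    ext i
    fin_cases i <;> simp [Lat.base, Lat.ofPrim, ModularGroup.coe_T_zpow]
  rw [← Lat.act_mul, mul_assoc, inv_mul_cancel_left, Lat.act_mul, Lat.act_neg, hT, Lat.neg_act]

/-- Regularity is transported through orbits: scaling commutes with 𝒢 and with negation, so it
preserves regular orbits. For odd k this keeps every cusp δ⁻¹x within the scope of the lemmas. -/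
theorem isRegularCusp_unitAct {N : ℕ} [NeZero N] {𝒢 : Subgroup SL(2, ℤ)}
    (h : CongruenceSubgroup.Gamma N ≤ 𝒢) (h1 : -1 ∉ 𝒢) {x : Cusp 𝒢} (hx : IsRegularCusp x)
    (δ : (ZMod N)ˣ) : IsRegularCusp (unitAct h δ x) := by
  obtain ⟨p, rfl⟩ := Cusp.mk_surjective _ x
  obtain ⟨σ, rfl⟩ := exists_smul_infty p
  have hreg := isRegularOrbit_iff.mp (isRegularOrbit_of_isRegularCusp h h1 hx)
  refine isRegularCusp_of_isRegularOrbit (N := N) fun σ' hσ' => ?_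
  rw [← cuspMap_mk h (σ • _), ← cuspMap_scaleCusp] at hσ'
  obtain ⟨γ, hγ, e⟩ := (cuspMap_eq_mk_iff h _ _).mp hσ'.symm
  rw [phi_scaleCusp, phi_mk, phiPoint_smul_infty, LatPM.scale_mk, LatPM.mk_eq_iff] at e
  rw [isRegularOrbit_iff]
  intro γ' hγ' e'
  refine hreg (γ⁻¹ * γ' * γ) (mul_mem (mul_mem (inv_mem hγ) hγ') hγ) ?_
  have key : (((Lat.base N).act (σ'⁻¹ * γ)).act (γ⁻¹ * γ' * γ)) =
      -((Lat.base N).act (σ'⁻¹ * γ)) := by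
    rw [← Lat.act_mul, show σ'⁻¹ * γ * (γ⁻¹ * γ' * γ) = σ'⁻¹ * γ' * γ by group, Lat.act_mul,
      Lat.act_mul, e', Lat.neg_act, Lat.act_mul]
  have hinj : Function.Injective (Lat.scale (N := N) δ) := fun v w hvw => by
    rw [← Lat.scale_one v, ← Lat.scale_one w, ← inv_mul_cancel δ, Lat.scale_mul, Lat.scale_mul, hvw]
  apply hinj
  rw [Lat.scale_act, Lat.scale_neg]
  rcases e with e | e
  · rw [← e, key]
  · rw [e, Lat.neg_act, Lat.neg_neg] at key
    conv_rhs => rw [← key, Lat.neg_neg]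

/-! ### Sums over the cusps above a cusp -/

theorem mem_cuspOrbit_iff {N : ℕ} {𝒢 : Subgroup SL(2, ℤ)}
    (h : CongruenceSubgroup.Gamma N ≤ 𝒢) (σ : ScalingChoice 𝒢) (x : Cusp 𝒢)
    (y : Cusp (CongruenceSubgroup.Gamma N)) :
    y ∈ cuspOrbit h x ↔
      ∃ γ ∈ 𝒢, phi N y = LatPM.mk ((Lat.base N).act ((σ.mat x)⁻¹ * γ)) := by
  rw [← cuspMap_eq_mk_iff h, σ.mk_mat]
  rfl

theorem orbitOfCusp_eq {N : ℕ} {𝒢 : Subgroup SL(2, ℤ)} {A : SignReps N} {σ : ScalingChoice 𝒢}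
    (hcomp : σ.IsCompatible A) {x : Cusp 𝒢} (hx : IsRegularCusp x) :
    orbitOfCusp A σ x = latOrbit 𝒢 ((Lat.base N).act (σ.mat x)⁻¹) := by
  rw [orbitOfCusp, hcomp x hx]

theorem isRegularOrbit_orbitOfCusp {N : ℕ} {𝒢 : Subgroup SL(2, ℤ)}
    (h : CongruenceSubgroup.Gamma N ≤ 𝒢) {A : SignReps N} {σ : ScalingChoice 𝒢} (h1 : -1 ∉ 𝒢)
    (hcomp : σ.IsCompatible A) {x : Cusp 𝒢}
    (hx : IsRegularCusp x) : IsRegularOrbit (orbitOfCusp A σ x) := by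
  rw [orbitOfCusp_eq hcomp hx]
  exact isRegularOrbit_of_isRegularCusp h h1 (by rwa [σ.mk_mat])

theorem orbitOfCusp_subset {N : ℕ} {𝒢 : Subgroup SL(2, ℤ)}
    (h : CongruenceSubgroup.Gamma N ≤ 𝒢) {A : SignReps N} {σ : ScalingChoice 𝒢} (h1 : -1 ∉ 𝒢)
    (hadm : A.IsAdmissible 𝒢) (hcomp : σ.IsCompatible A)
    {x : Cusp 𝒢} (hx : IsRegularCusp x) : orbitOfCusp A σ x ⊆ A.carrier :=
  hadm _ (isRegularOrbit_orbitOfCusp h h1 hcomp hx) ⟨_, mem_latOrbit_self 𝒢 _, A.lift_mem _⟩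

/-- By admissibility the whole orbit 𝒪_x lies in 𝒜, so the representatives of the cusps above x
carry a coherent sign: all of them lie in 𝒪_x rather than in -𝒪_x. -/
theorem lift_phi_mem_orbitOfCusp {N : ℕ} {𝒢 : Subgroup SL(2, ℤ)}
    (h : CongruenceSubgroup.Gamma N ≤ 𝒢) {A : SignReps N} {σ : ScalingChoice 𝒢} (h1 : -1 ∉ 𝒢)
    (hadm : A.IsAdmissible 𝒢)
    (hcomp : σ.IsCompatible A) {x : Cusp 𝒢} (hx : IsRegularCusp x)
    {y : Cusp (CongruenceSubgroup.Gamma N)} (hy : y ∈ cuspOrbit h x) :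
    A.lift (phi N y) ∈ orbitOfCusp A σ x := by
  obtain ⟨γ, hγ, e⟩ := (mem_cuspOrbit_iff h σ x y).mp hy
  have hmem : (Lat.base N).act ((σ.mat x)⁻¹ * γ) ∈ orbitOfCusp A σ x := by
    rw [orbitOfCusp_eq hcomp hx]
    exact ⟨γ, hγ, Lat.act_mul _ _ _⟩
  rw [e, A.lift_mk (orbitOfCusp_subset h h1 hadm hcomp hx hmem)]
  exact hmem

/-- Scaling the argument of a function of parity `k` permutes the sums over the cusps above a
cusp, up to sign. -/
theorem finsum_scale {k N : ℕ} [NeZero N] {𝒢 : Subgroup SL(2, ℤ)}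
    (h : CongruenceSubgroup.Gamma N ≤ 𝒢) {A : SignReps N} {σ : ScalingChoice 𝒢}
    (hodd : Odd k → -1 ∉ 𝒢 ∧ A.IsAdmissible 𝒢 ∧ σ.IsCompatible A)
    {x : Cusp 𝒢} (hx : Odd k → IsRegularCusp x) {g : Lat N → ℂ}
    (hg : ∀ v, g (-v) = (-1) ^ k * g v) (δ : (ZMod N)ˣ) :
    ∑ᶠ y ∈ cuspOrbit h x, g ((A.lift (phi N y)).scale δ⁻¹) =
      cuspSign h A σ x δ ^ k * ∑ᶠ y ∈ cuspOrbit h (unitAct h δ⁻¹ x), g (A.lift (phi N y)) := by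
  rw [mul_finsum_mem]
  refine finsum_mem_eq_of_bijOn (scaleCusp δ⁻¹) (bijOn_scaleCusp h δ⁻¹ x) fun y hy => ?_
  have hor : A.lift (phi N (scaleCusp δ⁻¹ y)) = (A.lift (phi N y)).scale δ⁻¹ ∨
      A.lift (phi N (scaleCusp δ⁻¹ y)) = -(A.lift (phi N y)).scale δ⁻¹ := by
    have e : phi N (scaleCusp δ⁻¹ y) = LatPM.mk ((A.lift (phi N y)).scale δ⁻¹) := by
      rw [phi_scaleCusp, ← LatPM.scale_mk, A.mk_lift]
    rw [e]
    exact A.lift_mk_eq_or _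
  rcases Nat.even_or_odd k with hk | hk
  · have hs : cuspSign h A σ x δ ^ k = 1 := by
      rw [cuspSign]
      split_ifs
      · exact one_pow _
      · exact hk.neg_one_pow
    rw [hs, one_mul]
    rcases hor with e | e
    · rw [e]
    · rw [e, hg, hk.neg_one_pow, one_mul]
  · obtain ⟨h1, hadm, hcomp⟩ := hodd hk
    have hx := hx hk
    have hx' := isRegularCusp_unitAct h h1 hx δ⁻¹
    have hm := lift_phi_mem_orbitOfCusp h h1 hadm hcomp hx hy
    have hm' := lift_phi_mem_orbitOfCusp h h1 hadm hcomp hx' ((bijOn_scaleCusp h δ⁻¹ x).1 hy)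
    rw [cuspSign]
    split_ifs with hO
    · have hm2 : (A.lift (phi N y)).scale δ⁻¹ ∈ orbitOfCusp A σ (unitAct h δ⁻¹ x) :=
        hO ▸ ⟨_, hm, rfl⟩
      rcases hor with e | e
      · rw [e, one_pow, one_mul]
      · rw [e] at hm'
        -- A minus sign would place both a vector and its negative in one regular orbit.
        exact absurd hm' (isRegularOrbit_orbitOfCusp h h1 hcomp hx' _ hm2)
    · rcases hor with e | e
      · refine absurd ?_ hO
        have e1 : orbitOfCusp A σ x = latOrbit 𝒢 (A.lift (phi N y)) := (latOrbit_eq_of_mem hm).symm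
        have e2 : orbitOfCusp A σ (unitAct h δ⁻¹ x) =
          latOrbit 𝒢 (A.lift (phi N (scaleCusp δ⁻¹ y))) := (latOrbit_eq_of_mem hm').symm
        rw [e1, e2, image_scale_latOrbit, e]
      · rw [e, hg, ← mul_assoc, ← mul_pow, neg_one_mul, _root_.neg_neg, one_pow, one_mul]

/-! ### The spectral series as a sum over primitive vectors -/

/-- The bottom row of a matrix. -/
def botRow (m : SL(2, ℤ)) : Fin 2 → ℤ := fun i => m 1 i

theorem isCoprime_botRow (m : SL(2, ℤ)) : IsCoprime (botRow m 0) (botRow m 1) :=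
  m.isCoprime_row 1

theorem botRow_neg (m : SL(2, ℤ)) : botRow (-m) = -botRow m := by
  ext i
  simp [botRow]

theorem base_act_val' (N : ℕ) (m : SL(2, ℤ)) :
    (fun i => ((botRow m i : ℤ) : ZMod N)) = ((Lat.base N).act m).val :=
  (base_act_val N m).symm

theorem botRow_eq_or (m : SL(2, ℤ)) :
    botRow m = primVec (m⁻¹ • (∞ : OnePoint ℚ)) ∨
      botRow m = -primVec (m⁻¹ • (∞ : OnePoint ℚ)) := by
  have h0 : (m⁻¹ : SL(2, ℤ)) 1 0 = -m 1 0 := by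
    rw [Matrix.SpecialLinearGroup.coe_inv, Matrix.adjugate_fin_two]; simp
  have h1 : (m⁻¹ : SL(2, ℤ)) 0 0 = m 1 1 := by
    rw [Matrix.SpecialLinearGroup.coe_inv, Matrix.adjugate_fin_two]; simp
  have e := primVec_smul_infty m⁻¹
  rw [h0, h1, _root_.neg_neg] at e
  rcases coprime_unique (isCoprime_primVec _) (isCoprime_botRow m) e with ⟨e0, e1⟩ | ⟨e0, e1⟩
  · left
    ext i
    fin_cases i
    · exact e0
    · exact e1
  · right
    ext i
    fin_cases i
    · exact e0
    · exact e1

/-- Two matrices have the same bottom row up to sign if and only if their inverses agree at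
`∞`. -/
theorem botRow_eq_or_neg_iff (m m' : SL(2, ℤ)) :
    (botRow m' = botRow m ∨ botRow m' = -botRow m) ↔
      m⁻¹ • (∞ : OnePoint ℚ) = m'⁻¹ • (∞ : OnePoint ℚ) := by
  constructor
  · intro e
    have h10 : (m' * m⁻¹) 1 0 = 0 := by
      have e' : m' 1 0 * m 1 1 = m' 1 1 * m 1 0 := by
        rcases e with e | e
        · have e0 : m' 1 0 = m 1 0 := congrFun e 0
          have e1 : m' 1 1 = m 1 1 := congrFun e 1
          rw [e0, e1]; ring
        · have e0 : m' 1 0 = -m 1 0 := congrFun e 0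
          have e1 : m' 1 1 = -m 1 1 := congrFun e 1
          rw [e0, e1]; ring
      rw [Matrix.SpecialLinearGroup.coe_mul, Matrix.SpecialLinearGroup.coe_inv,
        Matrix.adjugate_fin_two, Matrix.mul_apply, Fin.sum_univ_two]
      simp
      linarith
    have hfix : (m' * m⁻¹) • (∞ : OnePoint ℚ) = ∞ := by
      rw [smul_point_def, OnePoint.smul_infty_eq_self_iff,
        Matrix.SpecialLinearGroup.mapGL_coe_matrix, Matrix.SpecialLinearGroup.map_apply_coe,
        RingHom.mapMatrix_apply, Matrix.map_apply, h10, map_zero]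
    rw [mul_smul] at hfix
    rw [eq_inv_smul_iff]
    exact hfix
  · intro e
    rcases botRow_eq_or m with h1 | h1 <;> rcases botRow_eq_or m' with h2 | h2 <;>
      rw [h1, h2, e] <;> simp

theorem botRow_ne_zero (m : SL(2, ℤ)) : botRow m ≠ 0 :=
  ne_zero_of_isCoprime_vec (isCoprime_botRow m)

/-- From Im(mτ)|j(m,τ)|² = Im τ, so each spectral term depends only on the bottom row of m. -/
theorem seriesE_term (k : ℕ) (m : SL(2, ℤ)) (τ : ℍ) (s : ℂ) :
    (autFactor m τ ^ k)⁻¹ * ((m • τ).im : ℂ) ^ s = eisTerm k τ s (botRow m) := by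
  have hj : autFactor m τ = (botRow m 0 : ℂ) * τ + botRow m 1 := rfl
  have hne := lin_ne_zero τ (botRow_ne_zero m)
  rw [← hj] at hne
  set r : ℝ := ‖autFactor m τ‖ with hr
  have hr0 : 0 < r := norm_pos_iff.mpr hne
  have hrC : (r : ℂ) ≠ 0 := by exact_mod_cast hr0.ne'
  have him : (m • τ).im * (r * r) = τ.im := by
    have hd : denom (m : GL (Fin 2) ℝ) τ = autFactor m τ := by
      simp [denom, autFactor]
    rw [ModularGroup.im_smul_eq_div_normSq, hd, Complex.normSq_eq_norm_sq, ← hr]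
    field_simp
  have hpow : ((τ.im : ℝ) : ℂ) ^ s = ((m • τ).im : ℂ) ^ s * (r : ℂ) ^ (2 * s) := by
    rw [← him, Complex.ofReal_mul, Complex.mul_cpow_ofReal_nonneg (m • τ).im_pos.le (by positivity),
      Complex.ofReal_mul, Complex.mul_cpow_ofReal_nonneg hr0.le hr0.le, two_mul,
      Complex.cpow_add _ _ hrC]
  have hc0 : (r : ℂ) ^ (2 * s) ≠ 0 := by simp [Complex.cpow_eq_zero_iff, hrC]
  rw [eisTerm, ← hj, ← hr, hpow]
  field_simp

/-! ### Cosets and primitive vectors up to sign -/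

/-- The cosets indexing the spectral series. -/
abbrev CosetIndex (𝒢 : Subgroup SL(2, ℤ)) (σ : SL(2, ℤ)) : Type :=
  Quotient (QuotientGroup.rightRel (MulAction.stabilizer 𝒢 (σ • (∞ : OnePoint ℚ))))

/-- The primitive vector attached to a coset and a sign. -/
noncomputable def signedRow {𝒢 : Subgroup SL(2, ℤ)} (σ : SL(2, ℤ)) (q : CosetIndex 𝒢 σ × Bool)
    : Fin 2 → ℤ :=
  if q.2 then botRow (σ⁻¹ * (q.1.out : SL(2, ℤ))) else -botRow (σ⁻¹ * (q.1.out : SL(2, ℤ)))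

/-- Up to sign the row determines γ⁻¹σ∞, where γ represents the coset, and this point determines the
coset of the stabilizer. The sign is then determined because the row is nonzero. -/
theorem signedRow_injective (𝒢 : Subgroup SL(2, ℤ)) (σ : SL(2, ℤ)) :
    Function.Injective (signedRow (𝒢 := 𝒢) σ) := by
  rintro ⟨q, ε⟩ ⟨q', ε'⟩ e
  have hq : q = q' := by
    have e1 : botRow (σ⁻¹ * (q'.out : SL(2, ℤ))) = botRow (σ⁻¹ * (q.out : SL(2, ℤ))) ∨
        botRow (σ⁻¹ * (q'.out : SL(2, ℤ))) = -botRow (σ⁻¹ * (q.out : SL(2, ℤ))) := by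
      cases ε <;> cases ε' <;> simp [signedRow] at e <;> simp [e]
    have e2 := (botRow_eq_or_neg_iff _ _).mp e1
    rw [_root_.mul_inv_rev, _root_.mul_inv_rev, inv_inv, mul_smul, mul_smul] at e2
    rw [← q.out_eq, ← q'.out_eq]
    refine Quotient.sound ?_
    change QuotientGroup.rightRel _ q.out q'.out
    rw [QuotientGroup.rightRel_apply, MulAction.mem_stabilizer_iff, mul_smul]
    change (q'.out : SL(2, ℤ)) • ((q.out : SL(2, ℤ))⁻¹ • σ • (∞ : OnePoint ℚ)) = _
    rw [e2, smul_inv_smul]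
  subst hq
  have hne := botRow_ne_zero (σ⁻¹ * (q.out : SL(2, ℤ)))
  have hne' := self_ne_neg.mpr hne
  cases ε <;> cases ε' <;> simp [signedRow, hne', hne'.symm] at e ⊢

/-- Every primitive vector in the classes of `± (0, 1) σ⁻¹ 𝒢` comes from a coset. -/
theorem exists_signedRow_eq {N : ℕ} {𝒢 : Subgroup SL(2, ℤ)}
    (h : CongruenceSubgroup.Gamma N ≤ 𝒢) (σ : SL(2, ℤ)) {w : Fin 2 → ℤ} (hw : IsCoprime (w 0) (w 1))
    {γ : SL(2, ℤ)}
    (hγ : γ ∈ 𝒢) (e : (fun i => (w i : ZMod N)) = ((Lat.base N).act (σ⁻¹ * γ)).val ∨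
      (fun i => (w i : ZMod N)) = (-(Lat.base N).act (σ⁻¹ * γ)).val) :
    ∃ q, signedRow (𝒢 := 𝒢) σ q = w := by
  obtain ⟨g, hg⟩ := hw.exists_SL2_row 1
  have hgw : botRow g = w := by
    ext i
    fin_cases i
    · exact hg.1
    · exact hg.2
  have e1 : LatPM.mk ((Lat.base N).act (σ⁻¹ * γ)) = LatPM.mk ((Lat.base N).act g) := by
    rw [LatPM.mk_eq_iff]
    rw [← hgw, base_act_val'] at e
    exact e.imp Lat.ext Lat.ext
  -- Completing w to a matrix g, the congruence says that g⁻¹∞ lies above the cusp of σ∞; an element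
  -- of 𝒢 moving σ∞ to g⁻¹∞ then yields the coset.
  have e2 : phi N (Cusp.mk _ (g⁻¹ • (∞ : OnePoint ℚ))) =
      LatPM.mk ((Lat.base N).act (σ⁻¹ * γ)) := by
    rw [phi_mk, phiPoint_smul_infty, inv_inv, e1]
  have e3 := (cuspMap_eq_mk_iff h _ σ).mpr ⟨γ, hγ, e2⟩
  rw [cuspMap_mk, Cusp.mk_eq_iff] at e3
  obtain ⟨γ', hγ', e4⟩ := e3
  set q : CosetIndex 𝒢 σ := Quotient.mk'' ⟨γ'⁻¹, inv_mem hγ'⟩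
  have hq : (q.out : SL(2, ℤ))⁻¹ • σ • (∞ : OnePoint ℚ) = γ' • σ • (∞ : OnePoint ℚ) := by
    have : QuotientGroup.rightRel (MulAction.stabilizer 𝒢 (σ • (∞ : OnePoint ℚ))) q.out
      ⟨γ'⁻¹, inv_mem hγ'⟩ := Quotient.exact q.out_eq
    rw [QuotientGroup.rightRel_apply, MulAction.mem_stabilizer_iff, mul_smul] at this
    change γ'⁻¹ • ((q.out : SL(2, ℤ))⁻¹ • σ • (∞ : OnePoint ℚ)) = _ at this
    exact inv_smul_eq_iff.mp this
  have e5 : (σ⁻¹ * (q.out : SL(2, ℤ)))⁻¹ • (∞ : OnePoint ℚ) = g⁻¹ • (∞ : OnePoint ℚ) := by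
    rw [_root_.mul_inv_rev, inv_inv, mul_smul, hq, e4]
  rcases (botRow_eq_or_neg_iff _ _).mpr e5 with e6 | e6
  · exact ⟨(q, true), by rw [← hgw, e6]; rfl⟩
  · exact ⟨(q, false), by rw [← hgw, e6]; rfl⟩

/-- The classes modulo `N` attached to the cusps of `Γ(N)` above a cusp. -/
def orbitClasses {N : ℕ} {𝒢 : Subgroup SL(2, ℤ)} (h : CongruenceSubgroup.Gamma N ≤ 𝒢)
    (A : SignReps N) (x : Cusp 𝒢) : Set (Lat N) :=
  (fun y => A.lift (phi N y)) '' cuspOrbit h x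

theorem orbitClasses_subset {N : ℕ} {𝒢 : Subgroup SL(2, ℤ)} (h : CongruenceSubgroup.Gamma N ≤ 𝒢)
    (A : SignReps N) (x : Cusp 𝒢) : orbitClasses h A x ⊆ A.carrier := by
  rintro _ ⟨y, -, rfl⟩
  exact A.lift_mem _

open Classical in
/-- The term of the Eisenstein series at a primitive vector in one of the given classes. -/
noncomputable def primTerm (k : ℕ) {N : ℕ} (L : Set (Lat N)) (τ : ℍ) (s : ℂ) (w : Fin 2 → ℤ) : ℂ :=
  if (∃ v ∈ L, (fun i => (w i : ZMod N)) = v.val) ∧ IsCoprime (w 0) (w 1) then eisTerm k τ s w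
  else 0

theorem summable_ite_isCoprime {k : ℕ} (τ : ℍ) {s : ℂ} (hs : 2 < ((k : ℂ) + 2 * s).re)
    (p : (Fin 2 → ℤ) → Prop) {_ : DecidablePred p} (hp : ∀ w, p w → IsCoprime (w 0) (w 1)) :
    Summable fun w => if p w then eisTerm k τ s w else 0 := by
  refine Summable.of_norm_bounded (summable_eisTerm τ hs).norm fun w => ?_
  by_cases hw : p w
  · rw [if_pos hw, if_neg (ne_zero_of_isCoprime_vec (hp w hw))]
  · rw [if_neg hw, norm_zero]; exact norm_nonneg _

theorem summable_primTerm {k N : ℕ} (L : Set (Lat N)) (τ : ℍ) {s : ℂ}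
    (hs : 2 < ((k : ℂ) + 2 * s).re) : Summable (primTerm k L τ s) := by
  classical
  exact summable_ite_isCoprime τ hs _ fun w hw => hw.2

/-- Distinct cusps y have distinct representatives in 𝒜, so their congruence classes are disjoint
and the finite sum of series merges into one series. -/
theorem finsum_primG_eq_tsum {k N : ℕ} [NeZero N] {𝒢 : Subgroup SL(2, ℤ)}
    (h : CongruenceSubgroup.Gamma N ≤ 𝒢) (A : SignReps N) (x : Cusp 𝒢) (τ : ℍ) {s : ℂ}
    (hs : 2 < ((k : ℂ) + 2 * s).re) :
    ∑ᶠ y ∈ cuspOrbit h x, primG k (A.lift (phi N y)) τ s =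
      ∑' w, primTerm k (orbitClasses h A x) τ s w := by
  classical
  have hinj : Function.Injective fun y => A.lift (phi N y) :=
    A.lift_injective.comp (phi_injective N)
  rw [finsum_mem_eq_finite_toFinset_sum _ (Set.toFinite (cuspOrbit h x))]
  simp_rw [primG, tsum_subtype_eq_ite]
  refine (Summable.tsum_finsetSum fun y _ =>
    summable_ite_isCoprime τ hs _ fun w hw => hw.2).symm.trans ?_
  refine tsum_congr fun w => ?_
  rw [primTerm]
  split_ifs with hw
  · obtain ⟨⟨_, ⟨y, hy, rfl⟩, hyw⟩, hcop⟩ := hw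
    rw [Finset.sum_eq_single y]
    · rw [if_pos ⟨hyw, hcop⟩]
    · intro y' _ hne
      rw [if_neg]
      rintro ⟨hyw', -⟩
      exact hne (hinj (Lat.ext (hyw'.symm.trans hyw)))
    · intro hy'
      exact absurd ((Set.Finite.mem_toFinset _).mpr hy) hy'
  · refine Finset.sum_eq_zero fun y hy => if_neg ?_
    rintro ⟨hyw, hcop⟩
    exact hw ⟨⟨_, ⟨y, (Set.Finite.mem_toFinset _).mp hy, rfl⟩, hyw⟩, hcop⟩

theorem support_primTerm_subset (k : ℕ) {N : ℕ} {𝒢 : Subgroup SL(2, ℤ)}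
    (h : CongruenceSubgroup.Gamma N ≤ 𝒢) (A : SignReps N) (σ : ScalingChoice 𝒢) (x : Cusp 𝒢)
    (τ : ℍ) (s : ℂ) :
    Function.support (primTerm k (orbitClasses h A x) τ s) ⊆
      Set.range (signedRow (𝒢 := 𝒢) (σ.mat x)) := by
  classical
  intro w hw
  rw [Function.mem_support, primTerm] at hw
  obtain ⟨⟨⟨_, ⟨y, hy, rfl⟩, hyw⟩, hcop⟩, -⟩ := ite_ne_right_iff.mp hw
  obtain ⟨γ, hγ, e⟩ := (mem_cuspOrbit_iff h σ x y).mp hy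
  refine exists_signedRow_eq h (σ.mat x) hcop hγ ?_
  beta_reduce at hyw
  rw [e] at hyw
  exact (A.lift_mk_eq_or _).imp (fun e' => by rw [hyw, e']) (fun e' => by rw [hyw, e'])

open Classical in
theorem primTerm_botRow (k : ℕ) {N : ℕ} (L : Set (Lat N)) (τ : ℍ) (s : ℂ) (m : SL(2, ℤ)) :
    primTerm k L τ s (botRow m) =
      if (Lat.base N).act m ∈ L then eisTerm k τ s (botRow m) else 0 := by
  have hiff : (∃ v ∈ L, (fun i => (botRow m i : ZMod N)) = v.val) ↔ (Lat.base N).act m ∈ L := by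
    rw [base_act_val']
    exact ⟨fun ⟨v, hv, e⟩ => Lat.ext e ▸ hv, fun hv => ⟨_, hv, rfl⟩⟩
  simp only [primTerm, hiff, isCoprime_botRow m, and_true]

/-- The two primitive vectors attached to a coset, those in the classes above the cusp being
counted with weight `ε_N`, contribute the term of the spectral series at this coset. -/
theorem epsN_mul_primTerm_add {k N : ℕ} [NeZero N] {𝒢 : Subgroup SL(2, ℤ)}
    (h : CongruenceSubgroup.Gamma N ≤ 𝒢) {A : SignReps N} {σ : ScalingChoice 𝒢}
    (hodd : Odd k → -1 ∉ 𝒢 ∧ A.IsAdmissible 𝒢 ∧ σ.IsCompatible A)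
    {x : Cusp 𝒢} (hx : Odd k → IsRegularCusp x) (τ : ℍ) (s : ℂ) {γ : SL(2, ℤ)} (hγ : γ ∈ 𝒢) :
    epsN N * (primTerm k (orbitClasses h A x) τ s (botRow ((σ.mat x)⁻¹ * γ)) +
      primTerm k (orbitClasses h A x) τ s (-botRow ((σ.mat x)⁻¹ * γ))) =
        eisTerm k τ s (botRow ((σ.mat x)⁻¹ * γ)) := by
  classical
  obtain ⟨v, hv⟩ : ∃ v, (Lat.base N).act ((σ.mat x)⁻¹ * γ) = v := ⟨_, rfl⟩
  have hsub := orbitClasses_subset h A x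
  have hlift : A.lift (LatPM.mk v) ∈ orbitClasses h A x := by
    obtain ⟨y, hy⟩ := phi_surjective N (LatPM.mk v)
    exact ⟨y, (mem_cuspOrbit_iff h σ x y).mpr ⟨γ, hγ, by rw [hy, hv]⟩, by
      beta_reduce; rw [hy]⟩
  -- Only one representative per sign class lies in 𝒜, so v and -v can both occur only if they are
  -- equal.
  have hboth : v ∈ orbitClasses h A x → -v ∈ orbitClasses h A x → N ≤ 2 := fun h1 h2 => by
    refine (Lat.neg_eq_self_iff v).mp ?_
    calc -v = A.lift (LatPM.mk (-v)) := (A.lift_mk (hsub h2)).symm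
      _ = A.lift (LatPM.mk v) := by rw [LatPM.mk_neg]
      _ = v := A.lift_mk (hsub h1)
  rw [← botRow_neg, primTerm_botRow, primTerm_botRow, Lat.act_neg, hv, botRow_neg, eisTerm_neg,
    epsN]
  rcases Nat.even_or_odd k with hk | hk
  · rw [hk.neg_one_pow, one_mul]
    -- For even k: if N ≤ 2 both signs are counted and ε_N = 1/2 compensates; if N ≥ 3 exactly one
    -- sign is counted, and evenness makes its identity irrelevant.
    by_cases hN : N ≤ 2
    · have hneg := (Lat.neg_eq_self_iff v).mpr hN
      have hmem : v ∈ orbitClasses h A x := by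
        rcases A.lift_mk_eq_or v with e | e
        · rwa [e] at hlift
        · rwa [e, hneg] at hlift
      rw [hneg, if_pos hmem, if_pos hN]
      ring
    · rw [if_neg hN, one_mul]
      rcases A.lift_mk_eq_or v with e | e
      · rw [e] at hlift
        rw [if_pos hlift, if_neg fun h' => hN (hboth hlift h'), add_zero]
      · rw [e] at hlift
        rw [if_pos hlift, if_neg fun h' => hN (hboth h' hlift), zero_add]
  -- For odd k the sign matters: compatibility and admissibility ensure that v itself, not -v, is
  -- counted, and regularity excludes N ≤ 2.
  · obtain ⟨h1, hadm, hcomp⟩ := hodd hk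
    have hx := hx hk
    have hvO : v ∈ orbitOfCusp A σ x := by
      rw [orbitOfCusp_eq hcomp hx, ← hv]
      exact ⟨γ, hγ, Lat.act_mul _ _ _⟩
    rw [A.lift_mk (orbitOfCusp_subset h h1 hadm hcomp hx hvO)] at hlift
    have hN : ¬N ≤ 2 := fun hN => isRegularOrbit_orbitOfCusp h h1 hcomp hx v hvO
      (by rwa [(Lat.neg_eq_self_iff v).mpr hN])
    rw [if_pos hlift, if_neg fun h' => hN (hboth hlift h'), if_neg hN, one_mul, add_zero]

/-- The spectral series as a sum over the primitive vectors in the classes attached to the cusps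
of `Γ(N)` above a cusp. -/
theorem seriesE_eq_finsum_primG {k N : ℕ} [NeZero N] {𝒢 : Subgroup SL(2, ℤ)}
    (h : CongruenceSubgroup.Gamma N ≤ 𝒢) {A : SignReps N} {σ : ScalingChoice 𝒢}
    (hodd : Odd k → -1 ∉ 𝒢 ∧ A.IsAdmissible 𝒢 ∧ σ.IsCompatible A)
    {x : Cusp 𝒢} (hx : Odd k → IsRegularCusp x) (τ : ℍ) {s : ℂ}
    (hs : 2 < ((k : ℂ) + 2 * s).re) :
    seriesE k 𝒢 (σ.mat x) τ s =
      epsN N * ∑ᶠ y ∈ cuspOrbit h x, primG k (A.lift (phi N y)) τ s := by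
  have hsum : Summable fun q => primTerm k (orbitClasses h A x) τ s
      (signedRow (𝒢 := 𝒢) (σ.mat x) q) :=
    (summable_primTerm _ τ hs).comp_injective (signedRow_injective 𝒢 (σ.mat x))
  rw [finsum_primG_eq_tsum h A x τ hs, ← (signedRow_injective 𝒢 (σ.mat x)).tsum_eq
    (support_primTerm_subset k h A σ x τ s), hsum.tsum_prod, ← tsum_mul_left, seriesE]
  refine tsum_congr fun q => ?_
  rw [seriesE_term, ← epsN_mul_primTerm_add h hodd hx τ s q.out.2, tsum_bool, add_comm]
  rfl

/-! ### Continuation and the two identities -/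

theorem IsContinuation.continuation {k : ℕ} {f F : ℂ → ℂ} (hF : IsContinuation k f F) :
    IsContinuation k f (continuation k f) :=
  Classical.epsilon_spec ⟨F, hF⟩

/-- A continuation is determined on the whole half-plane by the function it continues. -/
theorem IsContinuation.eqOn {k : ℕ} {f F G : ℂ → ℂ} (hF : IsContinuation k f F)
    (hG : IsContinuation k f G) {s : ℂ} (hs : 1 < ((k : ℂ) + 2 * s).re) : F s = G s := by
  have hconv : Convex ℝ {s : ℂ | 1 < ((k : ℂ) + 2 * s).re} := by
    intro a ha b hb u v hu hv huv
    simp only [Set.mem_ofPred_eq, Complex.add_re, Complex.mul_re, Complex.re_ofNat,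
      Complex.im_ofNat, Complex.natCast_re, zero_mul, sub_zero, Complex.real_smul,
      Complex.ofReal_re, Complex.ofReal_im] at ha hb ⊢
    obtain rfl : v = 1 - u := by linarith
    rcases hu.eq_or_lt with rfl | hu
    · linarith
    · nlinarith
  -- Re(k+4) > 2 for every k ≥ 0, so 2 is a base point in the region where both functions agree with
  -- the series.
  have hmem : (2 : ℂ) ∈ {s : ℂ | 2 < ((k : ℂ) + 2 * s).re} := by
    simp only [Set.mem_ofPred_eq, Complex.add_re, Complex.mul_re, Complex.re_ofNat,
      Complex.im_ofNat, Complex.natCast_re]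
    have : (0 : ℝ) ≤ k := k.cast_nonneg
    linarith
  refine hF.analytic.eqOn_of_preconnected_of_eventuallyEq hG.analytic hconv.isPreconnected
    (z₀ := 2) (one_lt_two.trans (Set.mem_ofPred_eq.mp hmem)) ?_ hs
  filter_upwards [(isOpen_halfPlane k 2).mem_nhds hmem] with z hz
  rw [hF.eq z hz, hG.eq z hz]

theorem exists_continuation_seriesG {k : ℕ} (hk : 2 ≤ k) {N : ℕ} [NeZero N]
    {𝒢 : Subgroup SL(2, ℤ)} (h : CongruenceSubgroup.Gamma N ≤ 𝒢) (A : SignReps N) (x : Cusp 𝒢)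
    (τ : ℍ) : ∃ F, IsContinuation k (seriesG k h A x τ) F := by
  choose F hF using fun v : Lat N => exists_continuation_levelG hk v τ
  refine ⟨fun s => ∑ y ∈ (Set.toFinite (cuspOrbit h x)).toFinset, F (A.lift (phi N y)) s, ?_,
    fun s hs => ?_⟩
  · exact Finset.analyticOnNhd_fun_sum _ fun y _ => (hF _).analytic
  · rw [seriesG, finsum_mem_eq_finite_toFinset_sum _ (Set.toFinite (cuspOrbit h x))]
    exact Finset.sum_congr rfl fun y _ => (hF _).eq s hs

theorem isContinuation_unnormG {k : ℕ} (hk : 2 ≤ k) {N : ℕ} [NeZero N]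
    {𝒢 : Subgroup SL(2, ℤ)} (h : CongruenceSubgroup.Gamma N ≤ 𝒢) (A : SignReps N) (x : Cusp 𝒢)
    (τ : ℍ) : IsContinuation k (seriesG k h A x τ) (unnormG k h A x τ) :=
  (exists_continuation_seriesG hk h A x τ).choose_spec.continuation

theorem finsum_sum_scale {k N : ℕ} [NeZero N] {𝒢 : Subgroup SL(2, ℤ)}
    (h : CongruenceSubgroup.Gamma N ≤ 𝒢) {A : SignReps N} {σ : ScalingChoice 𝒢}
    (hodd : Odd k → -1 ∉ 𝒢 ∧ A.IsAdmissible 𝒢 ∧ σ.IsCompatible A)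
    {x : Cusp 𝒢} (hx : Odd k → IsRegularCusp x) {g : Lat N → ℂ}
    (hg : ∀ v, g (-v) = (-1) ^ k * g v) (c : (ZMod N)ˣ → ℂ) :
    ∑ᶠ y ∈ cuspOrbit h x, ∑ δ, c δ * g ((A.lift (phi N y)).scale δ⁻¹) =
      ∑ δ, cuspSign h A σ x δ ^ k * c δ *
        ∑ᶠ y ∈ cuspOrbit h (unitAct h δ⁻¹ x), g (A.lift (phi N y)) := by
  rw [finsum_mem_eq_finite_toFinset_sum _ (Set.toFinite (cuspOrbit h x)), Finset.sum_comm]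
  refine Finset.sum_congr rfl fun δ _ => ?_
  rw [← Finset.mul_sum, ← finsum_mem_eq_finite_toFinset_sum
    (fun y => g ((A.lift (phi N y)).scale δ⁻¹)) (Set.toFinite (cuspOrbit h x)),
    finsum_scale h hodd hx hg δ]
  ring

theorem seriesE_eq_sum_seriesG {k N : ℕ} [NeZero N] {𝒢 : Subgroup SL(2, ℤ)}
    (h : CongruenceSubgroup.Gamma N ≤ 𝒢) {A : SignReps N} {σ : ScalingChoice 𝒢}
    (hodd : Odd k → -1 ∉ 𝒢 ∧ A.IsAdmissible 𝒢 ∧ σ.IsCompatible A)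
    {x : Cusp 𝒢} (hx : Odd k → IsRegularCusp x) (τ : ℍ) {s : ℂ}
    (hs : 2 < ((k : ℂ) + 2 * s).re) :
    seriesE k 𝒢 (σ.mat x) τ s =
      epsN N * ∑ δ : (ZMod N)ˣ, cuspSign h A σ x δ ^ k * zetaPlusMu δ (k + 2 * s) *
        seriesG k h A (unitAct h δ⁻¹ x) τ s := by
  rw [seriesE_eq_finsum_primG h hodd hx τ hs]
  simp_rw [primG_eq_sum_levelG _ τ hs]
  rw [finsum_sum_scale h hodd hx (g := fun v => levelG k v τ s) (fun v => levelG_neg k v τ s)]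
  rfl

theorem epsN_ne_zero (N : ℕ) : epsN N ≠ 0 := by
  rw [epsN]
  split_ifs <;> norm_num

theorem seriesG_eq_sum_seriesE {k N : ℕ} [NeZero N] {𝒢 : Subgroup SL(2, ℤ)}
    (h : CongruenceSubgroup.Gamma N ≤ 𝒢) {A : SignReps N} {σ : ScalingChoice 𝒢}
    (hodd : Odd k → -1 ∉ 𝒢 ∧ A.IsAdmissible 𝒢 ∧ σ.IsCompatible A)
    {x : Cusp 𝒢} (hx : Odd k → IsRegularCusp x) (τ : ℍ) {s : ℂ}
    (hs : 2 < ((k : ℂ) + 2 * s).re) :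
    seriesG k h A x τ s =
      (epsN N)⁻¹ * ∑ δ : (ZMod N)ˣ, cuspSign h A σ x δ ^ k * zetaPlus δ (k + 2 * s) *
        seriesE k 𝒢 (σ.mat (unitAct h δ⁻¹ x)) τ s := by
  rw [seriesG]
  simp_rw [levelG_eq_sum_primG _ τ hs]
  rw [finsum_sum_scale h hodd hx (g := fun v => primG k v τ s) (fun v => primG_neg k v τ s),
    Finset.mul_sum]
  refine Finset.sum_congr rfl fun δ _ => ?_
  rw [seriesE_eq_finsum_primG h hodd
    (fun hk => isRegularCusp_unitAct h (hodd hk).1 (hx hk) δ⁻¹) τ hs]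
  field_simp [epsN_ne_zero N]

theorem isContinuation_sum {k N : ℕ} [NeZero N] (c : ℂ) (e : (ZMod N)ˣ → ℂ)
    {z f F : (ZMod N)ˣ → ℂ → ℂ}
    (hz : ∀ δ, AnalyticOnNhd ℂ (fun s => z δ (k + 2 * s)) {s | 1 < ((k : ℂ) + 2 * s).re})
    (hF : ∀ δ, IsContinuation k (f δ) (F δ)) :
    IsContinuation k (fun s => c * ∑ δ, e δ * z δ (k + 2 * s) * f δ s)
      (fun s => c * ∑ δ, e δ * z δ (k + 2 * s) * F δ s) where
  analytic := analyticOnNhd_const.mul <| Finset.analyticOnNhd_fun_sum _ fun δ _ =>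
    (analyticOnNhd_const.mul (hz δ)).mul (hF δ).analytic
  eq s hs := by simp only [fun δ => (hF δ).eq s hs]

theorem IsContinuation.congr {k : ℕ} {f g F : ℂ → ℂ} (hF : IsContinuation k f F)
    (hfg : ∀ s : ℂ, 2 < ((k : ℂ) + 2 * s).re → g s = f s) : IsContinuation k g F :=
  ⟨hF.analytic, fun s hs => (hF.eq s hs).trans (hfg s hs).symm⟩

/-- The spectral series gets its continuation from the Möbius formula, as a finite combination of
already continued G with coefficients analytic for Re(k+2s) > 1. -/
theorem isContinuation_seriesE {k : ℕ} (hk : 2 ≤ k) {N : ℕ} [NeZero N] {𝒢 : Subgroup SL(2, ℤ)}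
    (h : CongruenceSubgroup.Gamma N ≤ 𝒢) {A : SignReps N} {σ : ScalingChoice 𝒢}
    (hodd : Odd k → -1 ∉ 𝒢 ∧ A.IsAdmissible 𝒢 ∧ σ.IsCompatible A)
    {x : Cusp 𝒢} (hx : Odd k → IsRegularCusp x) (τ : ℍ) :
    IsContinuation k (seriesE k 𝒢 (σ.mat x) τ) fun s =>
      epsN N * ∑ δ : (ZMod N)ˣ, cuspSign h A σ x δ ^ k * zetaPlusMu δ (k + 2 * s) *
        unnormG k h A (unitAct h δ⁻¹ x) τ s :=
  (isContinuation_sum _ _ (analyticOnNhd_zetaPlusMu k) fun δ =>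
    isContinuation_unnormG hk h A (unitAct h δ⁻¹ x) τ).congr fun _ hs =>
      seriesE_eq_sum_seriesG h hodd hx τ hs

/-- This second continuation of G is compared with `unnormG` by uniqueness, which yields the first
identity beyond the region of convergence. -/
theorem isContinuation_seriesG {k : ℕ} (hk : 2 ≤ k) {N : ℕ} [NeZero N] {𝒢 : Subgroup SL(2, ℤ)}
    (h : CongruenceSubgroup.Gamma N ≤ 𝒢) {A : SignReps N} {σ : ScalingChoice 𝒢}
    (hodd : Odd k → -1 ∉ 𝒢 ∧ A.IsAdmissible 𝒢 ∧ σ.IsCompatible A)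
    {x : Cusp 𝒢} (hx : Odd k → IsRegularCusp x) (τ : ℍ) :
    IsContinuation k (seriesG k h A x τ) fun s =>
      (epsN N)⁻¹ * ∑ δ : (ZMod N)ˣ, cuspSign h A σ x δ ^ k * zetaPlus δ (k + 2 * s) *
        spectralE k σ (unitAct h δ⁻¹ x) τ s :=
  (isContinuation_sum _ _ (analyticOnNhd_zetaPlus k) fun δ =>
    (isContinuation_seriesE hk h hodd (x := unitAct h δ⁻¹ x)
      (fun hk => isRegularCusp_unitAct h (hodd hk).1 (hx hk) δ⁻¹) τ).continuation).congr
    fun _ hs => seriesG_eq_sum_seriesE h hodd hx τ hs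

end CongEis

theorem proposition5p1 (k : ℕ) (hk : 2 ≤ k) (N : ℕ) [NeZero N]
    (𝒢 : Subgroup (Matrix.SpecialLinearGroup (Fin 2) ℤ))
    (h : CongruenceSubgroup.Gamma N ≤ 𝒢)
    (A : CongEis.SignReps N) (σ : CongEis.ScalingChoice 𝒢)
    (hodd : Odd k → -1 ∉ 𝒢 ∧ A.IsAdmissible 𝒢 ∧ σ.IsCompatible A) :
    (∀ x : CongEis.Cusp 𝒢, (Odd k → CongEis.IsRegularCusp x) → ∀ τ : UpperHalfPlane,
      CongEis.IsContinuation k (CongEis.seriesG k h A x τ) (CongEis.unnormG k h A x τ) ∧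
      CongEis.IsContinuation k (CongEis.seriesE k 𝒢 (σ.mat x) τ) (CongEis.spectralE k σ x τ)) ∧
    ∀ x : CongEis.Cusp 𝒢, (Odd k → CongEis.IsRegularCusp x) →
      ∀ (τ : UpperHalfPlane) (s : ℂ), 1 < ((k : ℂ) + 2 * s).re →
        CongEis.unnormG k h A x τ s =
          (CongEis.epsN N)⁻¹ * ∑ δ : (ZMod N)ˣ, CongEis.cuspSign h A σ x δ ^ k *
            CongEis.zetaPlus δ (k + 2 * s) *
              CongEis.spectralE k σ (CongEis.unitAct h δ⁻¹ x) τ s ∧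
        CongEis.spectralE k σ x τ s =
          CongEis.epsN N * ∑ δ : (ZMod N)ˣ, CongEis.cuspSign h A σ x δ ^ k *
            CongEis.zetaPlusMu δ (k + 2 * s) *
              CongEis.unnormG k h A (CongEis.unitAct h δ⁻¹ x) τ s := by
  exact ⟨fun x hx τ => ⟨CongEis.isContinuation_unnormG hk h A x τ,
      (CongEis.isContinuation_seriesE hk h hodd hx τ).continuation⟩, fun x hx τ s hs =>
    ⟨(CongEis.isContinuation_unnormG hk h A x τ).eqOn
        (CongEis.isContinuation_seriesG hk h hodd hx τ) hs,
      (CongEis.isContinuation_seriesE hk h hodd hx τ).continuation.eqOn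
        (CongEis.isContinuation_seriesE hk h hodd hx τ) hs⟩⟩
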